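/- Let $\mathbb{T}=\mathbb{R}/2\pi\mathbb{Z}$ and consider the Zakharov--Kuznetsov equation $$\partial_t u+\partial_{xxx}u+3\,\partial_x\partial_{yy}u=u\,\partial_x u\qquad\text{on }[0,T]\times\mathbb{T}^2. \tag{ZK}$$ Put $\varphi(k)=k_1^3+3k_1k_2^2$ for $k\in\mathbb{Z}^2$. For a dyadic number $N\in\{1,2,4,\dots\}$ let $P_N$ be the Fourier projection onto the frequencies $k\in\mathbb{Z}^2$ with $N\le|k|<2N$ if $N\ge2$, and $|k|<2$ if $N=1$. For an interval $I=[a,b)$, a $U^2(I)$-atom is a step function $\sum_{m=1}^{K}\phi_{m-1}\chi_{[t_{m-1},t_m)}$ with $a=t_0<\dots<t_K=b$, $\phi_m\in L^2(\mathbb{T}^2;\mathbb{C})$ and $\sum_m\|\phi_m\|_{L^2}^2=1$; let $$\|f\|_{U^2(I)}=\inf\Big\{\sum_n|\lambda_n| : f(t)=\sum_{n}\lambda_na_n(t)\ \text{for all } t\in I,\ a_n\ U^2(I)\text{-atoms}\Big\},\qquad \|u\|_{U^2_\varphi(I)}=\|e^{-it\varphi(\nabla/i)}u\|_{U^2(I)}.$$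 For $\sigma\in\mathbb{R}$ let $\|f\|_{H^\sigma}^2=\sum_{k}(1+|k|^2)^{\sigma}|\hat f(k)|^2$ and $$\|u\|_{E^\sigma(T)}^2=\sum_{N}N^{2\sigma}\sup_{t\in[0,T]}\|P_Nu(t)\|_{L^2}^2,\qquad \|u\|_{F^\sigma(T)}^2=\sum_{N}N^{2\sigma}\sup_{|I|=N^{-2}}\|P_Nu\|_{U^2_\varphi(I\cap[0,T))}^2,$$ where the last supremum is over the intervals $I=[a,a+N^{-2})$ that meet $[0,T)$. **Proposition.** Let $s>3/2$. There is a constant $C=C(s)$ such that the following holds for every $T\in(0,1]$. (a) If $u$ is a smooth real-valued solution to (ZK) on $[0,T]\times\mathbb{T}^2$, then $$\|u\|_{E^s(T)}^2\le C\big(\|u(0)\|_{H^s}^2+\|u\|_{F^s(T)}^3\big).$$ (b) If $u_1,u_2$ are smooth real-valued solutions to (ZK) on $[0,T]\times\mathbb{T}^2$ and $v=u_1-u_2$, then $$\|v\|_{E^0(T)}^2\le C\big(\|v(0)\|_{L^2}^2+\|v\|_{F^0(T)}^2(\|u_1\|_{F^s(T)}+\|u_2\|_{F^s(T)})\big)$$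 and $$\|v\|_{E^s(T)}^2\le C\big(\|v(0)\|_{H^s}^2+\|v\|_{F^s(T)}^3+\|v\|_{F^s(T)}^2\|u_2\|_{F^s(T)}+\|v\|_{F^0(T)}\|v\|_{F^s(T)}\|u_2\|_{F^{2s}(T)}\big).$$ -/

import Mathlib

open MeasureTheory Set
open scoped ENNReal NNReal ContDiff

noncomputable section

namespace ZK

instance fact_two_pi_pos : Fact (0 < 2 * Real.pi) := ⟨Real.two_pi_pos⟩

/-- The circle `ℝ / 2πℤ`. -/
abbrev Circle1 : Type := AddCircle (2 * Real.pi)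

/-- The two-dimensional torus `(ℝ / 2πℤ)²`. -/
abbrev Torus : Type := Circle1 × Circle1

/-- Normalized Lebesgue measure `dx dy / (2π)²` on the torus. -/
abbrev torusMeasure : Measure Torus :=
  (AddCircle.haarAddCircle : Measure Circle1).prod AddCircle.haarAddCircle

/-- The Hilbert space `L²(𝕋²; ℂ)`. -/
abbrev L2 : Type := Lp ℂ 2 torusMeasure

/-- The character `(x, y) ↦ exp (i (k₁ x + k₂ y))` as a continuous function on the torus. -/
def character (k : ℤ × ℤ) : C(Torus, ℂ) where
  toFun p := fourier k.1 p.1 * fourier k.2 p.2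
  continuous_toFun := by fun_prop

/-- The character with frequency `k` as an element of `L²(𝕋²)`. -/
def characterL2 (k : ℤ × ℤ) : L2 := ContinuousMap.toLp 2 torusMeasure ℂ (character k)

/-- The Fourier coefficient `(2π)⁻² ∫ f(x, y) exp (-i (k₁ x + k₂ y)) dx dy`. -/
def coeff (f : Torus → ℝ) (k : ℤ × ℤ) : ℂ :=
  ∫ p, starRingEnd ℂ (character k p) * (f p : ℂ) ∂torusMeasure

/-- The frequencies in the dyadic annulus of `N = 2 ^ j`:
`N ≤ |k| < 2 N` if `j ≥ 1`, and `|k| < 2` if `j = 0`, with `|k|` the Euclidean length. -/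
def annulus (j : ℕ) : Finset (ℤ × ℤ) :=
  (Finset.Icc (-2 ^ (j + 1)) (2 ^ (j + 1)) ×ˢ Finset.Icc (-2 ^ (j + 1)) (2 ^ (j + 1))).filter
    fun k => (j = 0 ∨ (2 ^ j) ^ 2 ≤ k.1 ^ 2 + k.2 ^ 2) ∧ k.1 ^ 2 + k.2 ^ 2 < (2 ^ (j + 1)) ^ 2

/-- The box in the definition of `annulus` does not cut off anything. -/
theorem mem_annulus (j : ℕ) (k : ℤ × ℤ) : k ∈ annulus j ↔
    (j = 0 ∨ (2 ^ j) ^ 2 ≤ k.1 ^ 2 + k.2 ^ 2) ∧ k.1 ^ 2 + k.2 ^ 2 < (2 ^ (j + 1)) ^ 2 := by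
  simp only [annulus, Finset.mem_filter, Finset.mem_product, Finset.mem_Icc,
    and_iff_right_iff_imp]
  rintro ⟨-, h⟩
  have hp : (0 : ℤ) ≤ 2 ^ (j + 1) := by positivity
  have h1 : k.1 ^ 2 ≤ (2 ^ (j + 1)) ^ 2 := by nlinarith [sq_nonneg k.2]
  have h2 : k.2 ^ 2 ≤ (2 ^ (j + 1)) ^ 2 := by nlinarith [sq_nonneg k.1]
  exact ⟨abs_le.mp (abs_le_of_sq_le_sq h1 hp), abs_le.mp (abs_le_of_sq_le_sq h2 hp)⟩

/-- The Littlewood-Paley projection `P_N f`, `N = 2 ^ j`, as an element of `L²(𝕋²)`. -/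
def proj (j : ℕ) (f : Torus → ℝ) : L2 := ∑ k ∈ annulus j, coeff f k • characterL2 k

/-- The dispersion relation of the linear equation `∂ₜ u + ∂ₓₓₓ u + 3 ∂ₓ ∂_yy u = 0`,
whose solutions are `exp (i t φ(∇ / i)) u(0)`. -/
def phase (k : ℤ × ℤ) : ℝ := (k.1 : ℝ) ^ 3 + 3 * (k.1 : ℝ) * (k.2 : ℝ) ^ 2

/-- `exp (-i t φ(∇ / i)) P_N f` with `N = 2 ^ j`. -/
def backProj (j : ℕ) (t : ℝ) (f : Torus → ℝ) : L2 :=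
  ∑ k ∈ annulus j, (Complex.exp (-(Complex.I * t * phase k)) * coeff f k) • characterL2 k

/-- `U²([a, b); H)`-atoms: step functions `∑ φ_m χ_[t_m, t_(m+1))` over a finite partition
`a = t_0 < ... < t_K = b`, with `∑ ‖φ_m‖² = 1`. -/
def IsU2Atom {H : Type*} [NormedAddCommGroup H] (a b : ℝ) (f : ℝ → H) : Prop :=
  ∃ (K : ℕ) (t : Fin (K + 1) → ℝ) (φ : Fin K → H),
    StrictMono t ∧ t 0 = a ∧ t (Fin.last K) = b ∧ ∑ m, ‖φ m‖ ^ 2 = 1 ∧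
    ∀ τ, f τ = ∑ m : Fin K, (Ico (t m.castSucc) (t m.succ)).indicator (fun _ => φ m) τ

/-- The norm of `U²([a, b); H)` for `a < b`, with value `∞` off the space. Only the values of `f`
on `[a, b)` matter. -/
def U2norm {H : Type*} [NormedAddCommGroup H] [NormedSpace ℂ H] (a b : ℝ) (f : ℝ → H) : ℝ≥0∞ :=
  ⨅ (c : ℕ → ℂ) (A : ℕ → ℝ → H) (_ : ∀ n, IsU2Atom a b (A n))
    (_ : ∀ τ ∈ Ico a b, HasSum (fun n => c n • A n τ) (f τ)), ∑' n, ‖c n‖ₑ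

/-- The Sobolev norm `(∑ (1 + |k|²)^s |f̂(k)|²)^(1/2)`. -/
def Hnorm (s : ℝ) (f : Torus → ℝ) : ℝ≥0∞ :=
  (∑' k : ℤ × ℤ, ENNReal.ofReal ((1 + (k.1 : ℝ) ^ 2 + (k.2 : ℝ) ^ 2) ^ s) * ‖coeff f k‖ₑ ^ 2)
    ^ (1 / 2 : ℝ)

/-- The norm of `L²(𝕋²)`. -/
def L2norm (f : Torus → ℝ) : ℝ≥0∞ := eLpNorm f 2 torusMeasure

/-- The energy norm `E^s(T)`:
`‖u‖² = ∑_N N^(2s) sup_{t ∈ [0, T]} ‖P_N u(t)‖²`, `N = 2 ^ j`. -/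
def Enorm (s T : ℝ) (u : ℝ → Torus → ℝ) : ℝ≥0∞ :=
  (∑' j : ℕ, ((2 : ℝ≥0∞) ^ j) ^ (2 * s) * ⨆ t ∈ Icc 0 T, ‖proj j (u t)‖ₑ ^ 2) ^ (1 / 2 : ℝ)

/-- The short-time norm `F^s(T)`:
`‖u‖² = ∑_N N^(2s) sup_{|I| = N⁻²} ‖P_N u‖²` with the norm of `U²_φ(I ∩ [0, T); L²)`, `N = 2 ^ j`.
The intervals `I = [a, a + N⁻²)` with `a ∈ [0, T)` are enough: if `a < 0`, then `I ∩ [0, T)` is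
empty or an initial part of `[0, N⁻²) ∩ [0, T)`. -/
def Fnorm (s T : ℝ) (u : ℝ → Torus → ℝ) : ℝ≥0∞ :=
  (∑' j : ℕ, ((2 : ℝ≥0∞) ^ j) ^ (2 * s) *
    ⨆ a ∈ Ico 0 T, U2norm a (min (a + ((2 : ℝ) ^ j)⁻¹ ^ 2) T) (fun t => backProj j t (u t)) ^ 2)
    ^ (1 / 2 : ℝ)

/-- Smooth real-valued solutions of `∂ₜ u + ∂ₓₓₓ u + 3 ∂ₓ ∂_yy u = u ∂ₓ u` on `[0, T] × 𝕋²`;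
the time derivative is one-sided at the end points. -/
structure IsSmoothSolution (T : ℝ) (u : ℝ → Torus → ℝ) : Prop where
  smooth : ContDiffOn ℝ ∞ (fun q : ℝ × ℝ × ℝ => u q.1 ((q.2.1 : Circle1), (q.2.2 : Circle1)))
    (Icc 0 T ×ˢ univ)
  equation : ∀ t ∈ Icc 0 T, ∀ x y : ℝ,
    derivWithin (fun τ : ℝ => u τ ((x : Circle1), (y : Circle1))) (Icc 0 T) t
      + iteratedDeriv 3 (fun x' : ℝ => u t ((x' : Circle1), (y : Circle1))) x
      + 3 * deriv (fun x' : ℝ =>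
          iteratedDeriv 2 (fun y' : ℝ => u t ((x' : Circle1), (y' : Circle1))) y) x
    = u t ((x : Circle1), (y : Circle1)) *
        deriv (fun x' : ℝ => u t ((x' : Circle1), (y : Circle1))) x

end ZK

end

/-!
The time derivative of the energy of a solution at frequency `N` is a cubic form, a sum over
resonant frequencies `p + q + r = 0`; the dispersive part drops out, being imaginary. Its symbol
`k ↦ ψ(k / N) k₁` is Lipschitz for a Lipschitz cutoff `ψ`, and odd, so that symmetrization moves
the derivative onto the lowest of the three frequencies. The equation
`∂ₜ v + ∂ₓₓₓ v + 3 ∂ₓ ∂_yy v = ½ ∂ₓ (z v)` of a difference `v = u₁ - u₂`, with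
`z = u₁ + u₂ = v + 2 u₂`, allows only symmetrization in the two factors `v`, which moves the
derivative onto the frequency of `z`.

In the diagonal coordinates `k₁ ± k₂` the dispersion relation separates,
`2 φ(k) = (k₁ + k₂)³ + (k₁ - k₂)³`. If `p + q + r = 0` and the largest frequency has size `N`, then
`p` and one of `q`, `r` have group velocities differing by `N²` in one of these coordinates. The
resonance function is then well separated on each line in the other coordinate, and `p` of size
`M` meets `O(M)` such lines. By almost orthogonality, the `L²` norm of the product of the
corresponding free solutions over a time interval of length `N⁻²` is `O(M ^ (1 / 2) N⁻¹)`, which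
carries over to `U²`. Hölder's inequality in time gives `M ^ (1 / 2) N⁻²` for the trilinear
integral, hence `M ^ (1 / 2)` after summation over the `O(N²)` intervals that cover `[0, T)`.
With the derivative on the lowest frequency the total loss is `M ^ (3 / 2)`, summable against
`M ^ (-s)` for `s > 3 / 2`.
-/

noncomputable section

namespace ZK

/-! ### Almost orthogonality of exponential sums -/

theorem exp_neg_abs_mul_exp_of_nonneg (δ x : ℝ) {t : ℝ} (ht : 0 ≤ t) :
    (Real.exp (-|t| / δ) : ℂ) * Complex.exp (Complex.I * t * x)
      = Complex.exp ((-(1 / δ) + Complex.I * x) * t) := by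
  rw [abs_of_nonneg ht, Complex.ofReal_exp, ← Complex.exp_add]
  congr 1
  push_cast
  ring

theorem exp_neg_abs_mul_exp_of_nonpos (δ x : ℝ) {t : ℝ} (ht : t ≤ 0) :
    (Real.exp (-|t| / δ) : ℂ) * Complex.exp (Complex.I * t * x)
      = Complex.exp ((1 / δ + Complex.I * x) * t) := by
  rw [abs_of_nonpos ht, Complex.ofReal_exp, ← Complex.exp_add]
  congr 1
  push_cast
  ring

theorem integrable_exp_neg_abs_mul_exp {δ : ℝ} (hδ : 0 < δ) (x : ℝ) :
    Integrable fun t : ℝ => (Real.exp (-|t| / δ) : ℂ) * Complex.exp (Complex.I * t * x) := by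
  rw [← integrableOn_univ, ← Iic_union_Ioi (a := (0 : ℝ))]
  refine ((integrableOn_exp_mul_complex_Iic (a := 1 / δ + Complex.I * x)
    (by simp [← Complex.ofReal_inv, hδ]) 0).congr_fun (fun t ht => ?_) measurableSet_Iic).union
    ((integrableOn_exp_mul_complex_Ioi (a := -(1 / δ) + Complex.I * x)
    (by simp [← Complex.ofReal_inv, hδ]) 0).congr_fun (fun t ht => ?_) measurableSet_Ioi)
  · exact (exp_neg_abs_mul_exp_of_nonpos δ x ht).symm
  · exact (exp_neg_abs_mul_exp_of_nonneg δ x (le_of_lt ht)).symm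

theorem integral_exp_neg_abs_mul_exp {δ : ℝ} (hδ : 0 < δ) (x : ℝ) :
    ∫ t : ℝ, (Real.exp (-|t| / δ) : ℂ) * Complex.exp (Complex.I * t * x)
      = ((2 * δ / (1 + (δ * x) ^ 2) : ℝ) : ℂ) := by
  have hint := integrable_exp_neg_abs_mul_exp hδ x
  rw [← intervalIntegral.integral_Iic_add_Ioi hint.integrableOn hint.integrableOn,
    setIntegral_congr_fun measurableSet_Iic fun t ht => exp_neg_abs_mul_exp_of_nonpos δ x ht,
    setIntegral_congr_fun measurableSet_Ioi fun t ht =>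
      exp_neg_abs_mul_exp_of_nonneg δ x (le_of_lt ht),
    integral_exp_mul_complex_Iic (by simp [← Complex.ofReal_inv, hδ]),
    integral_exp_mul_complex_Ioi (by simp [← Complex.ofReal_inv, hδ])]
  have hδ' : (δ : ℂ) ≠ 0 := by exact_mod_cast hδ.ne'
  have hprod : (1 + δ * (Complex.I * x)) * (1 - δ * (Complex.I * x)) = 1 + (δ * x : ℂ) ^ 2 := by
    linear_combination -(δ * x : ℂ) ^ 2 * Complex.I_sq
  have hne : (1 + (δ * x : ℂ) ^ 2) ≠ 0 := by
    exact_mod_cast (by positivity : (1 + (δ * x) ^ 2 : ℝ) ≠ 0)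
  obtain ⟨hplus, hminus⟩ := mul_ne_zero_iff.mp (hprod ▸ hne)
  have hleft : (1 / δ + Complex.I * x : ℂ) = (1 + δ * (Complex.I * x)) / δ := by
    field_simp
  have hright : (-(1 / δ) + Complex.I * x : ℂ) = -((1 - δ * (Complex.I * x)) / δ) := by
    field_simp
    ring
  push_cast
  rw [hleft, hright, ← hprod, mul_zero, mul_zero, Complex.exp_zero, neg_div_neg_eq,
    one_div_div, one_div_div, div_add_div _ _ hplus hminus]
  ring

/-- The points `x p`, `p ∈ P`, are separated on the scale `δ⁻¹`, up to a multiplicity `L`: the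
kernel `1 / (1 + (δ x)²)` is, up to a factor `2 δ`, the Fourier transform of `exp (-|t| / δ)`. -/
def AlmostSeparated {ι : Type*} (δ L : ℝ) (P : Finset ι) (x : ι → ℝ) : Prop :=
  ∀ y, ∑ p ∈ P, 1 / (1 + (δ * (y - x p)) ^ 2) ≤ L

/-- The trigonometric sum `∑ c_p exp (i t x_p)`. -/
def expSum {ι : Type*} (P : Finset ι) (c : ι → ℂ) (x : ι → ℝ) (t : ℝ) : ℂ :=
  ∑ p ∈ P, c p * Complex.exp (Complex.I * t * x p)

section ExpSum

variable {ι : Type*} {P : Finset ι} {x : ι → ℝ} {δ L : ℝ}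

/-- This is Schur's test. -/
theorem AlmostSeparated.sum_sum_le (h : AlmostSeparated δ L P x) (a : ι → ℝ) :
    ∑ p ∈ P, ∑ q ∈ P, a p * a q * (1 / (1 + (δ * (x p - x q)) ^ 2)) ≤ L * ∑ p ∈ P, a p ^ 2 := by
  set k : ι → ι → ℝ := fun p q => 1 / (1 + (δ * (x p - x q)) ^ 2) with hk
  have hk_nonneg : ∀ p q, 0 ≤ k p q := fun p q => by positivity
  have hk_symm : ∀ p q, k p q = k q p := fun p q => by simp only [hk]; ring_nf
  calc ∑ p ∈ P, ∑ q ∈ P, a p * a q * k p q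
      ≤ ∑ p ∈ P, ∑ q ∈ P, (a p ^ 2 * k p q / 2 + a q ^ 2 * k q p / 2) := by
        refine Finset.sum_le_sum fun p _ => Finset.sum_le_sum fun q _ => ?_
        rw [hk_symm q p]
        nlinarith [mul_nonneg (sq_nonneg (a p - a q)) (hk_nonneg p q)]
    _ = ∑ p ∈ P, a p ^ 2 * ∑ q ∈ P, k p q := by
        simp_rw [Finset.sum_add_distrib]
        rw [Finset.sum_comm (f := fun p q => a q ^ 2 * k q p / 2), ← Finset.sum_add_distrib]
        refine Finset.sum_congr rfl fun p _ => ?_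
        rw [← Finset.sum_add_distrib, Finset.mul_sum]
        exact Finset.sum_congr rfl fun q _ => add_halves _
    _ ≤ ∑ p ∈ P, a p ^ 2 * L :=
        Finset.sum_le_sum fun p _ => mul_le_mul_of_nonneg_left (h (x p)) (sq_nonneg _)
    _ = L * ∑ p ∈ P, a p ^ 2 := by rw [← Finset.sum_mul, mul_comm]

theorem exp_neg_abs_mul_norm_expSum_sq (c : ι → ℂ) (t : ℝ) :
    ((Real.exp (-|t| / δ) * ‖expSum P c x t‖ ^ 2 : ℝ) : ℂ) =
      ∑ p ∈ P, ∑ q ∈ P, c p * starRingEnd ℂ (c q) *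
        ((Real.exp (-|t| / δ) : ℂ) * Complex.exp (Complex.I * t * (x p - x q : ℝ))) := by
  rw [Complex.ofReal_mul, Complex.ofReal_pow, ← Complex.mul_conj', expSum, map_sum,
    Finset.sum_mul_sum, Finset.mul_sum]
  simp only [Finset.mul_sum, map_mul, ← Complex.exp_conj]
  refine Finset.sum_congr rfl fun p _ => Finset.sum_congr rfl fun q _ => ?_
  have hexp : Complex.exp (Complex.I * t * (x p - x q : ℝ)) = Complex.exp (Complex.I * t * x p) *
      Complex.exp (starRingEnd ℂ Complex.I * starRingEnd ℂ (t : ℂ) * starRingEnd ℂ (x q : ℂ)) := by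
    rw [← Complex.exp_add, Complex.conj_I, Complex.conj_ofReal, Complex.conj_ofReal]
    push_cast
    ring_nf
  rw [hexp]
  ring

theorem integrable_exp_neg_abs_mul_norm_expSum_sq (hδ : 0 < δ) (c : ι → ℂ) :
    Integrable fun t : ℝ => Real.exp (-|t| / δ) * ‖expSum P c x t‖ ^ 2 := by
  have hint : Integrable fun t : ℝ => ((Real.exp (-|t| / δ) * ‖expSum P c x t‖ ^ 2 : ℝ) : ℂ) := by
    simp_rw [exp_neg_abs_mul_norm_expSum_sq]
    exact integrable_finsetSum _ fun p _ => integrable_finsetSum _ fun q _ =>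
      (integrable_exp_neg_abs_mul_exp hδ _).const_mul _
  simpa only [RCLike.re_to_complex, Complex.ofReal_re] using hint.re

theorem integral_exp_neg_abs_mul_norm_expSum_sq_le (hδ : 0 < δ) (h : AlmostSeparated δ L P x)
    (c : ι → ℂ) :
    ∫ t : ℝ, Real.exp (-|t| / δ) * ‖expSum P c x t‖ ^ 2 ≤ 2 * δ * (L * ∑ p ∈ P, ‖c p‖ ^ 2) := by
  have hterm (p q : ι) := (integrable_exp_neg_abs_mul_exp hδ (x p - x q)).const_mul
    (c p * starRingEnd ℂ (c q))
  have hval : ((∫ t : ℝ, Real.exp (-|t| / δ) * ‖expSum P c x t‖ ^ 2 : ℝ) : ℂ) =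
      ∑ p ∈ P, ∑ q ∈ P, c p * starRingEnd ℂ (c q) *
        ((2 * δ / (1 + (δ * (x p - x q)) ^ 2) : ℝ) : ℂ) := by
    rw [← integral_complex_ofReal]
    simp_rw [exp_neg_abs_mul_norm_expSum_sq]
    rw [integral_finsetSum _ fun p _ => integrable_finsetSum _ fun q _ => hterm p q]
    refine Finset.sum_congr rfl fun p _ => ?_
    rw [integral_finsetSum _ fun q _ => hterm p q]
    simp_rw [integral_const_mul, integral_exp_neg_abs_mul_exp hδ]
  calc ∫ t : ℝ, Real.exp (-|t| / δ) * ‖expSum P c x t‖ ^ 2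
      ≤ ∑ p ∈ P, ∑ q ∈ P, ‖c p‖ * ‖c q‖ * (2 * δ / (1 + (δ * (x p - x q)) ^ 2)) := by
        refine (le_abs_self _).trans ?_
        rw [← Real.norm_eq_abs, ← Complex.norm_real, hval]
        refine norm_sum_le_of_le _ fun p _ => norm_sum_le_of_le _ fun q _ => ?_
        rw [norm_mul, norm_mul, RCLike.norm_conj, Complex.norm_real,
          Real.norm_of_nonneg (by positivity)]
    _ = 2 * δ * ∑ p ∈ P, ∑ q ∈ P, ‖c p‖ * ‖c q‖ * (1 / (1 + (δ * (x p - x q)) ^ 2)) := by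
        simp_rw [Finset.mul_sum]
        exact Finset.sum_congr rfl fun p _ => Finset.sum_congr rfl fun q _ => by ring
    _ ≤ 2 * δ * (L * ∑ p ∈ P, ‖c p‖ ^ 2) :=
        mul_le_mul_of_nonneg_left (h.sum_sum_le fun p => ‖c p‖) (by positivity)

theorem setLIntegral_enorm_expSum_sq_le (hδ : 0 < δ) (h : AlmostSeparated δ L P x)
    (c : ι → ℂ) :
    ∫⁻ t in Ico 0 δ, ‖expSum P c x t‖ₑ ^ 2
      ≤ ENNReal.ofReal (2 * Real.exp 1 * δ * L * ∑ p ∈ P, ‖c p‖ ^ 2) := by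
  have hint := (integrable_exp_neg_abs_mul_norm_expSum_sq (P := P) (x := x) hδ c).const_mul
    (Real.exp 1)
  calc ∫⁻ t in Ico 0 δ, ‖expSum P c x t‖ₑ ^ 2
      ≤ ∫⁻ t in Ico 0 δ,
          ENNReal.ofReal (Real.exp 1 * (Real.exp (-|t| / δ) * ‖expSum P c x t‖ ^ 2)) := by
        refine setLIntegral_mono' measurableSet_Ico fun t ht => ?_
        rw [← ofReal_norm, ← ENNReal.ofReal_pow (norm_nonneg _), ← mul_assoc, ← Real.exp_add,
          abs_of_nonneg ht.1]
        have hweight : 0 ≤ 1 + -t / δ := by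
          rw [neg_div, ← sub_eq_add_neg, sub_nonneg, div_le_one hδ]
          exact ht.2.le
        exact ENNReal.ofReal_le_ofReal
          (le_mul_of_one_le_left (sq_nonneg _) (Real.one_le_exp hweight))
    _ ≤ ∫⁻ t, ENNReal.ofReal (Real.exp 1 * (Real.exp (-|t| / δ) * ‖expSum P c x t‖ ^ 2)) :=
        setLIntegral_le_lintegral _ _
    _ = ENNReal.ofReal (∫ t, Real.exp 1 * (Real.exp (-|t| / δ) * ‖expSum P c x t‖ ^ 2)) :=
        (ofReal_integral_eq_lintegral_ofReal hint (.of_forall fun t => by positivity)).symm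
    _ ≤ ENNReal.ofReal (2 * Real.exp 1 * δ * L * ∑ p ∈ P, ‖c p‖ ^ 2) := by
        refine ENNReal.ofReal_le_ofReal ?_
        rw [integral_const_mul]
        calc _ ≤ Real.exp 1 * (2 * δ * (L * ∑ p ∈ P, ‖c p‖ ^ 2)) := by
              gcongr
              exact integral_exp_neg_abs_mul_norm_expSum_sq_le hδ h c
          _ = _ := by ring

theorem expSum_add (c : ι → ℂ) (s t : ℝ) :
    expSum P c x (t + s) = expSum P (fun p => c p * Complex.exp (Complex.I * s * x p)) x t := by
  refine Finset.sum_congr rfl fun p _ => ?_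
  rw [mul_assoc (c p), ← Complex.exp_add]
  push_cast
  ring_nf

theorem norm_exp_I_mul_mul (t x : ℝ) : ‖Complex.exp (Complex.I * t * x)‖ = 1 := by
  rw [mul_assoc, mul_comm, ← Complex.ofReal_mul, Complex.norm_exp_ofReal_mul_I]

theorem setLIntegral_Ico_add_enorm_expSum_sq_le (hδ : 0 < δ) (h : AlmostSeparated δ L P x)
    (c : ι → ℂ) (α : ℝ) :
    ∫⁻ t in Ico α (α + δ), ‖expSum P c x t‖ₑ ^ 2
      ≤ ENNReal.ofReal (2 * Real.exp 1 * δ * L * ∑ p ∈ P, ‖c p‖ ^ 2) := by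
  have hshift : ∫⁻ t in Ico α (α + δ), ‖expSum P c x t‖ₑ ^ 2 = ∫⁻ t in Ico 0 δ,
      ‖expSum P (fun p => c p * Complex.exp (Complex.I * α * x p)) x t‖ₑ ^ 2 := by
    rw [← lintegral_indicator measurableSet_Ico, ← lintegral_indicator measurableSet_Ico,
      ← lintegral_add_right_eq_self _ α]
    refine lintegral_congr fun t => ?_
    simp only [indicator, mem_Ico, le_add_iff_nonneg_left, add_comm α δ, add_lt_add_iff_right,
      expSum_add]
  rw [hshift]
  simpa only [norm_mul, norm_exp_I_mul_mul, mul_one] using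
    setLIntegral_enorm_expSum_sq_le hδ h fun p => c p * Complex.exp (Complex.I * α * x p)

end ExpSum

/-! ### Counting resonances -/

/-- The constant `∑ 8 / (1 + n²)`, which bounds the sums of `1 / (1 + x²)` over the points of
`1 / 2`-separated sets. -/
def lineConst : ℝ := ∑' n : ℤ, 8 / (1 + (n : ℝ) ^ 2)

theorem summable_div_one_add_sq (c : ℝ) : Summable fun n : ℤ => c / (1 + (n : ℝ) ^ 2) := by
  have h : Summable fun n : ℤ => 1 / (1 + (n : ℝ) ^ 2) := by
    refine (Real.summable_one_div_int_pow.mpr one_lt_two).of_norm_bounded_eventually ?_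
    filter_upwards [(finite_singleton (0 : ℤ)).compl_mem_cofinite] with n hn
    have hn' : (n : ℝ) ≠ 0 := by exact_mod_cast hn
    rw [Real.norm_of_nonneg (by positivity)]
    gcongr
    exact le_add_of_nonneg_left zero_le_one
  simpa only [mul_one_div] using h.mul_left c

theorem lineConst_nonneg : 0 ≤ lineConst := tsum_nonneg fun _ => by positivity

theorem one_div_one_add_sq_le_floor (x : ℝ) :
    1 / (1 + x ^ 2) ≤ 8 / (1 + (⌊2 * x⌋ : ℝ) ^ 2) := by
  rw [div_le_div_iff₀ (by positivity) (by positivity)]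
  have hle := Int.floor_le (2 * x)
  have hlt := Int.lt_floor_add_one (2 * x)
  set m : ℝ := (⌊2 * x⌋ : ℝ)
  nlinarith [sq_nonneg (4 * x - m), mul_nonneg (sub_nonneg.mpr hle) (sub_nonneg.mpr hlt.le)]

namespace AlmostSeparated

variable {ι κ : Type*} {P : Finset ι} {x : ι → ℝ} {δ L L' : ℝ}

theorem mono (h : AlmostSeparated δ L P x) (hL : L ≤ L') : AlmostSeparated δ L' P x :=
  fun y => (h y).trans hL

theorem of_card (δ : ℝ) (P : Finset ι) (x : ι → ℝ) : AlmostSeparated δ P.card P x := by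
  intro y
  refine (Finset.sum_le_card_nsmul P _ 1 fun p _ => ?_).trans_eq (by simp)
  exact div_le_one_of_le₀ (le_add_of_nonneg_right (sq_nonneg _)) (by positivity)

theorem of_pairwise (h : (P : Set ι).Pairwise fun p q => 1 / 2 ≤ |δ * (x p - x q)|) :
    AlmostSeparated δ lineConst P x := by
  classical
  intro y
  set n : ι → ℤ := fun p => ⌊2 * (δ * (y - x p))⌋
  have hinj : Set.InjOn n P := by
    intro p hp q hq hpq
    by_contra hne
    have hlt := Int.abs_sub_lt_one_of_floor_eq_floor hpq
    rw [show 2 * (δ * (y - x p)) - 2 * (δ * (y - x q)) = -(2 * (δ * (x p - x q))) by ring,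
      abs_neg, abs_mul, abs_two] at hlt
    linarith [h hp hq hne]
  calc ∑ p ∈ P, 1 / (1 + (δ * (y - x p)) ^ 2) ≤ ∑ p ∈ P, 8 / (1 + (n p : ℝ) ^ 2) :=
        Finset.sum_le_sum fun p _ => one_div_one_add_sq_le_floor _
    _ = ∑ m ∈ P.image n, 8 / (1 + (m : ℝ) ^ 2) := by rw [Finset.sum_image hinj]
    _ ≤ lineConst := (summable_div_one_add_sq 8).sum_le_tsum _ fun _ _ => by positivity

theorem of_filter (p : ι → Prop) [DecidablePred p] (h : AlmostSeparated δ L (P.filter p) x)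
    (h' : AlmostSeparated δ L' (P.filter fun i => ¬ p i) x) :
    AlmostSeparated δ (L + L') P x := fun y => by
  rw [← Finset.sum_filter_add_sum_filter_not P p]
  exact add_le_add (h y) (h' y)

theorem of_fiberwise [DecidableEq κ] {S : Finset κ} {f : ι → κ} (hf : ∀ p ∈ P, f p ∈ S)
    (h : ∀ b ∈ S, AlmostSeparated δ L (P.filter fun p => f p = b) x) :
    AlmostSeparated δ (S.card * L) P x := fun y => by
  rw [← Finset.sum_fiberwise_of_maps_to hf, ← nsmul_eq_mul]
  exact Finset.sum_le_card_nsmul _ _ _ fun b hb => h b hb y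

end AlmostSeparated

/-- The coordinate `k₁ + ε k₂` along a diagonal, `ε = ±1`. In these coordinates the dispersion
relation separates. -/
def diag (ε : ℤˣ) : ℤ × ℤ →+ ℤ := AddMonoidHom.fst ℤ ℤ + (ε : ℤ) • AddMonoidHom.snd ℤ ℤ

theorem diag_apply (ε : ℤˣ) (k : ℤ × ℤ) : diag ε k = k.1 + ε * k.2 := rfl

theorem diag_neg_apply (ε : ℤˣ) (k : ℤ × ℤ) : diag (-ε) k = k.1 - ε * k.2 := by
  rw [diag_apply, Units.val_neg, neg_mul, sub_eq_add_neg]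

theorem two_mul_phase (ε : ℤˣ) (k : ℤ × ℤ) :
    2 * phase k = (diag ε k : ℝ) ^ 3 + (diag (-ε) k : ℝ) ^ 3 := by
  rw [phase, diag_apply, diag_neg_apply]
  obtain rfl | rfl := Int.units_eq_one_or ε <;> push_cast <;> ring

theorem eq_of_diag_eq (ε : ℤˣ) {k l : ℤ × ℤ} (h : diag ε k = diag ε l)
    (h' : diag (-ε) k = diag (-ε) l) : k = l := by
  rw [diag_apply, diag_apply] at h
  rw [diag_neg_apply, diag_neg_apply] at h'
  obtain rfl | rfl := Int.units_eq_one_or ε <;> ext <;> push_cast at h h' <;> lia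

/-- Two frequencies whose group velocities differ by at least a multiple of `4 ^ J` in one of the
diagonal directions; no condition if `J = 0`. -/
def Transversal (J : ℕ) (p q : ℤ × ℤ) : Prop :=
  J = 0 ∨ ∃ ε : ℤˣ, 3 * (2 ^ J) ^ 2 ≤ 8 * |diag ε p ^ 2 - diag ε q ^ 2|

theorem phase_add_sub_phase_add {ε : ℤˣ} {w w' : (ℤ × ℤ) × (ℤ × ℤ)}
    (hsum : w.1 + w.2 = w'.1 + w'.2) (hline : diag (-ε) w.1 = diag (-ε) w'.1) :
    2 * ((phase w.1 + phase w.2) - (phase w'.1 + phase w'.2)) =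
      3 * (diag ε (w.1 + w.2) : ℝ) * (diag ε w.1 - diag ε w'.1) *
        (diag ε w.1 + diag ε w'.1 - diag ε (w.1 + w.2)) := by
  have hdiag : (diag ε w.2 : ℝ) = diag ε w'.1 + diag ε w'.2 - diag ε w.1 := by
    exact_mod_cast eq_sub_of_add_eq' (by rw [← map_add, hsum, map_add])
  have hline' : (diag (-ε) w.1 : ℝ) = diag (-ε) w'.1 := by exact_mod_cast hline
  have hline₂ : (diag (-ε) w.2 : ℝ) = diag (-ε) w'.2 := by
    have h := congrArg (diag (-ε)) hsum
    rw [map_add, map_add, hline, add_right_inj] at h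
    exact_mod_cast h
  rw [mul_sub, mul_add, mul_add, two_mul_phase ε, two_mul_phase ε, two_mul_phase ε,
    two_mul_phase ε, hline', hline₂, hsum, map_add]
  push_cast
  rw [hdiag]
  ring

theorem le_abs_mul_add_sub {A a a' M : ℝ} (hsign : 0 ≤ (2 * a - A) * (2 * a' - A))
    (h : 3 * M ≤ 8 * |A * (2 * a - A)|) (h' : 3 * M ≤ 8 * |A * (2 * a' - A)|) :
    3 * M ≤ 8 * |A * (a + a' - A)| := by
  have habs : |2 * a - A| + |2 * a' - A| = 2 * |a + a' - A| := by
    rw [← (abs_add_eq_add_abs_iff _ _).mpr (mul_nonneg_iff.mp hsign),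
      show 2 * a - A + (2 * a' - A) = 2 * (a + a' - A) by ring, abs_mul, abs_two]
  rw [abs_mul] at h h' ⊢
  linear_combination (h + h') / 2 + 4 * |A| * habs

section Counting

variable {ε : ℤˣ} {k : ℤ × ℤ} {P : Finset ((ℤ × ℤ) × (ℤ × ℤ))} {M : ℝ}

/-- On a line in the second diagonal direction the resonance function is a parabola in `diag ε w.1`,
monotone on either side of its vertex. -/
theorem almostSeparated_of_halfLine (hM : 0 < M) (hsum : ∀ w ∈ P, w.1 + w.2 = k) {b : ℤ}
    (hline : ∀ w ∈ P, diag (-ε) w.1 = b)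
    (hgap : ∀ w ∈ P, 3 * M ≤ 8 * |(diag ε w.1 : ℝ) ^ 2 - (diag ε w.2 : ℝ) ^ 2|)
    (hside : ∀ w ∈ P, ∀ w' ∈ P,
      0 ≤ (2 * (diag ε w.1 : ℝ) - diag ε k) * (2 * (diag ε w'.1 : ℝ) - diag ε k)) :
    AlmostSeparated M⁻¹ lineConst P fun w => phase w.1 + phase w.2 := by
  refine .of_pairwise fun w hw w' hw' hne => ?_
  have hfactor : ∀ w ∈ P, (diag ε w.1 : ℝ) ^ 2 - (diag ε w.2 : ℝ) ^ 2
      = diag ε k * (2 * diag ε w.1 - diag ε k) := by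
    intro w hw
    rw [← hsum w hw, map_add]
    push_cast
    ring
  have hstep : 1 ≤ |(diag ε w.1 : ℝ) - diag ε w'.1| := by
    have hfst : w.1 ≠ w'.1 := fun h => hne <| Prod.ext h <| add_left_cancel (a := w.1) <| by
      rw [hsum w hw, h, hsum w' hw']
    exact_mod_cast Int.one_le_abs <| sub_ne_zero.mpr fun h =>
      hfst (eq_of_diag_eq ε h ((hline w hw).trans (hline w' hw').symm))
  have hvertex := le_abs_mul_add_sub (hside w hw w' hw') (hfactor w hw ▸ hgap w hw)
    (hfactor w' hw' ▸ hgap w' hw')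
  have hphase := phase_add_sub_phase_add ((hsum w hw).trans (hsum w' hw').symm)
    ((hline w hw).trans (hline w' hw').symm)
  rw [hsum w hw] at hphase
  have habs : 2 * |(phase w.1 + phase w.2) - (phase w'.1 + phase w'.2)| =
      3 * |(diag ε w.1 : ℝ) - diag ε w'.1| *
        |(diag ε k : ℝ) * (diag ε w.1 + diag ε w'.1 - diag ε k)| := by
    have h := congrArg abs hphase
    rw [abs_mul, abs_two] at h
    rw [h, abs_mul, abs_mul, abs_mul, abs_mul, abs_of_pos (zero_lt_three (α := ℝ))]
    ring
  change 1 / 2 ≤ |M⁻¹ * _|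
  rw [abs_mul, abs_of_pos (inv_pos.mpr hM), inv_mul_eq_div, le_div_iff₀ hM]
  nlinarith [le_mul_of_one_le_left
    (abs_nonneg ((diag ε k : ℝ) * (diag ε w.1 + diag ε w'.1 - diag ε k))) hstep]

theorem almostSeparated_of_line (hM : 0 < M) (hsum : ∀ w ∈ P, w.1 + w.2 = k) {b : ℤ}
    (hline : ∀ w ∈ P, diag (-ε) w.1 = b)
    (hgap : ∀ w ∈ P, 3 * M ≤ 8 * |(diag ε w.1 : ℝ) ^ 2 - (diag ε w.2 : ℝ) ^ 2|) :
    AlmostSeparated M⁻¹ (lineConst + lineConst) P fun w => phase w.1 + phase w.2 := by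
  refine .of_filter (fun w => (diag ε k : ℝ) ≤ 2 * diag ε w.1) ?_ ?_
  all_goals
    refine almostSeparated_of_halfLine (ε := ε) hM
      (fun w hw => hsum w (Finset.mem_filter.mp hw).1)
      (fun w hw => hline w (Finset.mem_filter.mp hw).1)
      (fun w hw => hgap w (Finset.mem_filter.mp hw).1) fun w hw w' hw' => ?_
    have hw := (Finset.mem_filter.mp hw).2
    have hw' := (Finset.mem_filter.mp hw').2
  · exact mul_nonneg (sub_nonneg.mpr hw) (sub_nonneg.mpr hw')
  · exact mul_nonneg_of_nonpos_of_nonpos (sub_nonpos.mpr (le_of_not_ge hw))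
      (sub_nonpos.mpr (le_of_not_ge hw'))

theorem abs_le_of_mem_annulus {j : ℕ} {k : ℤ × ℤ} (hk : k ∈ annulus j) :
    |k.1| ≤ 2 * 2 ^ j ∧ |k.2| ≤ 2 * 2 ^ j := by
  have h := Finset.mem_product.mp (Finset.mem_filter.mp hk).1
  rwa [Finset.mem_Icc, Finset.mem_Icc, ← abs_le, ← abs_le, pow_succ'] at h

theorem abs_diag_le_of_mem_annulus {j : ℕ} {k : ℤ × ℤ} (hk : k ∈ annulus j) (ε : ℤˣ) :
    |diag ε k| ≤ 4 * 2 ^ j := by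
  obtain ⟨h₁, h₂⟩ := abs_le_of_mem_annulus hk
  calc |diag ε k| ≤ |k.1| + |(ε : ℤ) * k.2| := abs_add_le _ _
    _ = |k.1| + |k.2| := by obtain rfl | rfl := Int.units_eq_one_or ε <;> simp
    _ ≤ 4 * 2 ^ j := by linarith

theorem almostSeparated_of_gap (hM : 0 < M) {j : ℕ} (hsum : ∀ w ∈ P, w.1 + w.2 = k)
    (hmem : ∀ w ∈ P, w.1 ∈ annulus j)
    (hgap : ∀ w ∈ P, 3 * M ≤ 8 * |(diag ε w.1 : ℝ) ^ 2 - (diag ε w.2 : ℝ) ^ 2|) :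
    AlmostSeparated M⁻¹ (18 * lineConst * 2 ^ j) P fun w => phase w.1 + phase w.2 := by
  have hmaps : ∀ w ∈ P, diag (-ε) w.1 ∈ Finset.Icc (-(4 * 2 ^ j) : ℤ) (4 * 2 ^ j) := fun w hw =>
    Finset.mem_Icc.mpr (abs_le.mp (abs_diag_le_of_mem_annulus (hmem w hw) (-ε)))
  have hcard : ((Finset.Icc (-(4 * 2 ^ j) : ℤ) (4 * 2 ^ j)).card : ℝ) = 8 * 2 ^ j + 1 := by
    have h : ((Finset.Icc (-(4 * 2 ^ j) : ℤ) (4 * 2 ^ j)).card : ℤ) = 8 * 2 ^ j + 1 := by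
      have hpos : (0 : ℤ) < 2 ^ j := by positivity
      rw [Int.card_Icc, Int.toNat_of_nonneg (by linarith)]
      ring
    exact_mod_cast h
  refine (AlmostSeparated.of_fiberwise (L := lineConst + lineConst) hmaps fun b _ => ?_).mono ?_
  · exact almostSeparated_of_line (b := b) hM (fun w hw => hsum w (Finset.mem_filter.mp hw).1)
      (fun w hw => (Finset.mem_filter.mp hw).2) fun w hw => hgap w (Finset.mem_filter.mp hw).1
  · rw [hcard]
    nlinarith [lineConst_nonneg, one_le_pow₀ (one_le_two (α := ℝ)) (n := j)]

/-- The constant in the counting estimate `almostSeparated_of_transversal`. -/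
def countConst : ℝ := 36 * lineConst + 25

theorem countConst_pos : 0 < countConst :=
  add_pos_of_nonneg_of_pos (mul_nonneg (by norm_num) lineConst_nonneg) (by norm_num)

theorem almostSeparated_of_mem_annulus_zero (hsum : ∀ w ∈ P, w.1 + w.2 = k)
    (hmem : ∀ w ∈ P, w.1 ∈ annulus 0) (δ : ℝ) :
    AlmostSeparated δ 25 P fun w => phase w.1 + phase w.2 := by
  have hcard : P.card ≤ 25 := by
    refine (Finset.card_le_card_of_injOn Prod.fst hmem fun w hw w' hw' h => ?_).trans
      ((Finset.card_filter_le _ _).trans (by simp))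
    exact Prod.ext h (add_left_cancel (a := w.1) (by rw [hsum w hw, h, hsum w' hw']))
  exact (AlmostSeparated.of_card δ P _).mono (by exact_mod_cast hcard)

theorem almostSeparated_of_transversal {J j : ℕ} (hj : j ≤ J) (hsum : ∀ w ∈ P, w.1 + w.2 = k)
    (hmem : ∀ w ∈ P, w.1 ∈ annulus j) (htrans : ∀ w ∈ P, Transversal J w.1 w.2) :
    AlmostSeparated (((2 : ℝ) ^ J) ^ 2)⁻¹ (countConst * 2 ^ j) P
      fun w => phase w.1 + phase w.2 := by
  classical
  have hlc := lineConst_nonneg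
  rcases eq_or_ne J 0 with rfl | hJ
  · obtain rfl : j = 0 := Nat.le_zero.mp hj
    exact (almostSeparated_of_mem_annulus_zero hsum hmem _).mono (by
      rw [countConst, pow_zero, mul_one]
      linarith)
  · have hgap : ∀ w ∈ P, ∃ ε : ℤˣ, 3 * ((2 : ℝ) ^ J) ^ 2 ≤
        8 * |(diag ε w.1 : ℝ) ^ 2 - (diag ε w.2 : ℝ) ^ 2| := fun w hw => by
      obtain ⟨ε, hε⟩ := (htrans w hw).resolve_left hJ
      exact ⟨ε, by exact_mod_cast hε⟩
    have hM : 0 < ((2 : ℝ) ^ J) ^ 2 := by positivity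
    refine (AlmostSeparated.of_filter (fun w => 3 * ((2 : ℝ) ^ J) ^ 2 ≤
      8 * |(diag 1 w.1 : ℝ) ^ 2 - (diag 1 w.2 : ℝ) ^ 2|)
      (almostSeparated_of_gap (ε := 1) (k := k) (j := j) hM ?_ ?_ ?_)
      (almostSeparated_of_gap (ε := -1) (k := k) (j := j) hM ?_ ?_ fun w hw => ?_)).mono ?_
    case refine_3 => exact fun w hw => (Finset.mem_filter.mp hw).2
    case refine_6 =>
      obtain ⟨hw, hnot⟩ := Finset.mem_filter.mp hw
      obtain ⟨ε, hε⟩ := hgap w hw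
      obtain rfl | rfl := Int.units_eq_one_or ε
      exacts [absurd hε hnot, hε]
    case refine_7 =>
      rw [countConst]
      nlinarith [(by positivity : (0 : ℝ) < 2 ^ j)]
    all_goals exact fun w hw => by simp only [hsum, hmem, (Finset.mem_filter.mp hw).1]

end Counting

theorem gap_of_add_eq_zero {R : Type*} [CommRing R] [LinearOrder R] [IsStrictOrderedRing R]
    {x y z N : R} (h : x + y + z = 0) (hN : N ^ 2 ≤ y ^ 2) :
    3 * N ^ 2 ≤ 8 * |x ^ 2 - y ^ 2| ∨ 3 * N ^ 2 ≤ 8 * |x ^ 2 - z ^ 2| := by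
  by_contra! hc
  obtain ⟨hxy, hxz⟩ := hc
  obtain rfl : x = -(y + z) := by linear_combination h
  set w := y + 2 * z with hw
  have hxz' : 8 * |w * y| < 3 * y ^ 2 := by
    rw [show w * y = (-(y + z)) ^ 2 - z ^ 2 by rw [hw]; ring]
    linarith
  have hy : 0 < y ^ 2 := by linarith [abs_nonneg (w * y)]
  have hw_sq : 64 * w ^ 2 ≤ 9 * y ^ 2 := by
    have hsq : (8 * |w * y|) ^ 2 ≤ (3 * y ^ 2) ^ 2 := by gcongr
    rw [mul_pow, sq_abs] at hsq
    exact le_of_mul_le_mul_right (by linarith) hy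
  have hxy_eq : 4 * ((-(y + z)) ^ 2 - y ^ 2) = w ^ 2 + 2 * (w * y) - 3 * y ^ 2 := by rw [hw]; ring
  linarith [le_abs_self (w * y), neg_abs_le ((-(y + z)) ^ 2 - y ^ 2), hxy_eq]

theorem exists_sq_le_diag_sq {J : ℕ} (hJ : J ≠ 0) {q : ℤ × ℤ} (hq : q ∈ annulus J) :
    ∃ ε : ℤˣ, (2 ^ J) ^ 2 ≤ diag ε q ^ 2 := by
  have hq' := ((mem_annulus J q).mp hq).1.resolve_left hJ
  by_contra! hc
  have h₁ := hc 1
  have h₂ := hc (-1)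
  simp only [diag_apply, Units.val_one, Units.val_neg] at h₁ h₂
  linarith

theorem transversal_or {J : ℕ} {p q r : ℤ × ℤ} (hqr : q ∈ annulus J ∨ r ∈ annulus J)
    (h : p + q + r = 0) : Transversal J p q ∨ Transversal J p r := by
  rcases eq_or_ne J 0 with rfl | hJ
  · exact .inl (.inl rfl)
  wlog hq : q ∈ annulus J generalizing q r
  · exact (this hqr.symm (by rw [add_right_comm, h]) (hqr.resolve_left hq)).symm
  obtain ⟨ε, hε⟩ := exists_sq_le_diag_sq hJ hq
  have hdiag : diag ε p + diag ε q + diag ε r = 0 := by rw [← map_add, ← map_add, h, map_zero]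
  exact (gap_of_add_eq_zero hdiag hε).imp (fun h => .inr ⟨ε, h⟩) fun h => .inr ⟨ε, h⟩

/-! ### Free evolution on the Fourier side -/

theorem inner_characterL2 (k l : ℤ × ℤ) :
    inner ℂ (characterL2 k) (characterL2 l) = if k = l then 1 else 0 := by
  have h1 : ∀ m n : ℤ, ∫ x : Circle1, fourier n x * starRingEnd ℂ (fourier m x)
      ∂AddCircle.haarAddCircle = if m = n then 1 else 0 := by
    intro m n
    have := (orthonormal_iff_ite.mp (orthonormal_fourier (T := 2 * Real.pi))) m n
    rw [← this, fourierLp, fourierLp, ContinuousMap.inner_toLp]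
  rw [characterL2, characterL2, ContinuousMap.inner_toLp]
  have : ∀ p : Torus, character l p * starRingEnd ℂ (character k p) =
      (fourier l.1 p.1 * starRingEnd ℂ (fourier k.1 p.1)) *
        (fourier l.2 p.2 * starRingEnd ℂ (fourier k.2 p.2)) := by
    intro p
    simp only [character, ContinuousMap.coe_mk, map_mul]
    ring
  simp_rw [this]
  rw [integral_prod_mul (fun x : Circle1 => fourier l.1 x * starRingEnd ℂ (fourier k.1 x))
    (fun x : Circle1 => fourier l.2 x * starRingEnd ℂ (fourier k.2 x)), h1, h1]
  by_cases h1 : k.1 = l.1 <;> by_cases h2 : k.2 = l.2 <;> simp [h1, h2, Prod.ext_iff]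

theorem orthonormal_characterL2 : Orthonormal ℂ characterL2 :=
  orthonormal_iff_ite.mpr inner_characterL2

theorem inner_sum_smul_characterL2 (A : Finset (ℤ × ℤ)) (c : ℤ × ℤ → ℂ) {k : ℤ × ℤ} (hk : k ∈ A) :
    inner ℂ (characterL2 k) (∑ l ∈ A, c l • characterL2 l) = c k :=
  orthonormal_characterL2.inner_right_sum c hk

theorem enorm_sum_smul_characterL2_sq (A : Finset (ℤ × ℤ)) (c : ℤ × ℤ → ℂ) :
    ‖∑ k ∈ A, c k • characterL2 k‖ₑ ^ 2 = ∑ k ∈ A, ‖c k‖ₑ ^ 2 := by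
  have h : ‖∑ k ∈ A, c k • characterL2 k‖ ^ 2 = ∑ k ∈ A, ‖c k‖ ^ 2 := by
    rw [← RCLike.ofReal_inj (K := ℂ), RCLike.ofReal_pow, ← inner_self_eq_norm_sq_to_K,
      orthonormal_characterL2.inner_sum, RCLike.ofReal_sum]
    exact Finset.sum_congr rfl fun k _ => by rw [RCLike.conj_mul, RCLike.ofReal_pow]
  simp only [← ofReal_norm, ← ENNReal.ofReal_pow (norm_nonneg _)]
  rw [h, ENNReal.ofReal_sum_of_nonneg fun _ _ => sq_nonneg _]

/-- The Fourier coefficient functional `f ↦ exp (i t φ(k)) f̂(k)` of the free evolution. -/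
def evolveL (t : ℝ) (k : ℤ × ℤ) : L2 →L[ℂ] ℂ :=
  Complex.exp (Complex.I * t * phase k) • innerSL ℂ (characterL2 k)

/-- The Fourier coefficients of the free evolution at time `t` of `f ∈ L²`. -/
def evolve (t : ℝ) (f : L2) (k : ℤ × ℤ) : ℂ := evolveL t k f

theorem evolve_eq (t : ℝ) (f : L2) (k : ℤ × ℤ) :
    evolve t f k = Complex.exp (Complex.I * t * phase k) * inner ℂ (characterL2 k) f := rfl

theorem evolve_zero (t : ℝ) : evolve t 0 = 0 :=
  funext fun k => map_zero (evolveL t k)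

theorem continuous_evolve (f : L2) (k : ℤ × ℤ) : Continuous fun t : ℝ => evolve t f k := by
  simp only [evolve_eq]
  fun_prop

theorem norm_evolve (t : ℝ) (f : L2) (k : ℤ × ℤ) :
    ‖evolve t f k‖ = ‖inner ℂ (characterL2 k) f‖ := by
  rw [evolve_eq, norm_mul, norm_exp_I_mul_mul, one_mul]

theorem sum_enorm_evolve_sq_le (A : Finset (ℤ × ℤ)) (t : ℝ) (f : L2) :
    ∑ k ∈ A, ‖evolve t f k‖ₑ ^ 2 ≤ ‖f‖ₑ ^ 2 := by
  simp only [← ofReal_norm, ← ENNReal.ofReal_pow (norm_nonneg _), norm_evolve]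
  rw [← ENNReal.ofReal_sum_of_nonneg fun _ _ => sq_nonneg _]
  exact ENNReal.ofReal_le_ofReal (orthonormal_characterL2.sum_inner_products_le f)

theorem evolve_backProj {j : ℕ} {k : ℤ × ℤ} (hk : k ∈ annulus j) (t : ℝ) (f : Torus → ℝ) :
    evolve t (backProj j t f) k = coeff f k := by
  rw [evolve_eq, backProj, inner_sum_smul_characterL2 _ _ hk, ← mul_assoc, ← Complex.exp_add,
    add_neg_cancel, Complex.exp_zero, one_mul]

/-! ### Sums over resonant triples -/

/-- The bilinear form `∑_{p + q + r = 0} M(p, q, r) f(p) g(q)` with values in functions of `r`. -/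
def bilSum (A₁ A₂ : Finset (ℤ × ℤ)) (M : ℤ × ℤ → ℤ × ℤ → ℤ × ℤ → ℂ) (f g : ℤ × ℤ → ℂ)
    (r : ℤ × ℤ) : ℂ :=
  ∑ p ∈ A₁, ∑ q ∈ A₂, if p + q + r = 0 then M p q r * f p * g q else 0

/-- The trilinear form `∑_{p + q + r = 0} M(p, q, r) f(p) g(q) h(r)`. -/
def triSum (A₁ A₂ A₃ : Finset (ℤ × ℤ)) (M : ℤ × ℤ → ℤ × ℤ → ℤ × ℤ → ℂ) (f g h : ℤ × ℤ → ℂ) : ℂ :=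
  ∑ p ∈ A₁, ∑ q ∈ A₂, ∑ r ∈ A₃, if p + q + r = 0 then M p q r * f p * g q * h r else 0

theorem triSum_eq_sum_bilSum (A₁ A₂ A₃ : Finset (ℤ × ℤ)) (M : ℤ × ℤ → ℤ × ℤ → ℤ × ℤ → ℂ)
    (f g h : ℤ × ℤ → ℂ) : triSum A₁ A₂ A₃ M f g h = ∑ r ∈ A₃, bilSum A₁ A₂ M f g r * h r := by
  simp only [triSum, bilSum, Finset.sum_mul, ite_mul, zero_mul]
  conv_rhs => rw [Finset.sum_comm]
  refine Finset.sum_congr rfl fun p _ => ?_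
  rw [Finset.sum_comm]

theorem triSum_swap_right (A₁ A₂ A₃ : Finset (ℤ × ℤ)) (M : ℤ × ℤ → ℤ × ℤ → ℤ × ℤ → ℂ)
    (f g h : ℤ × ℤ → ℂ) :
    triSum A₁ A₂ A₃ M f g h = triSum A₁ A₃ A₂ (fun p q r => M p r q) f h g := by
  simp only [triSum]
  refine Finset.sum_congr rfl fun p _ => ?_
  rw [Finset.sum_comm]
  refine Finset.sum_congr rfl fun q _ => Finset.sum_congr rfl fun r _ => ?_
  rw [add_right_comm]
  congr 1
  ring

theorem triSum_swap_left (A₁ A₂ A₃ : Finset (ℤ × ℤ)) (M : ℤ × ℤ → ℤ × ℤ → ℤ × ℤ → ℂ)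
    (f g h : ℤ × ℤ → ℂ) :
    triSum A₁ A₂ A₃ M f g h = triSum A₂ A₁ A₃ (fun p q r => M q p r) g f h := by
  simp only [triSum]
  rw [Finset.sum_comm]
  refine Finset.sum_congr rfl fun p _ => Finset.sum_congr rfl fun q _ =>
    Finset.sum_congr rfl fun r _ => ?_
  rw [add_comm q p]
  congr 1
  ring

theorem triSum_congr {A₁ A₂ A₃ : Finset (ℤ × ℤ)} (M : ℤ × ℤ → ℤ × ℤ → ℤ × ℤ → ℂ)
    {f f' g g' h h' : ℤ × ℤ → ℂ} (hf : ∀ p ∈ A₁, f p = f' p) (hg : ∀ p ∈ A₂, g p = g' p)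
    (hh : ∀ p ∈ A₃, h p = h' p) : triSum A₁ A₂ A₃ M f g h = triSum A₁ A₂ A₃ M f' g' h' := by
  refine Finset.sum_congr rfl fun p hp => Finset.sum_congr rfl fun q hq =>
    Finset.sum_congr rfl fun r hr => ?_
  rw [hf p hp, hg q hq, hh r hr]


theorem triSum_add (A₁ A₂ A₃ : Finset (ℤ × ℤ)) (M M' : ℤ × ℤ → ℤ × ℤ → ℤ × ℤ → ℂ)
    (f g h : ℤ × ℤ → ℂ) :
    triSum A₁ A₂ A₃ (M + M') f g h = triSum A₁ A₂ A₃ M f g h + triSum A₁ A₂ A₃ M' f g h := by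
  simp only [triSum, ← Finset.sum_add_distrib]
  refine Finset.sum_congr rfl fun p _ => Finset.sum_congr rfl fun q _ =>
    Finset.sum_congr rfl fun r _ => ?_
  split_ifs
  · simp only [Pi.add_apply, add_mul]
  · rw [add_zero]

/-- The nonzero terms of `bilSum A₁ A₂ M f g r`. -/
def resonantPairs (A₁ A₂ : Finset (ℤ × ℤ)) (M : ℤ × ℤ → ℤ × ℤ → ℤ × ℤ → ℂ) (r : ℤ × ℤ) :
    Finset ((ℤ × ℤ) × (ℤ × ℤ)) :=
  open Classical in {w ∈ A₁ ×ˢ A₂ | -(w.1 + w.2) = r ∧ M w.1 w.2 r ≠ 0}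

theorem mem_resonantPairs {A₁ A₂ : Finset (ℤ × ℤ)} {M : ℤ × ℤ → ℤ × ℤ → ℤ × ℤ → ℂ} {r : ℤ × ℤ}
    {w : (ℤ × ℤ) × (ℤ × ℤ)} : w ∈ resonantPairs A₁ A₂ M r ↔
      (w.1 ∈ A₁ ∧ w.2 ∈ A₂) ∧ w.1 + w.2 + r = 0 ∧ M w.1 w.2 r ≠ 0 := by
  simp only [resonantPairs, Finset.mem_filter, Finset.mem_product, neg_eq_iff_add_eq_zero]

theorem bilSum_evolve_eq_expSum (A₁ A₂ : Finset (ℤ × ℤ)) (M : ℤ × ℤ → ℤ × ℤ → ℤ × ℤ → ℂ)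
    (f g : L2) (t : ℝ) (r : ℤ × ℤ) :
    bilSum A₁ A₂ M (evolve t f) (evolve t g) r =
      expSum (resonantPairs A₁ A₂ M r)
        (fun w => M w.1 w.2 r * inner ℂ (characterL2 w.1) f * inner ℂ (characterL2 w.2) g)
        (fun w => phase w.1 + phase w.2) t := by
  classical
  rw [bilSum, ← Finset.sum_product', expSum, resonantPairs, Finset.sum_filter]
  refine Finset.sum_congr rfl fun w _ => ?_
  simp only [neg_eq_iff_add_eq_zero, ite_and]
  split_ifs with hres hM
  · rw [evolve_eq, evolve_eq, Complex.ofReal_add, mul_add, Complex.exp_add]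
    ring
  · rw [not_not.mp hM, zero_mul, zero_mul]
  · rfl

theorem sum_sum_resonantPairs_le {A₁ A₂ A₃ : Finset (ℤ × ℤ)} {M : ℤ × ℤ → ℤ × ℤ → ℤ × ℤ → ℂ}
    {μ : ℝ} (hM : ∀ p ∈ A₁, ∀ q ∈ A₂, ∀ r ∈ A₃, p + q + r = 0 → ‖M p q r‖ ≤ μ)
    (f g : ℤ × ℤ → ℂ) :
    ∑ r ∈ A₃, ∑ w ∈ resonantPairs A₁ A₂ M r, ‖M w.1 w.2 r * f w.1 * g w.2‖ ^ 2 ≤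
      μ ^ 2 * ((∑ p ∈ A₁, ‖f p‖ ^ 2) * ∑ q ∈ A₂, ‖g q‖ ^ 2) := by
  classical
  calc ∑ r ∈ A₃, ∑ w ∈ resonantPairs A₁ A₂ M r, ‖M w.1 w.2 r * f w.1 * g w.2‖ ^ 2
      ≤ ∑ r ∈ A₃, ∑ w ∈ A₁ ×ˢ A₂ with -(w.1 + w.2) = r, μ ^ 2 * (‖f w.1‖ ^ 2 * ‖g w.2‖ ^ 2) := by
        refine Finset.sum_le_sum fun r hr => (Finset.sum_le_sum fun w hw => ?_).trans
          (Finset.sum_le_sum_of_subset_of_nonneg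
            (Finset.monotone_filter_right _ fun w _ h => h.1) fun _ _ _ => by positivity)
        obtain ⟨⟨h₁, h₂⟩, hres, -⟩ := mem_resonantPairs.mp hw
        rw [norm_mul, norm_mul, mul_pow, mul_pow, mul_assoc]
        gcongr
        exact hM _ h₁ _ h₂ _ hr hres
    _ ≤ ∑ w ∈ A₁ ×ˢ A₂, μ ^ 2 * (‖f w.1‖ ^ 2 * ‖g w.2‖ ^ 2) :=
        Finset.sum_fiberwise_le_sum_of_sum_fiber_nonneg fun _ _ =>
          Finset.sum_nonneg fun _ _ => by positivity
    _ = _ := by rw [← Finset.mul_sum, Finset.sum_mul_sum, Finset.sum_product]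

/-- The part with frequencies in `A₃` of the product of two free evolutions, with the Fourier
multiplier `M` inserted; as in `triSum`, the output frequency is `r = -(p + q)`. -/
def freeProduct (A₁ A₂ A₃ : Finset (ℤ × ℤ)) (M : ℤ × ℤ → ℤ × ℤ → ℤ × ℤ → ℂ) (t : ℝ) :
    L2 →L[ℂ] L2 →L[ℂ] L2 :=
  ∑ r ∈ A₃, ∑ p ∈ A₁, ∑ q ∈ A₂, if p + q + r = 0 then
    M p q r • (evolveL t p).smulRight ((evolveL t q).smulRight (characterL2 r)) else 0

theorem freeProduct_apply (A₁ A₂ A₃ : Finset (ℤ × ℤ)) (M : ℤ × ℤ → ℤ × ℤ → ℤ × ℤ → ℂ) (t : ℝ)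
    (f g : L2) : freeProduct A₁ A₂ A₃ M t f g =
      ∑ r ∈ A₃, bilSum A₁ A₂ M (evolve t f) (evolve t g) r • characterL2 r := by
  simp only [freeProduct, bilSum, FunLike.coe_sum, Finset.sum_apply, Finset.sum_smul]
  refine Finset.sum_congr rfl fun r _ => Finset.sum_congr rfl fun p _ =>
    Finset.sum_congr rfl fun q _ => ?_
  split_ifs
  · simp [evolve, smul_smul, mul_assoc]
  · simp

theorem enorm_freeProduct_sq (A₁ A₂ A₃ : Finset (ℤ × ℤ)) (M : ℤ × ℤ → ℤ × ℤ → ℤ × ℤ → ℂ) (t : ℝ)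
    (f g : L2) : ‖freeProduct A₁ A₂ A₃ M t f g‖ₑ ^ 2 =
      ∑ r ∈ A₃, ‖bilSum A₁ A₂ M (evolve t f) (evolve t g) r‖ₑ ^ 2 := by
  rw [freeProduct_apply, enorm_sum_smul_characterL2_sq]

theorem continuous_bilSum_evolve (A₁ A₂ : Finset (ℤ × ℤ)) (M : ℤ × ℤ → ℤ × ℤ → ℤ × ℤ → ℂ)
    (f g : L2) (r : ℤ × ℤ) :
    Continuous fun t => bilSum A₁ A₂ M (evolve t f) (evolve t g) r := by
  refine continuous_finsetSum _ fun p _ => continuous_finsetSum _ fun q _ => ?_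
  split_ifs
  · exact ((continuous_evolve f p).const_mul _).mul (continuous_evolve g q)
  · exact continuous_const

theorem continuous_freeProduct (A₁ A₂ A₃ : Finset (ℤ × ℤ)) (M : ℤ × ℤ → ℤ × ℤ → ℤ × ℤ → ℂ)
    (f g : L2) : Continuous fun t => freeProduct A₁ A₂ A₃ M t f g := by
  simp only [freeProduct_apply]
  exact continuous_finsetSum _ fun r _ =>
    (continuous_bilSum_evolve A₁ A₂ M f g r).smul continuous_const

theorem enorm_triSum_evolve_le (A₁ A₂ A₃ : Finset (ℤ × ℤ)) (M : ℤ × ℤ → ℤ × ℤ → ℤ × ℤ → ℂ)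
    (t : ℝ) (f g h : L2) : ‖triSum A₁ A₂ A₃ M (evolve t f) (evolve t g) (evolve t h)‖ₑ ≤
      ‖freeProduct A₁ A₂ A₃ M t f g‖ₑ * ‖h‖ₑ := by
  have sq_rpow (x : ℝ≥0∞) : (x ^ 2) ^ (1 / 2 : ℝ) = x := by
    rw [← ENNReal.rpow_natCast, ← ENNReal.rpow_mul]
    norm_num
  have hCS := ENNReal.inner_le_Lp_mul_Lq A₃
    (fun r => ‖bilSum A₁ A₂ M (evolve t f) (evolve t g) r‖ₑ) (fun r => ‖evolve t h r‖ₑ)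
    Real.HolderConjugate.two_two
  simp only [ENNReal.rpow_two, ← enorm_freeProduct_sq, sq_rpow, ← enorm_mul] at hCS
  rw [triSum_eq_sum_bilSum]
  refine (enorm_sum_le _ _).trans (hCS.trans ?_)
  gcongr
  exact (ENNReal.rpow_le_rpow (sum_enorm_evolve_sq_le A₃ t h) (by norm_num)).trans_eq (sq_rpow _)

/-- The squared constant in the short-time bilinear estimate. -/
def bilConst (J j : ℕ) (μ : ℝ) : ℝ :=
  2 * Real.exp 1 * (((2 : ℝ) ^ J) ^ 2)⁻¹ * (countConst * 2 ^ j) * μ ^ 2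

theorem bilConst_nonneg (J j : ℕ) (μ : ℝ) : 0 ≤ bilConst J j μ := by
  have := countConst_pos
  unfold bilConst
  positivity

section ShortTime

variable {J j : ℕ} {A₂ A₃ : Finset (ℤ × ℤ)} {M : ℤ × ℤ → ℤ × ℤ → ℤ × ℤ → ℂ}

theorem lintegral_enorm_bilSum_evolve_sq_le {r : ℤ × ℤ} (hj : j ≤ J)
    (htrans : ∀ p ∈ annulus j, ∀ q ∈ A₂, p + q + r = 0 → M p q r ≠ 0 → Transversal J p q)
    (α : ℝ) (f g : L2) :
    ∫⁻ t in Ico α (α + (((2 : ℝ) ^ J) ^ 2)⁻¹),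
        ‖bilSum (annulus j) A₂ M (evolve t f) (evolve t g) r‖ₑ ^ 2 ≤
      ENNReal.ofReal (2 * Real.exp 1 * (((2 : ℝ) ^ J) ^ 2)⁻¹ * (countConst * 2 ^ j) *
        ∑ w ∈ resonantPairs (annulus j) A₂ M r,
          ‖M w.1 w.2 r * inner ℂ (characterL2 w.1) f * inner ℂ (characterL2 w.2) g‖ ^ 2) := by
  simp_rw [bilSum_evolve_eq_expSum]
  refine setLIntegral_Ico_add_enorm_expSum_sq_le (by positivity)
    (almostSeparated_of_transversal (k := -r) hj ?_ ?_ ?_) _ α <;>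
    intro w hw <;> obtain ⟨⟨h₁, h₂⟩, hres, hne⟩ := mem_resonantPairs.mp hw
  · exact eq_neg_of_add_eq_zero_left hres
  · exact h₁
  · exact htrans _ h₁ _ h₂ hres hne

theorem lintegral_enorm_freeProduct_sq_le (hj : j ≤ J) {μ : ℝ}
    (hM : ∀ p ∈ annulus j, ∀ q ∈ A₂, ∀ r ∈ A₃, p + q + r = 0 → ‖M p q r‖ ≤ μ)
    (htrans : ∀ p ∈ annulus j, ∀ q ∈ A₂, ∀ r ∈ A₃, p + q + r = 0 → M p q r ≠ 0 →
      Transversal J p q)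
    (α : ℝ) (f g : L2) :
    ∫⁻ t in Ico α (α + (((2 : ℝ) ^ J) ^ 2)⁻¹), ‖freeProduct (annulus j) A₂ A₃ M t f g‖ₑ ^ 2
      ≤ ENNReal.ofReal (bilConst J j μ) * (‖f‖ₑ ^ 2 * ‖g‖ₑ ^ 2) := by
  have hL : 0 < countConst * 2 ^ j := mul_pos countConst_pos (by positivity)
  simp_rw [enorm_freeProduct_sq]
  rw [lintegral_finsetSum _ fun r _ =>
    (continuous_bilSum_evolve _ _ _ f g r).measurable.enorm.pow_const _]
  refine (Finset.sum_le_sum fun r hr => lintegral_enorm_bilSum_evolve_sq_le hj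
    (fun p hp q hq => htrans p hp q hq r hr) α f g).trans ?_
  rw [← ENNReal.ofReal_sum_of_nonneg fun r _ => by positivity, ← Finset.mul_sum]
  simp only [← ofReal_norm, ← ENNReal.ofReal_pow (norm_nonneg _)]
  rw [← ENNReal.ofReal_mul (sq_nonneg _), ← ENNReal.ofReal_mul (bilConst_nonneg _ _ _), bilConst,
    mul_assoc _ (μ ^ 2)]
  have hsum := (sum_sum_resonantPairs_le hM (fun k => inner ℂ (characterL2 k) f)
    fun k => inner ℂ (characterL2 k) g).trans (mul_le_mul_of_nonneg_left (mul_le_mul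
      (orthonormal_characterL2.sum_inner_products_le f)
      (orthonormal_characterL2.sum_inner_products_le g)
      (Finset.sum_nonneg fun _ _ => sq_nonneg _) (sq_nonneg _)) (sq_nonneg μ))
  exact ENNReal.ofReal_le_ofReal (mul_le_mul_of_nonneg_left hsum (by positivity))

end ShortTime

/-! ### Functions of bounded `U²` norm -/

theorem map_sum_indicator {ι α H G : Type*} [Fintype ι] [AddCommMonoid H] [AddCommMonoid G]
    {s : ι → Set α} (hs : Pairwise (Function.onFun Disjoint s)) {F : H → G} (hF : F 0 = 0)
    (φ : ι → H) (τ : α) :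
    F (∑ m, (s m).indicator (fun _ => φ m) τ) = ∑ m, (s m).indicator (fun _ => F (φ m)) τ := by
  by_cases h : ∃ m, τ ∈ s m
  · obtain ⟨m, hm⟩ := h
    have hother : ∀ n, n ≠ m → τ ∉ s n := fun n hn hτ => (hs hn).le_bot ⟨hτ, hm⟩
    rw [Finset.sum_eq_single_of_mem m (Finset.mem_univ m)
        fun n _ hn => indicator_of_notMem (hother n hn) _,
      Finset.sum_eq_single_of_mem m (Finset.mem_univ m)
        fun n _ hn => indicator_of_notMem (hother n hn) _,
      indicator_of_mem hm, indicator_of_mem hm]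
  · have hnone (m) : τ ∉ s m := fun hτ => h ⟨m, hτ⟩
    simp only [indicator_of_notMem (hnone _), Finset.sum_const_zero, hF]

section Atoms

variable {H : Type*} [NormedAddCommGroup H] {a b : ℝ} {f : ℝ → H}

theorem IsU2Atom.exists_disjoint (hf : IsU2Atom a b f) :
    ∃ (K : ℕ) (s : Fin K → Set ℝ) (φ : Fin K → H), Pairwise (Function.onFun Disjoint s) ∧
      (∀ m, MeasurableSet (s m)) ∧ ∑ m, ‖φ m‖ₑ ^ 2 = 1 ∧
      ∀ τ, f τ = ∑ m, (s m).indicator (fun _ => φ m) τ := by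
  obtain ⟨K, t, φ, ht, -, -, hφ, hval⟩ := hf
  refine ⟨K, fun m => Ico (t m.castSucc) (t m.succ), φ,
    (pairwise_disjoint_on _).mpr fun m n hmn => ?_, fun _ => measurableSet_Ico, ?_, hval⟩
  · have hle : t m.succ ≤ t n.castSucc := ht.monotone (Fin.succ_le_castSucc_iff.mpr hmn)
    exact Set.disjoint_left.mpr fun τ hm hn => (hm.2.trans_le hle).not_ge hn.1
  · simp only [← ofReal_norm, ← ENNReal.ofReal_pow (norm_nonneg _)]
    rw [← ENNReal.ofReal_sum_of_nonneg fun _ _ => sq_nonneg _, hφ, ENNReal.ofReal_one]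

theorem IsU2Atom.enorm_le_one (hf : IsU2Atom a b f) (τ : ℝ) : ‖f τ‖ₑ ≤ 1 := by
  obtain ⟨K, s, φ, hs, -, hφ, hval⟩ := hf.exists_disjoint
  have hsq : ‖f τ‖ₑ ^ 2 ≤ 1 := by
    rw [hval, map_sum_indicator hs (F := fun x : H => ‖x‖ₑ ^ 2) (by simp), ← hφ]
    exact Finset.sum_le_sum fun m _ => indicator_le_self' (fun _ _ => zero_le) τ
  exact (pow_le_one_iff two_ne_zero).mp hsq

variable [NormedSpace ℂ H]

theorem IsU2Atom.stronglyMeasurable_clm {E : Type*} [NormedAddCommGroup E] [NormedSpace ℂ E]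
    (hf : IsU2Atom a b f) {L : ℝ → H →L[ℂ] E}
    (hL : ∀ x, StronglyMeasurable fun t => L t x) : StronglyMeasurable fun t => L t (f t) := by
  obtain ⟨K, s, φ, hs, hmeas, -, hval⟩ := hf.exists_disjoint
  have hexpand : (fun t => L t (f t)) = fun t => ∑ m, (s m).indicator (fun t => L t (φ m)) t := by
    ext t
    rw [hval, map_sum_indicator hs (map_zero (L t))]
    rfl
  rw [hexpand]
  exact Finset.stronglyMeasurable_fun_sum _ fun m _ => (hL _).indicator (hmeas m)

theorem exists_atoms_of_U2norm_lt {x : ℝ≥0∞} (h : U2norm a b f < x) :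
    ∃ (c : ℕ → ℂ) (A : ℕ → ℝ → H), (∀ n, IsU2Atom a b (A n)) ∧
      (∀ τ ∈ Ico a b, HasSum (fun n => c n • A n τ) (f τ)) ∧ ∑' n, ‖c n‖ₑ < x := by
  simp only [U2norm, iInf_lt_iff] at h
  obtain ⟨c, A, hA, hs, hx⟩ := h
  exact ⟨c, A, hA, hs, hx⟩

theorem le_mul_U2norm (hf : U2norm a b f ≠ ⊤) {B X : ℝ≥0∞} (hX : X ≠ ⊤)
    (h : ∀ (c : ℕ → ℂ) (A : ℕ → ℝ → H), (∀ n, IsU2Atom a b (A n)) →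
      (∀ τ ∈ Ico a b, HasSum (fun n => c n • A n τ) (f τ)) → ∑' n, ‖c n‖ₑ ≠ ⊤ →
      B ≤ X * ∑' n, ‖c n‖ₑ) : B ≤ X * U2norm a b f := by
  rcases eq_or_ne X 0 with rfl | hX0
  · obtain ⟨c, A, hA, hs, hx⟩ := exists_atoms_of_U2norm_lt hf.lt_top
    simpa only [zero_mul] using h c A hA hs hx.ne
  by_contra! hlt
  rw [mul_comm, ← ENNReal.lt_div_iff_mul_lt (Or.inl hX0) (Or.inl hX)] at hlt
  obtain ⟨c, A, hA, hs, hx⟩ := exists_atoms_of_U2norm_lt hlt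
  have hle := h c A hA hs (ne_top_of_lt hx)
  rw [ENNReal.lt_div_iff_mul_lt (Or.inl hX0) (Or.inl hX), mul_comm] at hx
  exact absurd hle (not_le.mpr hx)

theorem enorm_le_tsum_enorm_of_hasSum {ι E : Type*} [NormedAddCommGroup E] {f : ι → E} {x : E}
    (h : HasSum f x) : ‖x‖ₑ ≤ ∑' i, ‖f i‖ₑ :=
  h.tsum_eq ▸ enorm_tsum_le_tsum_enorm

theorem enorm_le_U2norm (f : ℝ → H) {τ : ℝ} (hτ : τ ∈ Ico a b) : ‖f τ‖ₑ ≤ U2norm a b f := by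
  simp only [U2norm, le_iInf_iff]
  intro c A hA hs
  refine (enorm_le_tsum_enorm_of_hasSum (hs τ hτ)).trans (ENNReal.tsum_le_tsum fun n => ?_)
  rw [enorm_smul]
  exact mul_le_of_le_one_right' ((hA n).enorm_le_one τ)

theorem aemeasurable_clm_of_U2norm_ne_top {L : ℝ → H →L[ℂ] ℂ}
    (hL : ∀ x, StronglyMeasurable fun t => L t x) (hf : U2norm a b f ≠ ⊤) {ν : Measure ℝ}
    (hν : ∀ᵐ t ∂ν, t ∈ Ico a b) : AEMeasurable (fun t => L t (f t)) ν := by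
  obtain ⟨c, A, hA, hs, -⟩ := exists_atoms_of_U2norm_lt hf.lt_top
  have h : Measurable fun t => ∑' n, c n * L t (A n t) :=
    Measurable.tsum fun n => ((hA n).stronglyMeasurable_clm hL).measurable.const_mul _
  refine h.aemeasurable.congr ?_
  filter_upwards [hν] with t ht
  simpa only [map_smul, smul_eq_mul] using ((hs t ht).mapL (L t)).tsum_eq

end Atoms

section Transference

variable {H E G : Type*} [NormedAddCommGroup H] [NormedSpace ℂ H] [NormedAddCommGroup E]
  [NormedSpace ℂ E] [NormedAddCommGroup G] [NormedSpace ℂ G]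
  {B : ℝ → H →L[ℂ] E →L[ℂ] G} {ν : Measure ℝ} {C : ℝ≥0∞} {a₁ b₁ a₂ b₂ : ℝ}
  {f : ℝ → H} {g : ℝ → E}

theorem IsU2Atom.lintegral_enorm_bilinear_sq_le
    (hB : ∀ x y, StronglyMeasurable fun t => B t x y)
    (hC : ∀ x y, ∫⁻ t, ‖B t x y‖ₑ ^ 2 ∂ν ≤ C * (‖x‖ₑ ^ 2 * ‖y‖ₑ ^ 2))
    (hf : IsU2Atom a₁ b₁ f) (hg : IsU2Atom a₂ b₂ g) :
    ∫⁻ t, ‖B t (f t) (g t)‖ₑ ^ 2 ∂ν ≤ C := by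
  obtain ⟨K, s, φ, hs, -, hφ, hf⟩ := hf.exists_disjoint
  obtain ⟨K', s', ψ, hs', -, hψ, hg⟩ := hg.exists_disjoint
  have hmeas (m n) : Measurable fun t => ‖B t (φ m) (ψ n)‖ₑ ^ 2 :=
    (hB _ _).enorm.pow_const _
  have hpt (t : ℝ) : ‖B t (f t) (g t)‖ₑ ^ 2 ≤ ∑ m, ∑ n, ‖B t (φ m) (ψ n)‖ₑ ^ 2 := by
    rw [hf, map_sum_indicator hs (F := fun x => ‖B t x (g t)‖ₑ ^ 2) (by simp)]
    refine Finset.sum_le_sum fun m _ => (indicator_le_self' (fun _ _ => zero_le) t).trans ?_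
    rw [hg, map_sum_indicator hs' (F := fun y => ‖B t (φ m) y‖ₑ ^ 2) (by simp)]
    exact Finset.sum_le_sum fun n _ => indicator_le_self' (fun _ _ => zero_le) t
  calc ∫⁻ t, ‖B t (f t) (g t)‖ₑ ^ 2 ∂ν
      ≤ ∫⁻ t, ∑ m, ∑ n, ‖B t (φ m) (ψ n)‖ₑ ^ 2 ∂ν := lintegral_mono hpt
    _ = ∑ m, ∑ n, ∫⁻ t, ‖B t (φ m) (ψ n)‖ₑ ^ 2 ∂ν := by
        rw [lintegral_finsetSum _ fun m _ => Finset.measurable_fun_sum _ fun n _ => hmeas m n]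
        exact Finset.sum_congr rfl fun m _ => lintegral_finsetSum _ fun n _ => hmeas m n
    _ ≤ ∑ m, ∑ n, C * (‖φ m‖ₑ ^ 2 * ‖ψ n‖ₑ ^ 2) :=
        Finset.sum_le_sum fun m _ => Finset.sum_le_sum fun n _ => hC _ _
    _ = C := by simp only [← Finset.mul_sum, hφ, hψ, mul_one]

theorem IsU2Atom.lintegral_enorm_bilinear_le
    (hB : ∀ x y, StronglyMeasurable fun t => B t x y)
    (hC : ∀ x y, ∫⁻ t, ‖B t x y‖ₑ ^ 2 ∂ν ≤ C * (‖x‖ₑ ^ 2 * ‖y‖ₑ ^ 2))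
    (hf : IsU2Atom a₁ b₁ f) (hg : IsU2Atom a₂ b₂ g) :
    ∫⁻ t, ‖B t (f t) (g t)‖ₑ ∂ν ≤ (C * ν univ) ^ (1 / 2 : ℝ) := by
  have hmeas := (hg.stronglyMeasurable_clm fun y =>
    hf.stronglyMeasurable_clm (L := fun t => (B t).flip y) fun x => hB x y).enorm
  have h := ENNReal.lintegral_mul_le_Lp_mul_Lq ν Real.HolderConjugate.two_two
    hmeas.aemeasurable (aemeasurable_const (b := (1 : ℝ≥0∞)))
  simp only [Pi.mul_apply, mul_one, one_pow, lintegral_const, one_mul,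
    ENNReal.rpow_two] at h
  refine h.trans ?_
  rw [ENNReal.mul_rpow_of_nonneg _ _ (by norm_num)]
  gcongr
  exact hf.lintegral_enorm_bilinear_sq_le hB hC hg

theorem enorm_bilinear_le_of_hasSum (B : H →L[ℂ] E →L[ℂ] G) {ι κ : Type*} {c : ι → ℂ} {d : κ → ℂ}
    {F : ι → H} {F' : κ → E} {x : H} {y : E} (hx : HasSum (fun i => c i • F i) x)
    (hy : HasSum (fun j => d j • F' j) y) :
    ‖B x y‖ₑ ≤ ∑' i, ‖c i‖ₑ * ∑' j, ‖d j‖ₑ * ‖B (F i) (F' j)‖ₑ := by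
  refine (enorm_le_tsum_enorm_of_hasSum (hx.mapL (B.flip y))).trans
    (ENNReal.tsum_le_tsum fun i => ?_)
  rw [map_smul, enorm_smul, ContinuousLinearMap.flip_apply]
  gcongr
  refine (enorm_le_tsum_enorm_of_hasSum (hy.mapL (B (F i)))).trans_eq (tsum_congr fun j => ?_)
  rw [map_smul, enorm_smul]

/-- An `L²` bound for free solutions transfers to `U²`, as it holds for every pair of pieces of
two atoms and the squares of the pieces add up. -/
theorem lintegral_enorm_bilinear_le_U2norm [IsFiniteMeasure ν]
    (hB : ∀ x y, StronglyMeasurable fun t => B t x y) (hCtop : C ≠ ⊤)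
    (hC : ∀ x y, ∫⁻ t, ‖B t x y‖ₑ ^ 2 ∂ν ≤ C * (‖x‖ₑ ^ 2 * ‖y‖ₑ ^ 2))
    (hν₁ : ∀ᵐ t ∂ν, t ∈ Ico a₁ b₁) (hν₂ : ∀ᵐ t ∂ν, t ∈ Ico a₂ b₂)
    (hf : U2norm a₁ b₁ f ≠ ⊤) (hg : U2norm a₂ b₂ g ≠ ⊤) :
    ∫⁻ t, ‖B t (f t) (g t)‖ₑ ∂ν ≤ (C * ν univ) ^ (1 / 2 : ℝ) * U2norm a₁ b₁ f * U2norm a₂ b₂ g := by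
  set D := (C * ν univ) ^ (1 / 2 : ℝ)
  have hD : D ≠ ⊤ := ENNReal.rpow_ne_top_of_nonneg (by norm_num)
    (ENNReal.mul_ne_top hCtop (measure_ne_top ν _))
  refine le_mul_U2norm hg (ENNReal.mul_ne_top hD hf) fun d F' hF' hg' hd => ?_
  rw [mul_right_comm]
  refine le_mul_U2norm hf (ENNReal.mul_ne_top hD hd) fun c F hF hf' _ => ?_
  have hmeas (n m) : Measurable fun t => ‖B t (F n t) (F' m t)‖ₑ :=
    ((hF' m).stronglyMeasurable_clm fun y => (hF n).stronglyMeasurable_clm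
      (L := fun t => (B t).flip y) fun x => hB x y).enorm
  calc ∫⁻ t, ‖B t (f t) (g t)‖ₑ ∂ν
      ≤ ∫⁻ t, ∑' n, ‖c n‖ₑ * ∑' m, ‖d m‖ₑ * ‖B t (F n t) (F' m t)‖ₑ ∂ν := by
        refine lintegral_mono_ae ?_
        filter_upwards [hν₁, hν₂] with t ht₁ ht₂
        exact enorm_bilinear_le_of_hasSum (B t) (hf' t ht₁) (hg' t ht₂)
    _ = ∑' n, ‖c n‖ₑ * ∑' m, ‖d m‖ₑ * ∫⁻ t, ‖B t (F n t) (F' m t)‖ₑ ∂ν := by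
        rw [lintegral_tsum fun n => (Measurable.const_mul (Measurable.tsum fun m =>
          (hmeas n m).const_mul _) _).aemeasurable]
        refine tsum_congr fun n => ?_
        rw [lintegral_const_mul _ (Measurable.tsum fun m => (hmeas n m).const_mul _),
          lintegral_tsum fun m => ((hmeas n m).const_mul _).aemeasurable]
        simp only [lintegral_const_mul _ (hmeas n _)]
    _ ≤ ∑' n, ‖c n‖ₑ * ∑' m, ‖d m‖ₑ * D := by
        gcongr with n m
        exact (hF n).lintegral_enorm_bilinear_le hB hC (hF' m)
    _ = D * (∑' n, ‖d n‖ₑ) * ∑' n, ‖c n‖ₑ := by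
        rw [ENNReal.tsum_mul_right, ENNReal.tsum_mul_right]
        ring

end Transference

/-! ### The short-time trilinear estimate -/

/-- The constant in the trilinear estimate. -/
def triConst : ℝ≥0 := 2 * Real.toNNReal (Real.sqrt (2 * Real.exp 1 * countConst))

theorem triConst_pos : 0 < triConst := by
  have := countConst_pos
  unfold triConst
  positivity

theorem two_mul_bilConst_rpow (J j : ℕ) (μ : ℝ≥0) :
    2 * ENNReal.ofReal (bilConst J j μ * (((2 : ℝ) ^ J) ^ 2)⁻¹) ^ (1 / 2 : ℝ) =
      triConst * μ * ((2 : ℝ≥0∞) ^ j) ^ (1 / 2 : ℝ) * ENNReal.ofReal ((((2 : ℝ) ^ J) ^ 2)⁻¹) := by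
  have hc := countConst_pos
  have e : bilConst J j μ * (((2 : ℝ) ^ J) ^ 2)⁻¹ =
      (2 * Real.exp 1 * countConst) * 2 ^ j * (μ * (((2 : ℝ) ^ J) ^ 2)⁻¹) ^ 2 := by
    rw [bilConst]; ring
  have h2 : ((2 : ℝ≥0∞) ^ j) = ENNReal.ofReal (2 ^ j) := by
    rw [ENNReal.ofReal_pow (by norm_num)]; norm_num
  rw [e, ENNReal.ofReal_rpow_of_nonneg (by positivity) (by norm_num), h2,
    ENNReal.ofReal_rpow_of_nonneg (by positivity) (by norm_num), triConst, ← Real.sqrt_eq_rpow,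
    ← Real.sqrt_eq_rpow, Real.sqrt_mul (by positivity), Real.sqrt_mul (by positivity),
    Real.sqrt_sq (by positivity), ENNReal.ofReal_mul (by positivity),
    ENNReal.ofReal_mul (by positivity), ENNReal.ofReal_mul (by positivity),
    ENNReal.ofReal_coe_nnreal]
  simp only [ENNReal.coe_mul, ENNReal.coe_ofNat, ENNReal.ofReal]
  ring

section ShortTime

variable {a b b₁ b₂ b₃ : ℝ} {f₁ f₂ f₃ : ℝ → L2}

theorem ae_restrict_Ico_mem_Ico (hb : b ≤ b₁) : ∀ᵐ t ∂volume.restrict (Ico a b), t ∈ Ico a b₁ := by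
  filter_upwards [ae_restrict_mem measurableSet_Ico] with t ht
  exact ⟨ht.1, ht.2.trans_le hb⟩

theorem aemeasurable_triSum_evolve (A₁ A₂ A₃ : Finset (ℤ × ℤ)) (M : ℤ × ℤ → ℤ × ℤ → ℤ × ℤ → ℂ)
    (hb₁ : b ≤ b₁) (hb₂ : b ≤ b₂) (hb₃ : b ≤ b₃) (h₁ : U2norm a b₁ f₁ ≠ ⊤)
    (h₂ : U2norm a b₂ f₂ ≠ ⊤) (h₃ : U2norm a b₃ f₃ ≠ ⊤) :
    AEMeasurable (fun t => triSum A₁ A₂ A₃ M (evolve t (f₁ t)) (evolve t (f₂ t)) (evolve t (f₃ t)))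
      (volume.restrict (Ico a b)) := by
  have hevolve {β : ℝ} {f : ℝ → L2} (hβ : b ≤ β) (hf : U2norm a β f ≠ ⊤) (k : ℤ × ℤ) :
      AEMeasurable (fun t => evolve t (f t) k) (volume.restrict (Ico a b)) :=
    aemeasurable_clm_of_U2norm_ne_top (L := fun t => evolveL t k)
      (fun x => (continuous_evolve x k).stronglyMeasurable) hf (ae_restrict_Ico_mem_Ico hβ)
  refine Finset.aemeasurable_fun_sum _ fun p _ => Finset.aemeasurable_fun_sum _ fun q _ =>
    Finset.aemeasurable_fun_sum _ fun r _ => ?_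
  split_ifs
  · exact (((hevolve hb₁ h₁ p).const_mul _).mul (hevolve hb₂ h₂ q)).mul (hevolve hb₃ h₃ r)
  · exact aemeasurable_const

theorem lintegral_triSum_transversal_le {J j : ℕ} (hj : j ≤ J) {A₂ A₃ : Finset (ℤ × ℤ)}
    {M : ℤ × ℤ → ℤ × ℤ → ℤ × ℤ → ℂ} {μ : ℝ}
    (hM : ∀ p ∈ annulus j, ∀ q ∈ A₂, ∀ r ∈ A₃, p + q + r = 0 → ‖M p q r‖ ≤ μ)
    (htrans : ∀ p ∈ annulus j, ∀ q ∈ A₂, ∀ r ∈ A₃, p + q + r = 0 → M p q r ≠ 0 →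
      Transversal J p q)
    (hb : b ≤ a + (((2 : ℝ) ^ J) ^ 2)⁻¹) (hb₁ : b ≤ b₁) (hb₂ : b ≤ b₂) (hb₃ : b ≤ b₃)
    (h₁ : U2norm a b₁ f₁ ≠ ⊤) (h₂ : U2norm a b₂ f₂ ≠ ⊤) (h₃ : U2norm a b₃ f₃ ≠ ⊤) :
    ∫⁻ t in Ico a b,
        ‖triSum (annulus j) A₂ A₃ M (evolve t (f₁ t)) (evolve t (f₂ t)) (evolve t (f₃ t))‖ₑ ≤
      ENNReal.ofReal (bilConst J j μ * (((2 : ℝ) ^ J) ^ 2)⁻¹) ^ (1 / 2 : ℝ) *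
        (U2norm a b₁ f₁ * U2norm a b₂ f₂ * U2norm a b₃ f₃) := by
  have hbil := lintegral_enorm_bilinear_le_U2norm
    (fun x y => (continuous_freeProduct (annulus j) A₂ A₃ M x y).stronglyMeasurable)
    ENNReal.ofReal_ne_top
    (fun x y => (lintegral_mono_set (Ico_subset_Ico_right hb)).trans
      (lintegral_enorm_freeProduct_sq_le hj hM htrans a x y))
    (ae_restrict_Ico_mem_Ico hb₁) (ae_restrict_Ico_mem_Ico hb₂) h₁ h₂
  calc ∫⁻ t in Ico a b,
        ‖triSum (annulus j) A₂ A₃ M (evolve t (f₁ t)) (evolve t (f₂ t)) (evolve t (f₃ t))‖ₑ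
      ≤ ∫⁻ t in Ico a b, ‖freeProduct (annulus j) A₂ A₃ M t (f₁ t) (f₂ t)‖ₑ * U2norm a b₃ f₃ := by
        refine setLIntegral_mono' measurableSet_Ico fun t ht =>
          (enorm_triSum_evolve_le _ _ _ _ _ _ _ _).trans ?_
        gcongr
        exact enorm_le_U2norm f₃ ⟨ht.1, ht.2.trans_le hb₃⟩
    _ = (∫⁻ t in Ico a b, ‖freeProduct (annulus j) A₂ A₃ M t (f₁ t) (f₂ t)‖ₑ) * U2norm a b₃ f₃ :=
        lintegral_mul_const' _ _ h₃
    _ ≤ (ENNReal.ofReal (bilConst J j μ) * volume.restrict (Ico a b) univ) ^ (1 / 2 : ℝ) *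
          U2norm a b₁ f₁ * U2norm a b₂ f₂ * U2norm a b₃ f₃ := by gcongr
    _ ≤ _ := by
        rw [ENNReal.ofReal_mul (bilConst_nonneg _ _ _), Measure.restrict_apply_univ,
          Real.volume_Ico, ← mul_assoc, ← mul_assoc]
        gcongr
        linarith

variable {j₁ j₂ j₃ J : ℕ} {M : ℤ × ℤ → ℤ × ℤ → ℤ × ℤ → ℂ} {μ : ℝ≥0}

/-- Every resonant triple is transversal in `(p, q)` or in `(p, r)`, so `M` splits into two
multipliers to each of which the bilinear estimate applies. -/
theorem lintegral_triSum_low_le (hJ : J = max j₂ j₃) (hj : j₁ ≤ J)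
    (hM : ∀ p ∈ annulus j₁, ∀ q ∈ annulus j₂, ∀ r ∈ annulus j₃, p + q + r = 0 → ‖M p q r‖ ≤ μ)
    (hb : b ≤ a + (((2 : ℝ) ^ J) ^ 2)⁻¹) (hb₁ : b ≤ b₁) (hb₂ : b ≤ b₂) (hb₃ : b ≤ b₃)
    (h₁ : U2norm a b₁ f₁ ≠ ⊤) (h₂ : U2norm a b₂ f₂ ≠ ⊤) (h₃ : U2norm a b₃ f₃ ≠ ⊤) :
    ∫⁻ t in Ico a b, ‖triSum (annulus j₁) (annulus j₂) (annulus j₃) M (evolve t (f₁ t))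
        (evolve t (f₂ t)) (evolve t (f₃ t))‖ₑ ≤
      triConst * μ * ((2 : ℝ≥0∞) ^ j₁) ^ (1 / 2 : ℝ) * ENNReal.ofReal ((((2 : ℝ) ^ J) ^ 2)⁻¹) *
        (U2norm a b₁ f₁ * U2norm a b₂ f₂ * U2norm a b₃ f₃) := by
  classical
  let M₁ : ℤ × ℤ → ℤ × ℤ → ℤ × ℤ → ℂ := fun p q r => if Transversal J p q then M p q r else 0
  let M₂ : ℤ × ℤ → ℤ × ℤ → ℤ × ℤ → ℂ := fun p r q => if Transversal J p q then 0 else M p q r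
  have hsplit : M = M₁ + fun p q r => M₂ p r q := by
    ext p q r
    simp only [M₁, M₂, Pi.add_apply]
    split_ifs <;> simp
  have hbound {P : Prop} [Decidable P] {z : ℂ} (hz : ‖z‖ ≤ μ) : ‖if P then z else 0‖ ≤ μ := by
    split_ifs
    exacts [hz, norm_zero.trans_le μ.2]
  have hmem {q r : ℤ × ℤ} (hq : q ∈ annulus j₂) (hr : r ∈ annulus j₃) :
      q ∈ annulus J ∨ r ∈ annulus J := by
    rcases max_choice j₂ j₃ with h | h
    exacts [.inl (by rwa [hJ, h]), .inr (by rwa [hJ, h])]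
  have hest₁ := lintegral_triSum_transversal_le (M := M₁) hj
    (fun p hp q hq r hr h0 => hbound (hM p hp q hq r hr h0))
    (fun _ _ _ _ _ _ _ hne => of_not_not fun h => hne (if_neg h))
    hb hb₁ hb₂ hb₃ h₁ h₂ h₃
  have hest₂ := lintegral_triSum_transversal_le (A₂ := annulus j₃) (A₃ := annulus j₂) (M := M₂) hj
    (fun p hp r hr q hq h0 => by
      simp only [M₂, ← ite_not (Transversal J p q)]
      exact hbound (hM p hp q hq r hr (by rw [← h0]; abel)))
    (fun _ _ r hr q hq h0 hne =>
      (transversal_or (hmem hq hr) (by rw [← h0]; abel)).resolve_left fun h => hne (if_pos h))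
    hb hb₁ hb₃ hb₂ h₁ h₃ h₂
  rw [← two_mul_bilConst_rpow]
  calc _ ≤ ∫⁻ t in Ico a b,
          ‖triSum (annulus j₁) (annulus j₂) (annulus j₃) M₁ (evolve t (f₁ t)) (evolve t (f₂ t))
            (evolve t (f₃ t))‖ₑ +
          ‖triSum (annulus j₁) (annulus j₃) (annulus j₂) M₂ (evolve t (f₁ t)) (evolve t (f₃ t))
            (evolve t (f₂ t))‖ₑ := by
        refine lintegral_mono fun t => ?_
        rw [hsplit, triSum_add, triSum_swap_right _ _ _ fun p q r => M₂ p r q]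
        exact enorm_add_le _ _
    _ ≤ _ := by
        rw [lintegral_add_left'
          (aemeasurable_triSum_evolve _ _ _ M₁ hb₁ hb₂ hb₃ h₁ h₂ h₃).enorm]
        exact (add_le_add hest₁ hest₂).trans_eq (by ring)

end ShortTime

section LongTime

theorem setLIntegral_Ico_le_nat_mul {δ T : ℝ} (hδ : 0 < δ) {n : ℕ} (hn : T ≤ n * δ)
    {F : ℝ → ℝ≥0∞} {X : ℝ≥0∞}
    (h : ∀ a ∈ Ico 0 T, ∫⁻ t in Ico a (min (a + δ) T), F t ≤ X) :
    ∫⁻ t in Ico 0 T, F t ≤ n * X := by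
  have hcover : Ico 0 T ⊆ ⋃ i : Fin n, Ico (i * δ) (min (i * δ + δ) T) := by
    intro t ht
    have hfloor : (⌊t / δ⌋₊ : ℝ) * δ ≤ t :=
      (le_div_iff₀ hδ).mp (Nat.floor_le (div_nonneg ht.1 hδ.le))
    have hlt : t < (⌊t / δ⌋₊ + 1) * δ := (div_lt_iff₀ hδ).mp (Nat.lt_floor_add_one _)
    rw [add_one_mul] at hlt
    refine mem_iUnion.mpr ⟨⟨⌊t / δ⌋₊, ?_⟩, hfloor, lt_min hlt ht.2⟩
    rw [Nat.floor_lt (div_nonneg ht.1 hδ.le), div_lt_iff₀ hδ]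
    exact ht.2.trans_le hn
  have hpiece (i : Fin n) : ∫⁻ t in Ico (i * δ) (min (i * δ + δ) T), F t ≤ X := by
    rcases lt_or_ge (i * δ : ℝ) T with hi | hi
    · exact h _ ⟨by positivity, hi⟩
    · simp [Ico_eq_empty_of_le ((min_le_right (i * δ + δ) T).trans hi)]
  calc ∫⁻ t in Ico 0 T, F t
      ≤ ∫⁻ t in ⋃ i : Fin n, Ico (i * δ) (min (i * δ + δ) T), F t := lintegral_mono_set hcover
    _ ≤ ∑' i : Fin n, ∫⁻ t in Ico (i * δ) (min (i * δ + δ) T), F t := lintegral_iUnion_le _ _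
    _ ≤ n * X := by
        rw [tsum_fintype]
        exact (Finset.sum_le_card_nsmul _ _ X fun i _ => hpiece i).trans_eq (by simp)

/-- Handles the cases `0 * ∞` in a product of extended norms. -/
theorem le_mul_mul_of_ne_top {c x X₁ X₂ X₃ : ℝ≥0∞} (hc : c ≠ 0)
    (hzero : X₁ = 0 ∨ X₂ = 0 ∨ X₃ = 0 → x = 0)
    (hfin : X₁ ≠ ⊤ → X₂ ≠ ⊤ → X₃ ≠ ⊤ → x ≤ c * (X₁ * X₂ * X₃)) : x ≤ c * (X₁ * X₂ * X₃) := by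
  by_cases h0 : X₁ = 0 ∨ X₂ = 0 ∨ X₃ = 0
  · exact (hzero h0).trans_le zero_le
  push Not at h0
  obtain ⟨n₁, n₂, n₃⟩ := h0
  by_cases htop : X₁ = ⊤ ∨ X₂ = ⊤ ∨ X₃ = ⊤
  · have : X₁ * X₂ * X₃ = ⊤ := by
      rcases htop with rfl | rfl | rfl <;> simp [ENNReal.top_mul, ENNReal.mul_top, *]
    simp [this, ENNReal.mul_top hc]
  push Not at htop
  exact hfin htop.1 htop.2.1 htop.2.2

/-- The supremum in the definition of `Fnorm` at the dyadic frequency `2 ^ j`. -/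
def shortNorm (T : ℝ) (u : ℝ → Torus → ℝ) (j : ℕ) : ℝ≥0∞ :=
  ⨆ a ∈ Ico 0 T, U2norm a (min (a + ((2 : ℝ) ^ j)⁻¹ ^ 2) T) (fun t => backProj j t (u t))

theorem U2norm_le_shortNorm {T a : ℝ} (ha : a ∈ Ico 0 T) (u : ℝ → Torus → ℝ) (j : ℕ) :
    U2norm a (min (a + ((2 : ℝ) ^ j)⁻¹ ^ 2) T) (fun t => backProj j t (u t)) ≤ shortNorm T u j :=
  le_iSup₂ (f := fun a (_ : a ∈ Ico 0 T) =>
    U2norm a (min (a + ((2 : ℝ) ^ j)⁻¹ ^ 2) T) (fun t => backProj j t (u t))) a ha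

theorem coeff_eq_zero_of_shortNorm {T t : ℝ} (ht : t ∈ Ico 0 T) {u : ℝ → Torus → ℝ} {j : ℕ}
    (h : shortNorm T u j = 0) {k : ℤ × ℤ} (hk : k ∈ annulus j) : coeff (u t) k = 0 := by
  have hmem : t ∈ Ico t (min (t + ((2 : ℝ) ^ j)⁻¹ ^ 2) T) :=
    ⟨le_rfl, lt_min (lt_add_of_pos_right t (by positivity)) ht.2⟩
  have hle := (enorm_le_U2norm (fun t => backProj j t (u t)) hmem).trans
    (U2norm_le_shortNorm ht u j)
  rw [h, nonpos_iff_eq_zero, enorm_eq_zero] at hle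
  rw [← evolve_backProj hk t (u t), hle, evolve_zero, Pi.zero_apply]

variable {j₁ j₂ j₃ : ℕ} {M : ℤ × ℤ → ℤ × ℤ → ℤ × ℤ → ℂ} {μ : ℝ≥0} {T : ℝ}

theorem triSum_coeff_eq_zero {u₁ u₂ u₃ : ℝ → Torus → ℝ} (M : ℤ × ℤ → ℤ × ℤ → ℤ × ℤ → ℂ)
    (h : shortNorm T u₁ j₁ = 0 ∨ shortNorm T u₂ j₂ = 0 ∨ shortNorm T u₃ j₃ = 0) {t : ℝ}
    (ht : t ∈ Ico 0 T) : triSum (annulus j₁) (annulus j₂) (annulus j₃) M (coeff (u₁ t))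
      (coeff (u₂ t)) (coeff (u₃ t)) = 0 := by
  refine Finset.sum_eq_zero fun p hp => Finset.sum_eq_zero fun q hq =>
    Finset.sum_eq_zero fun r hr => ?_
  rcases h with h | h | h
  · simp [coeff_eq_zero_of_shortNorm ht h hp]
  · simp [coeff_eq_zero_of_shortNorm ht h hq]
  · simp [coeff_eq_zero_of_shortNorm ht h hr]

theorem lintegral_triSum_coeff_shortTime_le (hj : j₁ ≤ max j₂ j₃)
    (hM : ∀ p ∈ annulus j₁, ∀ q ∈ annulus j₂, ∀ r ∈ annulus j₃, p + q + r = 0 → ‖M p q r‖ ≤ μ)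
    {u₁ u₂ u₃ : ℝ → Torus → ℝ} (h₁ : shortNorm T u₁ j₁ ≠ ⊤) (h₂ : shortNorm T u₂ j₂ ≠ ⊤)
    (h₃ : shortNorm T u₃ j₃ ≠ ⊤) {a : ℝ} (ha : a ∈ Ico 0 T) :
    ∫⁻ t in Ico a (min (a + (((2 : ℝ) ^ max j₂ j₃) ^ 2)⁻¹) T),
        ‖triSum (annulus j₁) (annulus j₂) (annulus j₃) M (coeff (u₁ t)) (coeff (u₂ t))
          (coeff (u₃ t))‖ₑ ≤
      triConst * μ * ((2 : ℝ≥0∞) ^ j₁) ^ (1 / 2 : ℝ) *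
        ENNReal.ofReal ((((2 : ℝ) ^ max j₂ j₃) ^ 2)⁻¹) *
          (shortNorm T u₁ j₁ * shortNorm T u₂ j₂ * shortNorm T u₃ j₃) := by
  have hb {j : ℕ} (hj : j ≤ max j₂ j₃) : min (a + (((2 : ℝ) ^ max j₂ j₃) ^ 2)⁻¹) T ≤
      min (a + ((2 : ℝ) ^ j)⁻¹ ^ 2) T := by
    rw [inv_pow]
    gcongr
    exact one_le_two
  have hcoeff (u : ℝ → Torus → ℝ) (j : ℕ) (t : ℝ) :
      ∀ k ∈ annulus j, coeff (u t) k = evolve t (backProj j t (u t)) k :=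
    fun k hk => (evolve_backProj hk t (u t)).symm
  simp_rw [fun t => triSum_congr M (hcoeff u₁ j₁ t) (hcoeff u₂ j₂ t) (hcoeff u₃ j₃ t)]
  refine (lintegral_triSum_low_le rfl hj hM (min_le_left _ _)
    (hb hj) (hb (le_max_left _ _)) (hb (le_max_right _ _))
    (ne_top_of_le_ne_top h₁ (U2norm_le_shortNorm ha u₁ j₁))
    (ne_top_of_le_ne_top h₂ (U2norm_le_shortNorm ha u₂ j₂))
    (ne_top_of_le_ne_top h₃ (U2norm_le_shortNorm ha u₃ j₃))).trans ?_
  gcongr <;> exact U2norm_le_shortNorm ha _ _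

theorem lintegral_triSum_coeff_low_le (hj : j₁ ≤ max j₂ j₃) (hμ : 0 < μ)
    (hM : ∀ p ∈ annulus j₁, ∀ q ∈ annulus j₂, ∀ r ∈ annulus j₃, p + q + r = 0 → ‖M p q r‖ ≤ μ)
    (hT : T ≤ 1) (u₁ u₂ u₃ : ℝ → Torus → ℝ) :
    ∫⁻ t in Ico 0 T, ‖triSum (annulus j₁) (annulus j₂) (annulus j₃) M (coeff (u₁ t)) (coeff (u₂ t))
      (coeff (u₃ t))‖ₑ ≤ triConst * μ * ((2 : ℝ≥0∞) ^ j₁) ^ (1 / 2 : ℝ) *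
        (shortNorm T u₁ j₁ * shortNorm T u₂ j₂ * shortNorm T u₃ j₃) := by
  refine le_mul_mul_of_ne_top (by simp [triConst_pos.ne', hμ.ne']) (fun h => ?_)
    fun h₁ h₂ h₃ => ?_
  · refine setLIntegral_eq_zero measurableSet_Ico fun t ht => ?_
    rw [triSum_coeff_eq_zero M h ht, enorm_zero, Pi.zero_apply]
  set δ : ℝ := (((2 : ℝ) ^ max j₂ j₃) ^ 2)⁻¹
  have hδ : 0 < δ := by positivity
  have hcard : ((4 ^ max j₂ j₃ : ℕ) : ℝ) * δ = 1 := by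
    rw [show δ = (4 ^ max j₂ j₃)⁻¹ by
      simp only [δ, ← pow_mul, mul_comm _ 2]; rw [pow_mul]; norm_num]
    push_cast
    exact mul_inv_cancel₀ (by positivity)
  refine (setLIntegral_Ico_le_nat_mul hδ (hT.trans_eq hcard.symm) fun a ha =>
    lintegral_triSum_coeff_shortTime_le hj hM h₁ h₂ h₃ ha).trans_eq ?_
  calc _ = triConst * μ * ((2 : ℝ≥0∞) ^ j₁) ^ (1 / 2 : ℝ) *
        ENNReal.ofReal ((4 ^ max j₂ j₃ : ℕ) * δ) *
          (shortNorm T u₁ j₁ * shortNorm T u₂ j₂ * shortNorm T u₃ j₃) := by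
        rw [ENNReal.ofReal_mul (by positivity), ENNReal.ofReal_natCast]
        ring
    _ = _ := by rw [hcard, ENNReal.ofReal_one, mul_one]

theorem lintegral_triSum_coeff_le (hμ : 0 < μ)
    (hM : ∀ p ∈ annulus j₁, ∀ q ∈ annulus j₂, ∀ r ∈ annulus j₃, p + q + r = 0 → ‖M p q r‖ ≤ μ)
    (hT : T ≤ 1) (u₁ u₂ u₃ : ℝ → Torus → ℝ) :
    ∫⁻ t in Ico 0 T, ‖triSum (annulus j₁) (annulus j₂) (annulus j₃) M (coeff (u₁ t)) (coeff (u₂ t))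
      (coeff (u₃ t))‖ₑ ≤ triConst * μ * ((2 : ℝ≥0∞) ^ min j₁ (min j₂ j₃)) ^ (1 / 2 : ℝ) *
        (shortNorm T u₁ j₁ * shortNorm T u₂ j₂ * shortNorm T u₃ j₃) := by
  by_cases hc : j₁ ≤ j₂ ∧ j₁ ≤ j₃
  · rw [min_eq_left (le_min hc.1 hc.2)]
    exact lintegral_triSum_coeff_low_le (le_max_of_le_left hc.1) hμ hM hT u₁ u₂ u₃
  rcases le_total j₂ j₃ with h23 | h32
  · rw [show min j₁ (min j₂ j₃) = j₂ by lia]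
    simp_rw [triSum_swap_left (annulus j₁)]
    refine (lintegral_triSum_coeff_low_le (by lia) hμ ?_ hT u₂ u₁ u₃).trans_eq (by ring)
    intro p hp q hq r hr h0
    exact hM q hq p hp r hr (by rw [add_comm q p, h0])
  · rw [show min j₁ (min j₂ j₃) = j₃ by lia]
    simp_rw [triSum_swap_right (annulus j₁) (annulus j₂),
      triSum_swap_left (annulus j₁) (annulus j₃)]
    refine (lintegral_triSum_coeff_low_le (by lia) hμ ?_ hT u₃ u₁ u₂).trans_eq (by ring)
    intro p hp q hq r hr h0
    exact hM q hq r hr p hp (by rw [← h0]; abel)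

end LongTime

/-! ### Smooth functions on the torus -/

/-- The lift of a function on `ℝ × 𝕋²` to a function on `ℝ × ℝ²`, periodic in space. -/
def lift (w : ℝ → Torus → ℝ) (q : ℝ × ℝ × ℝ) : ℝ := w q.1 ((q.2.1 : Circle1), (q.2.2 : Circle1))

/-- Smoothness up to the boundary on `[0, T] × 𝕋²`, expressed through the periodic lift. -/
def SmoothOn (T : ℝ) (w : ℝ → Torus → ℝ) : Prop := ContDiffOn ℝ ∞ (lift w) (Icc 0 T ×ˢ univ)

/-- The element of the torus represented by `s e ∈ ℝ²`. -/
def shift (e : ℝ × ℝ) (s : ℝ) : Torus := (((s * e.1 : ℝ) : Circle1), ((s * e.2 : ℝ) : Circle1))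

/-- The directional derivative in space along `e ∈ ℝ²`; an iterated one is again a function on
`ℝ × 𝕋²`. -/
def dirDeriv (e : ℝ × ℝ) (w : ℝ → Torus → ℝ) (t : ℝ) (p : Torus) : ℝ :=
  deriv (fun s : ℝ => w t (p + shift e s)) 0

/-- The time derivative, one-sided at the end points of `[0, T]`. -/
def timeDeriv (T : ℝ) (w : ℝ → Torus → ℝ) (t : ℝ) (p : Torus) : ℝ :=
  derivWithin (fun τ => w τ p) (Icc 0 T) t

theorem exists_coe_eq (p : Torus) : ∃ x ∈ Icc 0 (2 * Real.pi), ∃ y ∈ Icc 0 (2 * Real.pi),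
    p = ((x : Circle1), (y : Circle1)) := by
  obtain ⟨x, hx, hx'⟩ := AddCircle.eq_coe_Ico p.1
  obtain ⟨y, hy, hy'⟩ := AddCircle.eq_coe_Ico p.2
  exact ⟨x, Ico_subset_Icc_self hx, y, Ico_subset_Icc_self hy, Prod.ext hx'.symm hy'.symm⟩

theorem uniqueDiffOn_slab {T : ℝ} (hT : 0 < T) :
    UniqueDiffOn ℝ (Icc 0 T ×ˢ (univ : Set (ℝ × ℝ))) :=
  (uniqueDiffOn_Icc hT).prod uniqueDiffOn_univ

namespace SmoothOn

variable {T : ℝ} {w w' : ℝ → Torus → ℝ}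

theorem hasFDerivWithinAt (hw : SmoothOn T w) {q : ℝ × ℝ × ℝ} (hq : q ∈ Icc 0 T ×ˢ univ) :
    HasFDerivWithinAt (lift w) (fderivWithin ℝ (lift w) (Icc 0 T ×ˢ univ) q) (Icc 0 T ×ˢ univ) q :=
  (hw.differentiableOn (by simp) q hq).hasFDerivWithinAt

theorem hasDerivAt_lift (hw : SmoothOn T w) {t : ℝ} (ht : t ∈ Icc 0 T) (e : ℝ × ℝ) (x y s : ℝ) :
    HasDerivAt (fun s : ℝ => lift w (t, x + s * e.1, y + s * e.2))
      (fderivWithin ℝ (lift w) (Icc 0 T ×ˢ univ) (t, x + s * e.1, y + s * e.2) (0, e.1, e.2))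
      s := by
  have hline : HasDerivAt (fun s : ℝ => (t, x + s * e.1, y + s * e.2)) (0, e.1, e.2) s := by
    refine (hasDerivAt_const s t).prodMk (HasDerivAt.prodMk ?_ ?_)
    · simpa using ((hasDerivAt_id s).mul_const e.1).const_add x
    · simpa using ((hasDerivAt_id s).mul_const e.2).const_add y
  have hcomp := (hw.hasFDerivWithinAt (q := (t, x + s * e.1, y + s * e.2)) ⟨ht, mem_univ _⟩)
    |>.comp_hasDerivWithinAt s hline.hasDerivWithinAt fun _ (_ : _ ∈ univ) =>
      (⟨ht, mem_univ _⟩ : _ ∈ Icc 0 T ×ˢ univ)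
  exact hasDerivWithinAt_univ.mp hcomp

theorem lift_shift (w : ℝ → Torus → ℝ) (t x y s : ℝ) (e : ℝ × ℝ) :
    w t (((x : Circle1), (y : Circle1)) + shift e s) = lift w (t, x + s * e.1, y + s * e.2) := by
  simp [lift, shift]

theorem lift_dirDeriv (hw : SmoothOn T w) {t : ℝ} (ht : t ∈ Icc 0 T) (e : ℝ × ℝ) (x y : ℝ) :
    lift (dirDeriv e w) (t, x, y) =
      fderivWithin ℝ (lift w) (Icc 0 T ×ˢ univ) (t, x, y) (0, e.1, e.2) := by
  have := (hw.hasDerivAt_lift ht e x y 0).deriv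
  simp only [zero_mul, add_zero] at this
  rw [← this, lift, dirDeriv]
  simp only [lift_shift]

theorem contDiffOn_fderivWithin_apply (hT : 0 < T) (hw : SmoothOn T w) (e : ℝ × ℝ × ℝ) :
    ContDiffOn ℝ ∞ (fun q => fderivWithin ℝ (lift w) (Icc 0 T ×ˢ univ) q e) (Icc 0 T ×ˢ univ) :=
  (ContDiffOn.fderivWithin hw (uniqueDiffOn_slab hT) (by simp)).clm_apply contDiffOn_const

theorem dirDeriv (hT : 0 < T) (hw : SmoothOn T w) (e : ℝ × ℝ) : SmoothOn T (dirDeriv e w) := by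
  refine (hw.contDiffOn_fderivWithin_apply hT (0, e.1, e.2)).congr ?_
  rintro ⟨t, x, y⟩ ⟨ht, -⟩
  exact hw.lift_dirDeriv ht e x y

theorem hasDerivWithinAt_time (hw : SmoothOn T w) {t : ℝ} (ht : t ∈ Icc 0 T) (x y : ℝ) :
    HasDerivWithinAt (fun τ => lift w (τ, x, y))
      (fderivWithin ℝ (lift w) (Icc 0 T ×ˢ univ) (t, x, y) (1, 0, 0)) (Icc 0 T) t := by
  have hline : HasDerivWithinAt (fun τ : ℝ => (τ, x, y)) (1, 0, 0) (Icc 0 T) t :=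
    (hasDerivWithinAt_id t _).prodMk ((hasDerivWithinAt_const _ _ x).prodMk
      (hasDerivWithinAt_const _ _ y))
  exact (hw.hasFDerivWithinAt (q := (t, x, y)) ⟨ht, mem_univ _⟩).comp_hasDerivWithinAt t hline
    fun _ hτ => (⟨hτ, mem_univ _⟩ : _ ∈ Icc 0 T ×ˢ univ)

theorem lift_timeDeriv (hT : 0 < T) (hw : SmoothOn T w) {t : ℝ} (ht : t ∈ Icc 0 T) (x y : ℝ) :
    lift (timeDeriv T w) (t, x, y) =
      fderivWithin ℝ (lift w) (Icc 0 T ×ˢ univ) (t, x, y) (1, 0, 0) :=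
  (hw.hasDerivWithinAt_time ht x y).derivWithin (uniqueDiffOn_Icc hT t ht)

theorem timeDeriv (hT : 0 < T) (hw : SmoothOn T w) : SmoothOn T (timeDeriv T w) := by
  refine (hw.contDiffOn_fderivWithin_apply hT (1, 0, 0)).congr ?_
  rintro ⟨t, x, y⟩ ⟨ht, -⟩
  exact hw.lift_timeDeriv hT ht x y

theorem hasDerivWithinAt_timeDeriv (hT : 0 < T) (hw : SmoothOn T w) {t : ℝ} (ht : t ∈ Icc 0 T)
    (p : Torus) :
    HasDerivWithinAt (fun τ => w τ p) (ZK.timeDeriv T w t p) (Icc 0 T) t := by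
  obtain ⟨x, -, y, -, rfl⟩ := exists_coe_eq p
  exact (hw.hasDerivWithinAt_time ht x y).congr_deriv (hw.lift_timeDeriv hT ht x y).symm

theorem exists_abs_le (hw : SmoothOn T w) : ∃ B : ℝ, 0 ≤ B ∧ ∀ t ∈ Icc 0 T, ∀ p, |w t p| ≤ B := by
  have hc : IsCompact (Icc (0 : ℝ) T ×ˢ (Icc 0 (2 * Real.pi) ×ˢ Icc 0 (2 * Real.pi))) :=
    isCompact_Icc.prod (isCompact_Icc.prod isCompact_Icc)
  obtain ⟨B, hB⟩ := hc.exists_bound_of_continuousOn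
    (hw.continuousOn.mono (prod_mono le_rfl (subset_univ _)))
  refine ⟨max B 0, le_max_right _ _, fun t ht p => ?_⟩
  obtain ⟨x, hx, y, hy, rfl⟩ := exists_coe_eq p
  exact (hB (t, x, y) ⟨ht, hx, hy⟩).trans (le_max_left _ _)

theorem continuous (hw : SmoothOn T w) {t : ℝ} (ht : t ∈ Icc 0 T) : Continuous (w t) := by
  have hq : IsOpenQuotientMap (Prod.map ((↑) : ℝ → Circle1) ((↑) : ℝ → Circle1)) :=
    QuotientAddGroup.isOpenQuotientMap_mk.prodMap QuotientAddGroup.isOpenQuotientMap_mk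
  rw [← hq.continuous_comp_iff]
  exact ContinuousOn.comp_continuous (f := fun z : ℝ × ℝ => (t, z)) hw.continuousOn
    (by fun_prop) fun _ => ⟨ht, mem_univ _⟩

theorem mul (hw : SmoothOn T w) (hw' : SmoothOn T w') : SmoothOn T (w * w') :=
  ContDiffOn.mul hw hw'

theorem hasDerivAt_shift (hw : SmoothOn T w) {t : ℝ} (ht : t ∈ Icc 0 T) (e : ℝ × ℝ) (p : Torus)
    (s : ℝ) : HasDerivAt (fun s => w t (p + shift e s)) (ZK.dirDeriv e w t (p + shift e s)) s := by
  obtain ⟨x, -, y, -, rfl⟩ := exists_coe_eq p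
  simp only [lift_shift]
  rw [hw.lift_dirDeriv ht]
  exact hw.hasDerivAt_lift ht e x y s

end SmoothOn

theorem norm_fourier_apply (n : ℤ) (x : Circle1) : ‖fourier n x‖ = 1 := by
  rw [fourier_apply]
  exact Circle.norm_coe _

theorem norm_character (k : ℤ × ℤ) (p : Torus) : ‖character k p‖ = 1 := by
  rw [character, ContinuousMap.coe_mk, norm_mul, norm_fourier_apply, norm_fourier_apply, one_mul]

theorem norm_conj_character_mul (k : ℤ × ℤ) (p : Torus) (x : ℝ) :
    ‖starRingEnd ℂ (character k p) * (x : ℂ)‖ = |x| := by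
  rw [norm_mul, RCLike.norm_conj, norm_character, one_mul, Complex.norm_real, Real.norm_eq_abs]

theorem fourier_add_apply (n : ℤ) (x y : Circle1) :
    fourier n (x + y) = fourier n x * fourier n y := by
  simp only [fourier_apply, smul_add, AddCircle.toCircle_add, Circle.coe_mul]

theorem character_add_apply (k : ℤ × ℤ) (p q : Torus) :
    character k (p + q) = character k p * character k q := by
  simp only [character, ContinuousMap.coe_mk, Prod.fst_add, Prod.snd_add, fourier_add_apply]
  ring

theorem character_add (k l : ℤ × ℤ) (p : Torus) :
    character (k + l) p = character k p * character l p := by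
  simp only [character, ContinuousMap.coe_mk, Prod.fst_add, Prod.snd_add, fourier_add]
  ring

theorem character_neg (k : ℤ × ℤ) (p : Torus) :
    character (-k) p = starRingEnd ℂ (character k p) := by
  simp only [character, ContinuousMap.coe_mk, Prod.fst_neg, Prod.snd_neg, fourier_neg, map_mul]

theorem fourier_coe_eq_exp (n : ℤ) (x : ℝ) :
    fourier n (x : Circle1) = Complex.exp (Complex.I * n * x) := by
  rw [fourier_coe_apply]
  congr 1
  push_cast
  field_simp

theorem character_shift (k : ℤ × ℤ) (e : ℝ × ℝ) (s : ℝ) :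
    character k (shift e s) = Complex.exp (s * (Complex.I * (k.1 * e.1 + k.2 * e.2))) := by
  simp only [character, ContinuousMap.coe_mk, shift, fourier_coe_eq_exp, ← Complex.exp_add]
  congr 1
  push_cast
  ring

theorem coeff_neg_freq (f : Torus → ℝ) (k : ℤ × ℤ) :
    coeff f (-k) = starRingEnd ℂ (coeff f k) := by
  rw [coeff, coeff, ← integral_conj]
  simp [character_neg]

theorem norm_coeff_le {f : Torus → ℝ} {B : ℝ} (hf : ∀ p, |f p| ≤ B) (k : ℤ × ℤ) :
    ‖coeff f k‖ ≤ B := by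
  have h := norm_integral_le_of_norm_le_const (μ := torusMeasure) <|
    .of_forall fun p => (norm_conj_character_mul k p (f p)).trans_le (hf p)
  simpa [coeff] using h

theorem integrable_conj_character_mul {f : Torus → ℝ} (hf : Continuous f) (k : ℤ × ℤ) :
    Integrable (fun p => starRingEnd ℂ (character k p) * (f p : ℂ)) torusMeasure :=
  Continuous.integrable_of_hasCompactSupport (by fun_prop) (.of_compactSpace _)

theorem coeff_sub {f g : Torus → ℝ} (hf : Continuous f) (hg : Continuous g) (k : ℤ × ℤ) :
    coeff (f - g) k = coeff f k - coeff g k := by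
  rw [coeff, coeff, coeff, ← integral_sub (integrable_conj_character_mul hf k)
    (integrable_conj_character_mul hg k)]
  simp only [Pi.sub_apply, Complex.ofReal_sub, mul_sub]

theorem coeff_add {f g : Torus → ℝ} (hf : Continuous f) (hg : Continuous g) (k : ℤ × ℤ) :
    coeff (f + g) k = coeff f k + coeff g k := by
  rw [coeff, coeff, coeff, ← integral_add (integrable_conj_character_mul hf k)
    (integrable_conj_character_mul hg k)]
  simp only [Pi.add_apply, Complex.ofReal_add, mul_add]

theorem coeff_const_mul (a : ℝ) (f : Torus → ℝ) (k : ℤ × ℤ) :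
    coeff (fun p => a * f p) k = a * coeff f k := by
  rw [coeff, coeff, ← integral_const_mul]
  simp only [Complex.ofReal_mul, mul_left_comm]

theorem coeff_comp_add (f : Torus → ℝ) (h : Torus) (k : ℤ × ℤ) :
    coeff (fun p => f (p + h)) k = character k h * coeff f k := by
  have hunit : character k h * starRingEnd ℂ (character k h) = 1 := by
    rw [Complex.mul_conj', norm_character]; norm_num
  rw [coeff, coeff, ← integral_const_mul, ← integral_add_right_eq_self
    (fun p => character k h * (starRingEnd ℂ (character k p) * (f p : ℂ))) h]
  congr 1
  ext p
  rw [character_add_apply, map_mul]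
  linear_combination (-(starRingEnd ℂ (character k p)) * (f (p + h) : ℂ)) * hunit

theorem hasDerivAt_coeff {F F' : ℝ → Torus → ℝ} {S : Set ℝ} {t B : ℝ} (hS : S ∈ nhds t)
    (hF : ∀ τ ∈ S, Continuous (F τ)) (hF' : Continuous (F' t)) (hB : ∀ τ ∈ S, ∀ p, |F' τ p| ≤ B)
    (hderiv : ∀ τ ∈ S, ∀ p, HasDerivAt (fun τ => F τ p) (F' τ p) τ) (k : ℤ × ℤ) :
    HasDerivAt (fun τ => coeff (F τ) k) (coeff (F' t) k) t :=
  (hasDerivAt_integral_of_dominated_loc_of_deriv_le (𝕜 := ℝ) (bound := fun _ => B) hS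
    (Filter.eventually_of_mem hS fun τ hτ =>
      (integrable_conj_character_mul (hF τ hτ) k).aestronglyMeasurable)
    (integrable_conj_character_mul (hF t (mem_of_mem_nhds hS)) k)
    (integrable_conj_character_mul hF' k).aestronglyMeasurable
    (.of_forall fun p τ hτ => (norm_conj_character_mul k p _).trans_le (hB τ hτ p))
    (integrable_const B)
    (.of_forall fun p τ hτ => (hderiv τ hτ p).ofReal_comp.const_mul _)).2

namespace SmoothOn

variable {T t : ℝ} {w : ℝ → Torus → ℝ}

theorem coeff_dirDeriv (hT : 0 < T) (hw : SmoothOn T w) (ht : t ∈ Icc 0 T) (e : ℝ × ℝ)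
    (k : ℤ × ℤ) :
    coeff (ZK.dirDeriv e w t) k = Complex.I * (k.1 * e.1 + k.2 * e.2) * coeff (w t) k := by
  set c : ℂ := Complex.I * (k.1 * e.1 + k.2 * e.2)
  obtain ⟨B, -, hB⟩ := (hw.dirDeriv hT e).exists_abs_le
  have hshift : shift e 0 = 0 := by simp [shift]
  have hderiv : HasDerivAt (fun s : ℝ => coeff (fun p => w t (p + shift e s)) k)
      (coeff (fun p => ZK.dirDeriv e w t (p + shift e 0)) k) 0 :=
    hasDerivAt_coeff (F' := fun s p => ZK.dirDeriv e w t (p + shift e s)) Filter.univ_mem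
      (fun s _ => (hw.continuous ht).comp (continuous_add_const _))
      (((hw.dirDeriv hT e).continuous ht).comp (continuous_add_const _))
      (fun s _ p => hB t ht _) (fun s _ p => hw.hasDerivAt_shift ht e p s) k
  have hexp :
      HasDerivAt (fun s : ℝ => Complex.exp (s * c) * coeff (w t) k) (c * coeff (w t) k) 0 := by
    have hlin : HasDerivAt (fun s : ℝ => (s : ℂ) * c) c 0 := by
      simpa using (Complex.ofRealCLM.hasDerivAt (x := (0 : ℝ))).mul_const c
    simpa using hlin.cexp.mul_const (coeff (w t) k)
  simp only [coeff_comp_add (w t), character_shift, hshift, add_zero] at hderiv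
  exact hderiv.unique hexp

theorem coeff_dirDeriv_dirDeriv (hT : 0 < T) (hw : SmoothOn T w) (ht : t ∈ Icc 0 T) (e : ℝ × ℝ)
    (k : ℤ × ℤ) :
    coeff (ZK.dirDeriv e (ZK.dirDeriv e w) t) k =
      -(k.1 * e.1 + k.2 * e.2) ^ 2 * coeff (w t) k := by
  rw [(hw.dirDeriv hT e).coeff_dirDeriv hT ht, hw.coeff_dirDeriv hT ht]
  linear_combination (k.1 * e.1 + k.2 * e.2 : ℂ) ^ 2 * coeff (w t) k * Complex.I_sq

theorem continuousOn_coeff (hw : SmoothOn T w) (k : ℤ × ℤ) :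
    ContinuousOn (fun t => coeff (w t) k) (Icc 0 T) := by
  obtain ⟨B, -, hB⟩ := hw.exists_abs_le
  refine continuousOn_of_dominated (bound := fun _ => B)
    (fun t ht => (integrable_conj_character_mul (hw.continuous ht) k).aestronglyMeasurable)
    (fun t ht => .of_forall fun p => (norm_conj_character_mul k p _).trans_le (hB t ht p))
    (integrable_const _) (.of_forall fun p => ?_)
  obtain ⟨x, -, y, -, rfl⟩ := exists_coe_eq p
  have hlift : ContinuousOn (fun t : ℝ => lift w (t, x, y)) (Icc 0 T) :=
    hw.continuousOn.comp (by fun_prop) fun t ht => ⟨ht, mem_univ _⟩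
  exact continuousOn_const.mul (Complex.continuous_ofReal.comp_continuousOn hlift)

theorem hasDerivAt_coeff (hT : 0 < T) (hw : SmoothOn T w) (ht : t ∈ Ioo 0 T) (k : ℤ × ℤ) :
    HasDerivAt (fun t => coeff (w t) k) (coeff (ZK.timeDeriv T w t) k) t := by
  obtain ⟨B, -, hB⟩ := (hw.timeDeriv hT).exists_abs_le
  exact ZK.hasDerivAt_coeff (Ioo_mem_nhds ht.1 ht.2)
    (fun τ hτ => hw.continuous (Ioo_subset_Icc_self hτ))
    ((hw.timeDeriv hT).continuous (Ioo_subset_Icc_self ht))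
    (fun τ hτ => hB τ (Ioo_subset_Icc_self hτ))
    (fun τ hτ p => (hw.hasDerivWithinAt_timeDeriv hT (Ioo_subset_Icc_self hτ) p).hasDerivAt
      (Icc_mem_nhds hτ.1 hτ.2)) k

theorem exists_mul_norm_coeff_le (hT : 0 < T) (hw : SmoothOn T w) :
    ∃ B : ℝ, 0 ≤ B ∧ ∀ t ∈ Icc 0 T, ∀ k : ℤ × ℤ,
      (1 + (k.1 : ℝ) ^ 2) * (1 + (k.2 : ℝ) ^ 2) * ‖coeff (w t) k‖ ≤ B := by
  have hxx := (hw.dirDeriv hT (1, 0)).dirDeriv hT (1, 0)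
  have hyy := (hw.dirDeriv hT (0, 1)).dirDeriv hT (0, 1)
  have hxxyy := (hyy.dirDeriv hT (1, 0)).dirDeriv hT (1, 0)
  obtain ⟨B₀, hB₀, h₀⟩ := hw.exists_abs_le
  obtain ⟨B₁, hB₁, h₁⟩ := hxx.exists_abs_le
  obtain ⟨B₂, hB₂, h₂⟩ := hyy.exists_abs_le
  obtain ⟨B₃, hB₃, h₃⟩ := hxxyy.exists_abs_le
  refine ⟨B₀ + B₁ + B₂ + B₃, by positivity, fun t ht k => ?_⟩
  have c₀ := norm_coeff_le (h₀ t ht) k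
  have c₁ := norm_coeff_le (h₁ t ht) k
  have c₂ := norm_coeff_le (h₂ t ht) k
  have c₃ := norm_coeff_le (h₃ t ht) k
  rw [hw.coeff_dirDeriv_dirDeriv hT ht] at c₁ c₂
  rw [hyy.coeff_dirDeriv_dirDeriv hT ht, hw.coeff_dirDeriv_dirDeriv hT ht] at c₃
  simp only [norm_mul, norm_neg, norm_pow, Complex.ofReal_one, Complex.ofReal_zero, mul_one,
    mul_zero, add_zero, zero_add, Complex.norm_intCast, sq_abs] at c₁ c₂ c₃
  linarith

theorem exists_summable_coeff_bound (hT : 0 < T) (hw : SmoothOn T w) :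
    ∃ b : ℤ × ℤ → ℝ, Summable b ∧ (∀ k, 0 ≤ b k) ∧ ∀ t ∈ Icc 0 T, ∀ k, ‖coeff (w t) k‖ ≤ b k := by
  obtain ⟨B, hB, hle⟩ := hw.exists_mul_norm_coeff_le hT
  have hsum : Summable fun k : ℤ × ℤ => B / (1 + (k.1 : ℝ) ^ 2) * (1 / (1 + (k.2 : ℝ) ^ 2)) :=
    (summable_div_one_add_sq B).mul_of_nonneg (summable_div_one_add_sq 1)
      (fun n => by positivity) (fun n => by positivity)
  refine ⟨_, hsum, fun k => by positivity, fun t ht k => ?_⟩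
  rw [div_mul_div_comm, mul_one, le_div_iff₀ (by positivity), mul_comm]
  exact hle t ht k

theorem summable_coeff (hT : 0 < T) (hw : SmoothOn T w) (ht : t ∈ Icc 0 T) :
    Summable (coeff (w t)) := by
  obtain ⟨b, hb, -, h⟩ := hw.exists_summable_coeff_bound hT
  exact .of_norm_bounded hb fun k => h t ht k

end SmoothOn

/-- The `m`-th Fourier coefficient in the first variable, as a function of the second. -/
def fiberCoeff (f : Torus → ℝ) (m : ℤ) (y : Circle1) : ℂ :=
  fourierCoeff (fun x => (f (x, y) : ℂ)) m

theorem continuous_fiberCoeff {f : Torus → ℝ} (hf : Continuous f) (m : ℤ) :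
    Continuous (fiberCoeff f m) := by
  have h := continuous_parametric_integral_of_continuous (μ := AddCircle.haarAddCircle)
    (f := fun (y x : Circle1) => fourier (-m) x • (f (x, y) : ℂ))
    (by unfold Function.uncurry; fun_prop) isCompact_univ
  simp only [Measure.restrict_univ] at h
  exact h

theorem fourierCoeff_fiberCoeff {f : Torus → ℝ} (hf : Continuous f) (m n : ℤ) :
    fourierCoeff (fiberCoeff f m) n = coeff f (m, n) := by
  rw [coeff, integral_prod_symm _ (integrable_conj_character_mul hf _)]
  simp only [fiberCoeff, fourierCoeff, ← integral_smul]
  congr! 4 with y x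
  simp only [character, ContinuousMap.coe_mk, map_mul, fourier_neg, smul_eq_mul]
  ring

theorem hasSum_fiberCoeff {f : Torus → ℝ} (hf : Continuous f) (hs : Summable (coeff f)) (m : ℤ)
    (y : Circle1) : HasSum (fun n => coeff f (m, n) * fourier n y) (fiberCoeff f m y) := by
  let g : C(Circle1, ℂ) := ⟨fiberCoeff f m, continuous_fiberCoeff hf m⟩
  have hcoeff : fourierCoeff g = fun n => coeff f (m, n) := funext (fourierCoeff_fiberCoeff hf m)
  have h := has_pointwise_sum_fourier_series_of_summable (f := g)
    (hcoeff ▸ hs.prod_factor m) y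
  simp only [hcoeff, smul_eq_mul] at h
  exact h

theorem summable_fiberCoeff {f : Torus → ℝ} (hf : Continuous f) (hs : Summable (coeff f))
    (y : Circle1) : Summable fun m => fiberCoeff f m y := by
  refine .of_norm_bounded hs.norm.prod fun m => ?_
  have hnorm : Summable fun n => ‖coeff f (m, n) * fourier n y‖ := by
    simpa only [norm_mul, norm_fourier_apply, mul_one] using hs.norm.prod_factor m
  rw [← (hasSum_fiberCoeff hf hs m y).tsum_eq]
  exact (norm_tsum_le_tsum_norm hnorm).trans_eq
    (by simp only [norm_mul, norm_fourier_apply, mul_one])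

theorem hasSum_coeff {f : Torus → ℝ} (hf : Continuous f) (hs : Summable (coeff f)) (p : Torus) :
    HasSum (fun k => coeff f k * character k p) (f p : ℂ) := by
  obtain ⟨x, y⟩ := p
  have hfiber : HasSum (fun m => fiberCoeff f m y * fourier m x) (f (x, y) : ℂ) :=
    has_pointwise_sum_fourier_series_of_summable (f := ⟨fun x => (f (x, y) : ℂ), by fun_prop⟩)
      (summable_fiberCoeff hf hs y) x
  have hsum : Summable fun k => coeff f k * character k (x, y) :=
    .of_norm (by simpa only [norm_mul, norm_character, mul_one] using hs.norm)
  have hprod := hsum.hasSum.prod_fiberwise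
    (g := fun m => fiberCoeff f m y * fourier m x) fun m => by
    refine ((hasSum_fiberCoeff hf hs m y).mul_right (fourier m x)).congr_fun fun n => ?_
    simp only [character, ContinuousMap.coe_mk]
    ring
  exact hprod.unique hfiber ▸ hsum.hasSum

theorem coeff_mul {f g : Torus → ℝ} (hf : Continuous f) (hg : Continuous g)
    (hs : Summable (coeff f)) (k : ℤ × ℤ) :
    coeff (f * g) k = ∑' l, coeff f l * coeff g (k - l) := by
  set F : ℤ × ℤ → Torus → ℂ := fun l p =>
    coeff f l * (starRingEnd ℂ (character (k - l) p) * (g p : ℂ))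
  obtain ⟨B, hB⟩ := isCompact_univ.exists_bound_of_continuousOn hg.continuousOn
  have hint (l : ℤ × ℤ) : Integrable (F l) torusMeasure :=
    (integrable_conj_character_mul hg _).const_mul _
  have hnorm (l : ℤ × ℤ) : ∫ p, ‖F l p‖ ∂torusMeasure ≤ ‖coeff f l‖ * B := by
    have h := integral_mono (hint l).norm (integrable_const (‖coeff f l‖ * B)) fun p => by
      simp only [F, norm_mul (coeff f l), norm_conj_character_mul]
      gcongr
      exact hB p (mem_univ _)
    simpa using h
  have hsum : Summable fun l => ∫ p, ‖F l p‖ ∂torusMeasure :=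
    .of_nonneg_of_le (fun l => integral_nonneg fun p => norm_nonneg _) hnorm (hs.norm.mul_right B)
  have hF (p : Torus) : ∑' l, F l p = starRingEnd ℂ (character k p) * ((f * g) p : ℂ) := by
    rw [Pi.mul_apply, Complex.ofReal_mul, mul_left_comm,
      ← ((hasSum_coeff hf hs p).mul_right _).tsum_eq]
    refine tsum_congr fun l => ?_
    simp only [F]
    rw [← character_neg, ← character_neg, neg_sub, sub_eq_add_neg, character_add]
    ring
  have h := (hasSum_integral_of_summable_integral_norm hint hsum).tsum_eq
  simp only [hF, F, integral_const_mul] at h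
  exact h.symm

theorem deriv_fst_eq_dirDeriv (w : ℝ → Torus → ℝ) (t x : ℝ) (y : Circle1) :
    deriv (fun x' : ℝ => w t ((x' : Circle1), y)) x = dirDeriv (1, 0) w t ((x : Circle1), y) := by
  have h := deriv_comp_const_add (fun x' : ℝ => w t ((x' : Circle1), y)) x 0
  rw [add_zero] at h
  rw [← h, dirDeriv]
  simp [shift]

theorem deriv_snd_eq_dirDeriv (w : ℝ → Torus → ℝ) (t y : ℝ) (x : Circle1) :
    deriv (fun y' : ℝ => w t (x, (y' : Circle1))) y = dirDeriv (0, 1) w t (x, (y : Circle1)) := by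
  have h := deriv_comp_const_add (fun y' : ℝ => w t (x, (y' : Circle1))) y 0
  rw [add_zero] at h
  rw [← h, dirDeriv]
  simp [shift]

theorem SmoothOn.coeff_mul_dirDeriv {T : ℝ} (hT : 0 < T) {w : ℝ → Torus → ℝ} (hw : SmoothOn T w)
    {t : ℝ} (ht : t ∈ Icc 0 T) (k : ℤ × ℤ) :
    coeff (fun p => w t p * ZK.dirDeriv (1, 0) w t p) k =
      Complex.I * k.1 / 2 * ∑' l, coeff (w t) l * coeff (w t) (k - l) := by
  have hsq (p : Torus) :
      w t p * ZK.dirDeriv (1, 0) w t p = (1 / 2 : ℝ) * ZK.dirDeriv (1, 0) (w * w) t p := by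
    have h := hw.hasDerivAt_shift ht (1, 0) p 0
    have hmul : ZK.dirDeriv (1, 0) (w * w) t p = _ := (h.mul h).deriv
    rw [show shift (1, 0) 0 = 0 by simp [shift], add_zero] at hmul
    rw [hmul]
    ring
  simp only [hsq]
  rw [coeff_const_mul, (hw.mul hw).coeff_dirDeriv hT ht, Pi.mul_apply,
    coeff_mul (hw.continuous ht) (hw.continuous ht) (hw.summable_coeff hT ht)]
  push_cast
  ring

namespace IsSmoothSolution

variable {T t : ℝ} {u : ℝ → Torus → ℝ}

theorem smoothOn (hu : IsSmoothSolution T u) : SmoothOn T u := hu.smooth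

theorem timeDeriv_eq (hu : IsSmoothSolution T u) (ht : t ∈ Icc 0 T) (p : Torus) :
    timeDeriv T u t p = u t p * dirDeriv (1, 0) u t p
      - dirDeriv (1, 0) (dirDeriv (1, 0) (dirDeriv (1, 0) u)) t p
      - 3 * dirDeriv (1, 0) (dirDeriv (0, 1) (dirDeriv (0, 1) u)) t p := by
  obtain ⟨x, -, y, -, rfl⟩ := exists_coe_eq p
  have hfst (w : ℝ → Torus → ℝ) (y : Circle1) : deriv (fun x' : ℝ => w t ((x' : Circle1), y)) =
      fun x : ℝ => dirDeriv (1, 0) w t ((x : Circle1), y) :=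
    funext fun x => deriv_fst_eq_dirDeriv w t x y
  have hsnd (w : ℝ → Torus → ℝ) (x : Circle1) : deriv (fun y' : ℝ => w t (x, (y' : Circle1))) =
      fun y : ℝ => dirDeriv (0, 1) w t (x, (y : Circle1)) :=
    funext fun y => deriv_snd_eq_dirDeriv w t y x
  have h := hu.equation t ht x y
  simp only [iteratedDeriv_succ', iteratedDeriv_zero, hfst, hsnd] at h
  rw [timeDeriv]
  linarith

theorem hasDerivAt_coeff (hT : 0 < T) (hu : IsSmoothSolution T u) (ht : t ∈ Ioo 0 T)
    (k : ℤ × ℤ) :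
    HasDerivAt (fun t => coeff (u t) k) (Complex.I * phase k * coeff (u t) k +
      Complex.I * k.1 / 2 * ∑' l, coeff (u t) l * coeff (u t) (k - l)) t := by
  have htI := Ioo_subset_Icc_self ht
  have hw := hu.smoothOn
  have hx := hw.dirDeriv hT (1, 0)
  have hxx := hx.dirDeriv hT (1, 0)
  have hyy := (hw.dirDeriv hT (0, 1)).dirDeriv hT (0, 1)
  have hxxx := (hxx.dirDeriv hT (1, 0)).continuous htI
  have hxyy : Continuous fun p => 3 * dirDeriv (1, 0) (dirDeriv (0, 1) (dirDeriv (0, 1) u)) t p :=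
    continuous_const.mul ((hyy.dirDeriv hT (1, 0)).continuous htI)
  have huux : Continuous fun p => u t p * dirDeriv (1, 0) u t p :=
    (hw.continuous htI).mul (hx.continuous htI)
  have heq : timeDeriv T u t = ((fun p => u t p * dirDeriv (1, 0) u t p)
      - dirDeriv (1, 0) (dirDeriv (1, 0) (dirDeriv (1, 0) u)) t)
      - fun p => 3 * dirDeriv (1, 0) (dirDeriv (0, 1) (dirDeriv (0, 1) u)) t p :=
    funext fun p => hu.timeDeriv_eq htI p
  refine (hw.hasDerivAt_coeff hT ht k).congr_deriv ?_
  rw [heq, coeff_sub (huux.sub hxxx) hxyy, coeff_sub huux hxxx,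
    coeff_const_mul, hw.coeff_mul_dirDeriv hT htI, hxx.coeff_dirDeriv hT htI,
    hw.coeff_dirDeriv_dirDeriv hT htI, hyy.coeff_dirDeriv hT htI,
    hw.coeff_dirDeriv_dirDeriv hT htI, phase]
  push_cast
  ring

end IsSmoothSolution

/-! ### Dyadic annuli and Lipschitz weights -/

theorem exists_mem_annulus (k : ℤ × ℤ) : ∃ j, k ∈ annulus j := by
  classical
  have hex : ∃ j : ℕ, k.1 ^ 2 + k.2 ^ 2 < ((2 : ℤ) ^ (j + 1)) ^ 2 := by
    obtain ⟨m, hm⟩ := Int.eq_ofNat_of_zero_le (by positivity : 0 ≤ k.1 ^ 2 + k.2 ^ 2)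
    have hlt : (m : ℤ) < 2 ^ (m + 1) := by
      exact_mod_cast Nat.lt_two_pow_self.trans_le (Nat.pow_le_pow_right two_pos m.le_succ)
    exact ⟨m, by rw [hm]; nlinarith⟩
  refine ⟨Nat.find hex, (mem_annulus _ _).mpr ⟨?_, Nat.find_spec hex⟩⟩
  rcases Nat.eq_zero_or_pos (Nat.find hex) with hzero | hpos
  · exact Or.inl hzero
  · have hmin := Nat.find_min hex (m := Nat.find hex - 1) (by lia)
    rw [Nat.sub_add_cancel hpos] at hmin
    exact Or.inr (not_lt.mp hmin)

theorem annulus_unique {k : ℤ × ℤ} {i j : ℕ} (hi : k ∈ annulus i) (hj : k ∈ annulus j) :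
    i = j := by
  have le_of_mem : ∀ {i j : ℕ}, k ∈ annulus i → k ∈ annulus j → i ≤ j := by
    intro i j hi hj
    by_contra! hlt
    have hlower := ((mem_annulus _ _).mp hi).1.resolve_left (by lia)
    have hupper := ((mem_annulus _ _).mp hj).2
    have hpow : ((2 : ℤ) ^ (j + 1)) ^ 2 ≤ (2 ^ i) ^ 2 := by
      gcongr
      · norm_num
      · exact hlt
    linarith
  exact le_antisymm (le_of_mem hi hj) (le_of_mem hj hi)

/-- The dyadic index of a frequency: `k` lies in the annulus of `2 ^ idx k`. -/
def idx (k : ℤ × ℤ) : ℕ := (exists_mem_annulus k).choose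

theorem mem_annulus_idx (k : ℤ × ℤ) : k ∈ annulus (idx k) := (exists_mem_annulus k).choose_spec

theorem mem_annulus_iff_idx {k : ℤ × ℤ} {j : ℕ} : k ∈ annulus j ↔ idx k = j :=
  ⟨fun h => annulus_unique (mem_annulus_idx k) h, fun h => h ▸ mem_annulus_idx k⟩

/-- The Euclidean length of a frequency, taken in `ℂ` since `ℤ × ℤ` carries the sup norm. -/
def len (k : ℤ × ℤ) : ℝ := ‖(⟨k.1, k.2⟩ : ℂ)‖

theorem len_sq (k : ℤ × ℤ) : len k ^ 2 = (k.1 : ℝ) ^ 2 + (k.2 : ℝ) ^ 2 := by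
  rw [len, Complex.sq_norm, Complex.normSq_mk]
  ring

theorem len_nonneg (k : ℤ × ℤ) : 0 ≤ len k := norm_nonneg _

theorem len_neg (k : ℤ × ℤ) : len (-k) = len k := by
  rw [len, len, ← norm_neg]
  congr 1
  apply Complex.ext <;> simp

theorem abs_fst_le_len (k : ℤ × ℤ) : |(k.1 : ℝ)| ≤ len k :=
  Complex.abs_re_le_norm (⟨k.1, k.2⟩ : ℂ)

theorem abs_snd_le_len (k : ℤ × ℤ) : |(k.2 : ℝ)| ≤ len k :=
  Complex.abs_im_le_norm (⟨k.1, k.2⟩ : ℂ)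

theorem len_add_le (k l : ℤ × ℤ) : len (k + l) ≤ len k + len l := by
  refine (le_of_eq ?_).trans (norm_add_le (⟨k.1, k.2⟩ : ℂ) (⟨l.1, l.2⟩ : ℂ))
  rw [len]
  congr 1
  apply Complex.ext <;> simp

theorem abs_len_sub_len_le (k l : ℤ × ℤ) : |len k - len l| ≤ len (k - l) := by
  refine (abs_norm_sub_norm_le (⟨k.1, k.2⟩ : ℂ) (⟨l.1, l.2⟩ : ℂ)).trans (le_of_eq ?_)
  rw [len]
  congr 1
  apply Complex.ext <;> simp

theorem len_lt_of_mem_annulus {k : ℤ × ℤ} {j : ℕ} (hk : k ∈ annulus j) : len k < 2 * 2 ^ j := by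
  have hsq : (k.1 : ℝ) ^ 2 + (k.2 : ℝ) ^ 2 < ((2 : ℝ) ^ (j + 1)) ^ 2 := by
    exact_mod_cast ((mem_annulus _ _).mp hk).2
  rw [← len_sq, pow_succ' (2 : ℝ) j] at hsq
  exact lt_of_pow_lt_pow_left₀ 2 (by positivity) hsq

theorem le_len_of_mem_annulus {k : ℤ × ℤ} {j : ℕ} (hk : k ∈ annulus j) (hj : j ≠ 0) :
    2 ^ j ≤ len k := by
  have hsq : ((2 : ℝ) ^ j) ^ 2 ≤ (k.1 : ℝ) ^ 2 + (k.2 : ℝ) ^ 2 := by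
    exact_mod_cast ((mem_annulus _ _).mp hk).1.resolve_left hj
  rw [← len_sq] at hsq
  exact (pow_le_pow_iff_left₀ (by positivity) (len_nonneg k) two_ne_zero).mp hsq

/-- A weight that equals `1` on the annulus of `2 ^ n` and vanishes unless
`2 ^ n / 2 < |k| < 3 * 2 ^ n`; for `n = 0` there is no lower cutoff. Being Lipschitz at scale
`2 ^ n`, it can replace the sharp projection in the energy estimate. -/
def wt (n : ℕ) (k : ℤ × ℤ) : ℝ :=
  max 0 (min 1 (min (if n = 0 then 1 else 2 * (len k / 2 ^ n) - 1) (3 - len k / 2 ^ n)))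

theorem wt_nonneg (n : ℕ) (k : ℤ × ℤ) : 0 ≤ wt n k := le_max_left _ _

theorem wt_le_one (n : ℕ) (k : ℤ × ℤ) : wt n k ≤ 1 := max_le zero_le_one (min_le_left _ _)

theorem wt_neg (n : ℕ) (k : ℤ × ℤ) : wt n (-k) = wt n k := by rw [wt, wt, len_neg]

theorem wt_eq_one {n : ℕ} {k : ℤ × ℤ} (hk : k ∈ annulus n) : wt n k = 1 := by
  have hpow : (0 : ℝ) < 2 ^ n := by positivity
  have hupper : len k / 2 ^ n ≤ 2 := by
    rw [div_le_iff₀ hpow]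
    exact (len_lt_of_mem_annulus hk).le
  have hlower : (1 : ℝ) ≤ if n = 0 then 1 else 2 * (len k / 2 ^ n) - 1 := by
    split_ifs with hn
    · exact le_rfl
    · have : 1 ≤ len k / 2 ^ n := (one_le_div hpow).mpr (le_len_of_mem_annulus hk hn)
      linarith
  rw [wt, min_eq_left (le_min hlower (by linarith)), max_eq_right zero_le_one]

theorem abs_wt_sub_wt_le (n : ℕ) (k l : ℤ × ℤ) :
    |wt n k - wt n l| ≤ 2 / 2 ^ n * len (k - l) := by
  have hpow : (0 : ℝ) < 2 ^ n := by positivity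
  have hdiff : |len k / 2 ^ n - len l / 2 ^ n| ≤ 1 / 2 ^ n * len (k - l) := by
    rw [← sub_div, abs_div, abs_of_pos hpow, one_div_mul_eq_div]
    gcongr
    exact abs_len_sub_len_le k l
  have hnonneg : 0 ≤ 1 / 2 ^ n * len (k - l) := (abs_nonneg _).trans hdiff
  rw [show 2 / 2 ^ n * len (k - l) = 2 * (1 / 2 ^ n * len (k - l)) by ring]
  refine (abs_max_sub_max_le_max _ _ _ _).trans (max_le (by simpa using hnonneg) ?_)
  refine (abs_min_sub_min_le_max _ _ _ _).trans (max_le (by simpa using hnonneg) ?_)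
  refine (abs_min_sub_min_le_max _ _ _ _).trans (max_le ?_ ?_)
  · split_ifs
    · simpa using hnonneg
    · rw [show 2 * (len k / 2 ^ n) - 1 - (2 * (len l / 2 ^ n) - 1) =
        2 * (len k / 2 ^ n - len l / 2 ^ n) by ring, abs_mul, abs_two]
      gcongr
  · rw [show 3 - len k / 2 ^ n - (3 - len l / 2 ^ n) = -(len k / 2 ^ n - len l / 2 ^ n) by ring,
      abs_neg]
    linarith

theorem lt_len_and_len_lt_of_wt_ne_zero {n : ℕ} {k : ℤ × ℤ} (h : wt n k ≠ 0) :
    (n = 0 ∨ 2 ^ n < 2 * len k) ∧ len k < 3 * 2 ^ n := by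
  have hpow : (0 : ℝ) < 2 ^ n := by positivity
  have hpos : 0 < wt n k := (wt_nonneg n k).lt_of_ne' h
  rw [wt, lt_max_iff, lt_min_iff, lt_min_iff] at hpos
  obtain ⟨-, hlower, hupper⟩ := hpos.resolve_left (lt_irrefl _)
  constructor
  · split_ifs at hlower with hn
    · exact Or.inl hn
    · have : 1 < 2 * len k / 2 ^ n := by rw [mul_div_assoc]; linarith
      exact Or.inr ((one_lt_div hpow).mp this)
  · exact (div_lt_iff₀ hpow).mp (by linarith)

/-- Dyadic indices that differ by at most one. -/
def Near (i j : ℕ) : Prop := i ≤ j + 1 ∧ j ≤ i + 1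

theorem near_of_wt_ne_zero {n j : ℕ} {k : ℤ × ℤ} (hk : k ∈ annulus j) (h : wt n k ≠ 0) :
    Near n j := by
  obtain ⟨hlower, hupper⟩ := lt_len_and_len_lt_of_wt_ne_zero h
  constructor
  · rcases hlower with hn | hlower
    · lia
    · have hlen := len_lt_of_mem_annulus hk
      have hpow : (2 : ℝ) ^ n < 2 ^ (j + 2) := by rw [pow_add]; linarith
      have := (pow_lt_pow_iff_right₀ one_lt_two).mp hpow
      lia
  · rcases eq_or_ne j 0 with rfl | hj
    · lia
    · have hlen := le_len_of_mem_annulus hk hj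
      have hpow : (2 : ℝ) ^ j < 2 ^ (n + 2) := by
        have : (0 : ℝ) < 2 ^ n := by positivity
        rw [pow_add]; linarith
      have := (pow_lt_pow_iff_right₀ one_lt_two).mp hpow
      lia

/-- The symbol `wt n k * k₁` of `∂ₓ` localized to frequencies of size `2 ^ n`. -/
def sym (n : ℕ) (k : ℤ × ℤ) : ℝ := wt n k * k.1

theorem sym_neg (n : ℕ) (k : ℤ × ℤ) : sym n (-k) = -sym n k := by
  simp [sym, wt_neg]

theorem abs_sym_sub_sym_le_of_wt_ne_zero {n : ℕ} (k : ℤ × ℤ) {l : ℤ × ℤ} (hl : wt n l ≠ 0) :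
    |sym n k - sym n l| ≤ 7 * len (k - l) := by
  have hfst : |wt n k * ((k.1 : ℝ) - l.1)| ≤ 1 * len (k - l) := by
    rw [abs_mul, abs_of_nonneg (wt_nonneg n k)]
    gcongr
    · exact wt_le_one n k
    · simpa using abs_fst_le_len (k - l)
  have hwt : |(wt n k - wt n l) * l.1| ≤ 2 / 2 ^ n * len (k - l) * (3 * 2 ^ n) := by
    rw [abs_mul]
    gcongr
    · exact mul_nonneg (by positivity) (len_nonneg _)
    · exact abs_wt_sub_wt_le n k l
    · exact (abs_fst_le_len l).trans (lt_len_and_len_lt_of_wt_ne_zero hl).2.le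
  calc |sym n k - sym n l| = |wt n k * ((k.1 : ℝ) - l.1) + (wt n k - wt n l) * l.1| := by
        rw [sym, sym]
        ring_nf
    _ ≤ 1 * len (k - l) + 2 / 2 ^ n * len (k - l) * (3 * 2 ^ n) :=
        (abs_add_le _ _).trans (add_le_add hfst hwt)
    _ = 7 * len (k - l) := by
        field_simp
        ring

theorem abs_sym_sub_sym_le (n : ℕ) (k l : ℤ × ℤ) : |sym n k - sym n l| ≤ 7 * len (k - l) := by
  by_cases hl : wt n l = 0
  · by_cases hk : wt n k = 0
    · simp only [sym, hl, hk, zero_mul, sub_zero, abs_zero]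
      exact mul_nonneg (by norm_num) (len_nonneg _)
    · rw [abs_sub_comm, ← len_neg, neg_sub]
      exact abs_sym_sub_sym_le_of_wt_ne_zero l hk
  · exact abs_sym_sub_sym_le_of_wt_ne_zero k hl

theorem abs_sym_add_sym_le (n : ℕ) {p q r : ℤ × ℤ} (h : p + q + r = 0) :
    |sym n q + sym n r| ≤ 7 * len p := by
  have hqr : q - -r = -p := by linear_combination (exp := 1) h
  simpa only [hqr, len_neg, sym_neg, sub_neg_eq_add] using abs_sym_sub_sym_le n q (-r)

theorem abs_sym_le (n : ℕ) (k : ℤ × ℤ) : |sym n k| ≤ 7 * len k := by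
  simpa [sym] using abs_sym_sub_sym_le n k 0

theorem abs_sym_le_const (n : ℕ) (k : ℤ × ℤ) : |sym n k| ≤ 3 * 2 ^ n := by
  by_cases h : wt n k = 0
  · simp [sym, h]
  · rw [sym, abs_mul, abs_of_nonneg (wt_nonneg n k), ← one_mul (3 * (2 : ℝ) ^ n)]
    gcongr
    · exact wt_le_one n k
    · exact (abs_fst_le_len k).trans (lt_len_and_len_lt_of_wt_ne_zero h).2.le

theorem abs_sym_add_add_le (n : ℕ) {p q r : ℤ × ℤ} (h : p + q + r = 0) :
    |sym n p + sym n q + sym n r| ≤ 14 * len p := by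
  rw [add_assoc]
  linarith [abs_add_le (sym n p) (sym n q + sym n r), abs_sym_le n p, abs_sym_add_sym_le n h]

/-- A box that contains the support of `wt n`. -/
def box (n : ℕ) : Finset (ℤ × ℤ) :=
  Finset.Icc (-(3 * 2 ^ n)) (3 * 2 ^ n) ×ˢ Finset.Icc (-(3 * 2 ^ n)) (3 * 2 ^ n)

theorem mem_box_of_wt_ne_zero {n : ℕ} {k : ℤ × ℤ} (h : wt n k ≠ 0) : k ∈ box n := by
  have hlen := (lt_len_and_len_lt_of_wt_ne_zero h).2.le
  rw [box, Finset.mem_product, Finset.mem_Icc, Finset.mem_Icc, ← abs_le, ← abs_le]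
  exact ⟨by exact_mod_cast (abs_fst_le_len k).trans hlen,
    by exact_mod_cast (abs_snd_le_len k).trans hlen⟩

/-! ### The energy identity and its cubic form -/

/-- The cubic form whose real part is the time derivative of the weighted energy of a solution
of `∂ₜ v + ∂ₓₓₓ v + 3 ∂ₓ ∂_yy v = ½ ∂ₓ (z v)`; here `z` and `c` are the Fourier coefficients of
`z` and of `v`. -/
def theta (n : ℕ) (z c : ℤ × ℤ → ℂ) : ℂ :=
  ∑ k ∈ box n, Complex.I * sym n k * c (-k) * ∑' l, z l * c (k - l)

/-- The sum of `M(p, q, r) f(p) g(q) h(r)` over all `p + q + r = 0`, parametrized by `(p, q)`. -/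
def triSeries (M : ℤ × ℤ → ℤ × ℤ → ℤ × ℤ → ℂ) (f g h : ℤ × ℤ → ℂ) : ℂ :=
  ∑' w : (ℤ × ℤ) × (ℤ × ℤ), M w.1 w.2 (-w.1 - w.2) * f w.1 * g w.2 * h (-w.1 - w.2)

theorem summable_triSeries {M : ℤ × ℤ → ℤ × ℤ → ℤ × ℤ → ℂ} {C : ℝ} (hM : ∀ p q r, ‖M p q r‖ ≤ C)
    {f g h : ℤ × ℤ → ℂ} (hf : Summable f) (hg : Summable g) (hh : Summable h) :
    Summable fun w : (ℤ × ℤ) × (ℤ × ℤ) =>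
      M w.1 w.2 (-w.1 - w.2) * f w.1 * g w.2 * h (-w.1 - w.2) := by
  refine Summable.of_norm_bounded ((hf.norm.mul_of_nonneg hg.norm (fun _ => norm_nonneg _)
    (fun _ => norm_nonneg _)).mul_left (C * ∑' l, ‖h l‖)) fun w => ?_
  have hC : 0 ≤ C := (norm_nonneg _).trans (hM 0 0 0)
  rw [norm_mul, norm_mul, norm_mul]
  calc _ ≤ C * ‖f w.1‖ * ‖g w.2‖ * ∑' l, ‖h l‖ := by
        gcongr
        · exact hM _ _ _
        · exact hh.norm.le_tsum _ fun _ _ => norm_nonneg _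
    _ = _ := by ring

theorem triSeries_add_symbol {M M' : ℤ × ℤ → ℤ × ℤ → ℤ × ℤ → ℂ} {C C' : ℝ}
    (hM : ∀ p q r, ‖M p q r‖ ≤ C) (hM' : ∀ p q r, ‖M' p q r‖ ≤ C') {f g h : ℤ × ℤ → ℂ}
    (hf : Summable f) (hg : Summable g) (hh : Summable h) :
    triSeries (fun p q r => M p q r + M' p q r) f g h =
      triSeries M f g h + triSeries M' f g h := by
  simp only [triSeries, add_mul]
  exact (summable_triSeries hM hf hg hh).tsum_add (summable_triSeries hM' hf hg hh)

theorem triSeries_div_symbol (M : ℤ × ℤ → ℤ × ℤ → ℤ × ℤ → ℂ) (a : ℂ) (f g h : ℤ × ℤ → ℂ) :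
    triSeries (fun p q r => M p q r / a) f g h = triSeries M f g h / a := by
  rw [triSeries, triSeries, ← tsum_div_const]
  exact tsum_congr fun w => by ring

theorem triSeries_swap_left (M : ℤ × ℤ → ℤ × ℤ → ℤ × ℤ → ℂ) (f g h : ℤ × ℤ → ℂ) :
    triSeries M f g h = triSeries (fun p q r => M q p r) g f h := by
  rw [triSeries, triSeries, ← (Equiv.prodComm (ℤ × ℤ) (ℤ × ℤ)).tsum_eq]
  refine tsum_congr fun w => ?_
  simp only [Equiv.prodComm_apply, Prod.fst_swap, Prod.snd_swap]
  rw [show -w.2 - w.1 = -w.1 - w.2 by abel]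
  ring

theorem triSeries_swap_right (M : ℤ × ℤ → ℤ × ℤ → ℤ × ℤ → ℂ) (f g h : ℤ × ℤ → ℂ) :
    triSeries M f g h = triSeries (fun p q r => M p r q) f h g := by
  let toThird : (ℤ × ℤ) × (ℤ × ℤ) ≃ (ℤ × ℤ) × (ℤ × ℤ) :=
    { toFun := fun w => (w.1, -w.1 - w.2)
      invFun := fun w => (w.1, -w.1 - w.2)
      left_inv := fun w => by simp
      right_inv := fun w => by simp }
  rw [triSeries, triSeries, ← toThird.tsum_eq]
  refine tsum_congr fun w => ?_
  simp only [toThird, Equiv.coe_fn_mk]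
  rw [show -w.1 - (-w.1 - w.2) = w.2 by abel]
  ring

theorem summable_mul_comp_sub {z c : ℤ × ℤ → ℂ} (hz : Summable z) (hc : Summable c) (k : ℤ × ℤ) :
    Summable fun l => z l * c (k - l) := by
  refine Summable.of_norm_bounded (hz.norm.mul_right (∑' l, ‖c l‖)) fun l => ?_
  rw [norm_mul]
  gcongr
  exact hc.norm.le_tsum _ fun _ _ => norm_nonneg _

theorem theta_add (n : ℕ) {z z' c : ℤ × ℤ → ℂ} (hz : Summable z) (hz' : Summable z')
    (hc : Summable c) : theta n (z + z') c = theta n z c + theta n z' c := by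
  simp only [theta, ← Finset.sum_add_distrib]
  refine Finset.sum_congr rfl fun k _ => ?_
  rw [← mul_add, ← (summable_mul_comp_sub hz hc k).tsum_add (summable_mul_comp_sub hz' hc k)]
  simp only [Pi.add_apply, add_mul]

theorem norm_neg_I_mul_sym_le (n : ℕ) (k : ℤ × ℤ) : ‖-Complex.I * sym n k‖ ≤ 3 * 2 ^ n := by
  rw [norm_mul, norm_neg, Complex.norm_I, one_mul, Complex.norm_real]
  exact abs_sym_le_const n k

theorem theta_eq_triSeries_snd (n : ℕ) {z c : ℤ × ℤ → ℂ} (hz : Summable z) (hc : Summable c) :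
    theta n z c = triSeries (fun _ q _ => -Complex.I * sym n q) z c c := by
  let toFreq : (ℤ × ℤ) × (ℤ × ℤ) ≃ (ℤ × ℤ) × (ℤ × ℤ) :=
    { toFun := fun w => (w.2, -w.1)
      invFun := fun w => (-w.2, w.1)
      left_inv := fun w => by simp
      right_inv := fun w => by simp }
  have hsum := summable_triSeries (fun _ q _ => norm_neg_I_mul_sym_le n q) hz hc hc
  have hfubini := (toFreq.summable_iff.mpr hsum).tsum_prod
  simp only [Function.comp_apply] at hfubini
  rw [triSeries, ← toFreq.tsum_eq, hfubini, theta, tsum_eq_sum (s := box n)]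
  · refine Finset.sum_congr rfl fun k _ => ?_
    rw [← tsum_mul_left]
    refine tsum_congr fun l => ?_
    simp only [toFreq, Equiv.coe_fn_mk, sym_neg]
    rw [show -l - -k = k - l by abel]
    push_cast
    ring
  · intro k hk
    have hwt : wt n k = 0 := by
      contrapose! hk
      exact mem_box_of_wt_ne_zero hk
    simp [toFreq, sym, wt_neg, hwt]

theorem theta_eq_triSeries_thd (n : ℕ) {z c : ℤ × ℤ → ℂ} (hz : Summable z) (hc : Summable c) :
    theta n z c = triSeries (fun _ _ r => -Complex.I * sym n r) z c c := by
  rw [theta_eq_triSeries_snd n hz hc, triSeries_swap_right]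

theorem theta_eq_triSeries_fst (n : ℕ) {c : ℤ × ℤ → ℂ} (hc : Summable c) :
    theta n c c = triSeries (fun p _ _ => -Complex.I * sym n p) c c c := by
  rw [theta_eq_triSeries_snd n hc hc, triSeries_swap_left]

/-- The symbol of the cubic form after symmetrization in the last two frequencies. -/
def halfSym (n : ℕ) (_ q r : ℤ × ℤ) : ℂ := -Complex.I * sym n q / 2 + -Complex.I * sym n r / 2

/-- The symbol of the cubic form after symmetrization in all frequencies. -/
def fullSym (n : ℕ) (p q r : ℤ × ℤ) : ℂ :=
  -Complex.I * sym n p / 3 + -Complex.I * sym n q / 3 + -Complex.I * sym n r / 3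

theorem norm_neg_I_mul_sym_div_le (n m : ℕ) (k : ℤ × ℤ) :
    ‖-Complex.I * sym n k / m‖ ≤ 3 * 2 ^ n / m := by
  rw [norm_div, RCLike.norm_natCast]
  gcongr
  exact norm_neg_I_mul_sym_le n k

theorem norm_halfSym_le_const (n : ℕ) (p q r : ℤ × ℤ) : ‖halfSym n p q r‖ ≤ 3 * 2 ^ n := by
  have hq := norm_neg_I_mul_sym_div_le n 2 q
  have hr := norm_neg_I_mul_sym_div_le n 2 r
  push_cast at hq hr
  exact (norm_add_le _ _).trans (by linarith)

theorem norm_fullSym_le_const (n : ℕ) (p q r : ℤ × ℤ) : ‖fullSym n p q r‖ ≤ 3 * 2 ^ n := by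
  have hp := norm_neg_I_mul_sym_div_le n 3 p
  have hq := norm_neg_I_mul_sym_div_le n 3 q
  have hr := norm_neg_I_mul_sym_div_le n 3 r
  push_cast at hp hq hr
  exact norm_add₃_le.trans (by linarith)

theorem theta_eq_triSeries_halfSym (n : ℕ) {z c : ℤ × ℤ → ℂ} (hz : Summable z)
    (hc : Summable c) : theta n z c = triSeries (halfSym n) z c c := by
  have hsplit := triSeries_add_symbol (fun _ q _ => norm_neg_I_mul_sym_div_le n 2 q)
    (fun _ _ r => norm_neg_I_mul_sym_div_le n 2 r) hz hc hc
  rw [triSeries_div_symbol (fun _ q _ => -Complex.I * sym n q),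
    triSeries_div_symbol (fun _ _ r => -Complex.I * sym n r), ← theta_eq_triSeries_snd n hz hc,
    ← theta_eq_triSeries_thd n hz hc, ← add_div, ← two_mul] at hsplit
  push_cast at hsplit
  rw [mul_div_cancel_left₀ _ two_ne_zero] at hsplit
  exact hsplit.symm

theorem theta_eq_triSeries_fullSym (n : ℕ) {c : ℤ × ℤ → ℂ} (hc : Summable c) :
    theta n c c = triSeries (fullSym n) c c c := by
  have hpq := triSeries_add_symbol (fun p _ _ => norm_neg_I_mul_sym_div_le n 3 p)
    (fun _ q _ => norm_neg_I_mul_sym_div_le n 3 q) hc hc hc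
  have hpqr := triSeries_add_symbol
    (fun p q _ => norm_add_le_of_le (norm_neg_I_mul_sym_div_le n 3 p)
      (norm_neg_I_mul_sym_div_le n 3 q))
    (fun _ _ r => norm_neg_I_mul_sym_div_le n 3 r) hc hc hc
  rw [hpq, triSeries_div_symbol (fun p _ _ => -Complex.I * sym n p),
    triSeries_div_symbol (fun _ q _ => -Complex.I * sym n q),
    triSeries_div_symbol (fun _ _ r => -Complex.I * sym n r), ← theta_eq_triSeries_fst n hc,
    ← theta_eq_triSeries_snd n hc hc, ← theta_eq_triSeries_thd n hc hc] at hpqr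
  push_cast at hpqr
  exact (hpqr.trans (by ring)).symm

theorem enorm_triSeries_le {M : ℤ × ℤ → ℤ × ℤ → ℤ × ℤ → ℂ} {C : ℝ} (hM : ∀ p q r, ‖M p q r‖ ≤ C)
    {f g h : ℤ × ℤ → ℂ} (hf : Summable f) (hg : Summable g) (hh : Summable h) :
    ‖triSeries M f g h‖ₑ ≤ ∑' J : ℕ × ℕ × ℕ,
      ‖triSum (annulus J.1) (annulus J.2.1) (annulus J.2.2) M f g h‖ₑ := by
  classical
  set indices : (ℤ × ℤ) × (ℤ × ℤ) → ℕ × ℕ × ℕ :=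
    fun w => (idx w.1, idx w.2, idx (-w.1 - w.2)) with hindices
  have hfiber := (summable_triSeries hM hf hg hh).hasSum.tsum_fiberwise indices
  refine (enorm_le_tsum_enorm_of_hasSum hfiber).trans (le_of_eq (tsum_congr fun J => ?_))
  congr 1
  obtain ⟨j₁, j₂, j₃⟩ := J
  have hpreimage : indices ⁻¹' {(j₁, j₂, j₃)} =
      ((annulus j₁ ×ˢ annulus j₂).filter fun w => -w.1 - w.2 ∈ annulus j₃ :
        Finset ((ℤ × ℤ) × (ℤ × ℤ))) := by
    ext w
    simp [hindices, mem_annulus_iff_idx, and_assoc]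
  rw [hpreimage, Finset.tsum_subtype' _
    (fun w : (ℤ × ℤ) × (ℤ × ℤ) => M w.1 w.2 (-w.1 - w.2) * f w.1 * g w.2 * h (-w.1 - w.2)),
    Finset.sum_filter, Finset.sum_product, triSum]
  refine Finset.sum_congr rfl fun p _ => Finset.sum_congr rfl fun q _ => ?_
  have third_eq (r : ℤ × ℤ) : p + q + r = 0 ↔ r = -p - q := by
    rw [add_eq_zero_iff_eq_neg', neg_add']
  simp only [third_eq, Finset.sum_ite_eq']

/-- The Fourier side of the equation `∂ₜ v + ∂ₓₓₓ v + 3 ∂ₓ ∂_yy v = ½ ∂ₓ (z v)` on `(0, T)`.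
For `z = v` this is the Zakharov-Kuznetsov equation, and `v = u₁ - u₂` solves it with
`z = u₁ + u₂`. -/
def IsAdvected (T : ℝ) (z v : ℝ → Torus → ℝ) : Prop :=
  ∀ t ∈ Ioo 0 T, ∀ k, HasDerivAt (fun t => coeff (v t) k) (Complex.I * phase k * coeff (v t) k +
    Complex.I * k.1 / 2 * ∑' l, coeff (z t) l * coeff (v t) (k - l)) t

/-- The weighted energy `∑ wt n k |f̂(k)|²`, which dominates `‖P_N f‖²` for `N = 2 ^ n`. -/
def energy (n : ℕ) (f : Torus → ℝ) : ℝ := ∑ k ∈ box n, wt n k * ‖coeff f k‖ ^ 2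

theorem continuousOn_theta {T : ℝ} (hT : 0 < T) {z v : ℝ → Torus → ℝ} (hz : SmoothOn T z)
    (hv : SmoothOn T v) (n : ℕ) :
    ContinuousOn (fun t => theta n (coeff (z t)) (coeff (v t))) (Icc 0 T) := by
  obtain ⟨b, hb, hb_nonneg, hbz⟩ := hz.exists_summable_coeff_bound hT
  obtain ⟨b', hb', hb'_nonneg, hbv⟩ := hv.exists_summable_coeff_bound hT
  refine continuousOn_finsetSum _ fun k _ =>
    (continuousOn_const.mul (hv.continuousOn_coeff _)).mul ?_
  refine continuousOn_tsum (u := fun l => b l * ∑' m, b' m)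
    (fun l => (hz.continuousOn_coeff l).mul (hv.continuousOn_coeff _)) (hb.mul_right _) ?_
  intro l t ht
  rw [norm_mul]
  gcongr
  · exact hb_nonneg l
  · exact hbz t ht l
  · exact (hbv t ht _).trans (hb'.le_tsum _ fun m _ => hb'_nonneg m)

namespace IsAdvected

variable {T : ℝ} {z v : ℝ → Torus → ℝ}

theorem hasDerivAt_energy (heq : IsAdvected T z v) {t : ℝ} (ht : t ∈ Ioo 0 T) (n : ℕ) :
    HasDerivAt (fun t => energy n (v t)) (theta n (coeff (z t)) (coeff (v t))).re t := by
  have hderiv := HasDerivAt.fun_sum fun k (_ : k ∈ box n) =>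
    ((heq t ht k).norm_sq.const_mul (wt n k))
  refine hderiv.congr_deriv ?_
  rw [theta, Complex.re_sum]
  refine Finset.sum_congr rfl fun k _ => ?_
  rw [Complex.inner, coeff_neg_freq, sym]
  set c := coeff (v t) k
  set S := ∑' l, coeff (z t) l * coeff (v t) (k - l)
  -- The dispersive part of the equation is imaginary after multiplication by `conj c`.
  have hdispersive : (Complex.I * phase k * c + Complex.I * k.1 / 2 * S) * starRingEnd ℂ c =
      Complex.I * ((phase k * ‖c‖ ^ 2 : ℝ) : ℂ) +
        ((1 / 2 : ℝ) : ℂ) * (Complex.I * k.1 * starRingEnd ℂ c * S) := by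
    push_cast
    linear_combination (Complex.I * phase k) * Complex.mul_conj' c
  have hweight : Complex.I * ((wt n k * k.1 : ℝ) : ℂ) * starRingEnd ℂ c * S =
      ((wt n k : ℝ) : ℂ) * (Complex.I * k.1 * starRingEnd ℂ c * S) := by
    push_cast
    ring
  rw [hdispersive, hweight, Complex.add_re, Complex.re_ofReal_mul, Complex.re_ofReal_mul,
    Complex.I_mul_re, Complex.ofReal_im]
  ring

theorem energy_le (heq : IsAdvected T z v) (hT : 0 < T) (hz : SmoothOn T z) (hv : SmoothOn T v)
    (n : ℕ) {t : ℝ} (ht : t ∈ Icc 0 T) :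
    ENNReal.ofReal (energy n (v t)) ≤ ENNReal.ofReal (energy n (v 0)) +
      ∫⁻ τ in Ico 0 T, ‖theta n (coeff (z τ)) (coeff (v τ))‖ₑ := by
  have hsub : Icc 0 t ⊆ Icc 0 T := Icc_subset_Icc_right ht.2
  have hcont : ContinuousOn (fun t => energy n (v t)) (Icc 0 t) :=
    continuousOn_finsetSum _ fun k _ => continuousOn_const.mul
      (((hv.continuousOn_coeff k).mono hsub).norm.pow 2)
  have hre : ContinuousOn (fun τ => (theta n (coeff (z τ)) (coeff (v τ))).re) (Icc 0 t) :=
    Complex.continuous_re.comp_continuousOn ((continuousOn_theta hT hz hv n).mono hsub)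
  have hftc := intervalIntegral.integral_eq_sub_of_hasDerivAt_of_le ht.1 hcont
    (fun τ hτ => heq.hasDerivAt_energy ⟨hτ.1, hτ.2.trans_le ht.2⟩ n)
    (hre.intervalIntegrable_of_Icc ht.1)
  rw [← sub_add_cancel (energy n (v t)) (energy n (v 0)), ← hftc, add_comm]
  refine ENNReal.ofReal_add_le.trans ?_
  gcongr
  refine (ENNReal.ofReal_le_ofReal (le_abs_self _)).trans ?_
  rw [← Real.norm_eq_abs, ofReal_norm, intervalIntegral.integral_of_le ht.1,
    restrict_Ico_eq_restrict_Ioc]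
  refine (enorm_integral_le_lintegral_enorm _).trans ?_
  refine (lintegral_mono_set (Ioc_subset_Ioc_right ht.2)).trans (lintegral_mono fun τ => ?_)
  rw [← ofReal_norm, ← ofReal_norm]
  exact ENNReal.ofReal_le_ofReal (Complex.abs_re_le_norm _)

end IsAdvected

theorem enorm_proj_sq (n : ℕ) (f : Torus → ℝ) :
    ‖proj n f‖ₑ ^ 2 = ENNReal.ofReal (∑ k ∈ annulus n, ‖coeff f k‖ ^ 2) := by
  rw [← ofReal_norm, ← ENNReal.ofReal_pow (norm_nonneg _)]
  congr 1
  have hinner := orthonormal_characterL2.inner_sum (coeff f) (coeff f) (annulus n)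
  rw [← proj, inner_self_eq_norm_sq_to_K] at hinner
  simp only [Complex.conj_mul'] at hinner
  apply Complex.ofReal_injective
  push_cast
  exact hinner

theorem enorm_proj_sq_le_energy (n : ℕ) (f : Torus → ℝ) :
    ‖proj n f‖ₑ ^ 2 ≤ ENNReal.ofReal (energy n f) := by
  rw [enorm_proj_sq]
  refine ENNReal.ofReal_le_ofReal ?_
  calc ∑ k ∈ annulus n, ‖coeff f k‖ ^ 2 = ∑ k ∈ annulus n, wt n k * ‖coeff f k‖ ^ 2 :=
        Finset.sum_congr rfl fun k hk => by rw [wt_eq_one hk, one_mul]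
    _ ≤ energy n f := by
        refine Finset.sum_le_sum_of_subset_of_nonneg (fun k hk => ?_) fun k _ _ =>
          mul_nonneg (wt_nonneg n k) (sq_nonneg _)
        exact mem_box_of_wt_ne_zero ((wt_eq_one hk).trans_ne one_ne_zero)

theorem IsAdvected.iSup_enorm_proj_sq_le {T : ℝ} {z v : ℝ → Torus → ℝ} (heq : IsAdvected T z v)
    (hT : 0 < T) (hz : SmoothOn T z) (hv : SmoothOn T v) (n : ℕ) :
    ⨆ t ∈ Icc 0 T, ‖proj n (v t)‖ₑ ^ 2 ≤ ENNReal.ofReal (energy n (v 0)) +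
      ∫⁻ τ in Ico 0 T, ‖theta n (coeff (z τ)) (coeff (v τ))‖ₑ :=
  iSup₂_le fun _ ht => (enorm_proj_sq_le_energy n _).trans (heq.energy_le hT hz hv n ht)

/-! ### Dyadic estimates of the cubic form -/

/-- Triples of dyadic indices whose annuli can carry frequencies with sum zero: no frequency is
much larger than both others. -/
def Admissible (J : ℕ × ℕ × ℕ) : Prop :=
  J.1 ≤ max J.2.1 J.2.2 + 1 ∧ J.2.1 ≤ max J.1 J.2.2 + 1 ∧ J.2.2 ≤ max J.1 J.2.1 + 1

theorem le_max_add_one {i j l : ℕ} {p q r : ℤ × ℤ} (hp : p ∈ annulus i) (hq : q ∈ annulus j)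
    (hr : r ∈ annulus l) (h : p + q + r = 0) : i ≤ max j l + 1 := by
  rcases eq_or_ne i 0 with rfl | hi
  · lia
  have htriangle : len p ≤ len q + len r := by
    rw [← len_neg p, neg_eq_of_add_eq_zero_right ((add_assoc p q r).symm.trans h)]
    exact len_add_le q r
  have hj : (2 : ℝ) ^ j ≤ 2 ^ max j l := pow_le_pow_right₀ one_le_two (le_max_left _ _)
  have hl : (2 : ℝ) ^ l ≤ 2 ^ max j l := pow_le_pow_right₀ one_le_two (le_max_right _ _)
  have hpow : (2 : ℝ) ^ i < 2 ^ (max j l + 2) := by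
    rw [pow_add]
    linarith [le_len_of_mem_annulus hp hi, len_lt_of_mem_annulus hq, len_lt_of_mem_annulus hr]
  have := (pow_lt_pow_iff_right₀ one_lt_two).mp hpow
  lia

theorem admissible_of_add_eq_zero {J : ℕ × ℕ × ℕ} {p q r : ℤ × ℤ} (hp : p ∈ annulus J.1)
    (hq : q ∈ annulus J.2.1) (hr : r ∈ annulus J.2.2) (h : p + q + r = 0) : Admissible J :=
  ⟨le_max_add_one hp hq hr h, le_max_add_one hq hp hr (by rw [← h]; abel),
    le_max_add_one hr hp hq (by rw [← h]; abel)⟩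

theorem sym_eq_zero_of_not_near {n j : ℕ} {k : ℤ × ℤ} (hk : k ∈ annulus j) (h : ¬Near n j) :
    sym n k = 0 := by
  contrapose! h
  exact near_of_wt_ne_zero hk fun hwt => h (by simp [sym, hwt])

theorem norm_halfSym_le {n j : ℕ} {p q r : ℤ × ℤ} (hp : p ∈ annulus j) (h : p + q + r = 0) :
    ‖halfSym n p q r‖ ≤ 14 * 2 ^ j := by
  have hfactor : halfSym n p q r = -Complex.I * ((sym n q + sym n r : ℝ) : ℂ) / 2 := by
    rw [halfSym]
    push_cast
    ring
  rw [hfactor, norm_div, norm_mul, norm_neg, Complex.norm_I, one_mul, Complex.norm_real,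
    RCLike.norm_ofNat, Real.norm_eq_abs]
  linarith [abs_sym_add_sym_le n h, len_lt_of_mem_annulus hp, len_nonneg p]

theorem norm_fullSym (n : ℕ) (p q r : ℤ × ℤ) :
    ‖fullSym n p q r‖ = |sym n p + sym n q + sym n r| / 3 := by
  have hfactor : fullSym n p q r = -Complex.I * ((sym n p + sym n q + sym n r : ℝ) : ℂ) / 3 := by
    rw [fullSym]
    push_cast
    ring
  rw [hfactor, norm_div, norm_mul, norm_neg, Complex.norm_I, one_mul, Complex.norm_real,
    RCLike.norm_ofNat, Real.norm_eq_abs]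

theorem norm_fullSym_le_fst {n j : ℕ} {p q r : ℤ × ℤ} (hp : p ∈ annulus j)
    (h : p + q + r = 0) : ‖fullSym n p q r‖ ≤ 14 * 2 ^ j := by
  rw [norm_fullSym]
  linarith [abs_sym_add_add_le n h, len_lt_of_mem_annulus hp, len_nonneg p]

theorem norm_fullSym_le {n : ℕ} {J : ℕ × ℕ × ℕ} {p q r : ℤ × ℤ} (hp : p ∈ annulus J.1)
    (hq : q ∈ annulus J.2.1) (hr : r ∈ annulus J.2.2) (h : p + q + r = 0) :
    ‖fullSym n p q r‖ ≤ 14 * 2 ^ min J.1 (min J.2.1 J.2.2) := by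
  have hsnd : fullSym n p q r = fullSym n q p r := by simp only [fullSym]; ring
  have hthd : fullSym n p q r = fullSym n r p q := by simp only [fullSym]; ring
  rcases min_choice J.1 (min J.2.1 J.2.2) with hmin | hmin <;> rw [hmin]
  · exact norm_fullSym_le_fst hp h
  rcases min_choice J.2.1 J.2.2 with hmin | hmin <;> rw [hmin]
  · rw [hsnd]
    exact norm_fullSym_le_fst hq (by rw [← h]; abel)
  · rw [hthd]
    exact norm_fullSym_le_fst hr (by rw [← h]; abel)

theorem lintegral_triSeries_le {T : ℝ} (hT : 0 < T) {M : ℤ × ℤ → ℤ × ℤ → ℤ × ℤ → ℂ} {C : ℝ}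
    (hM : ∀ p q r, ‖M p q r‖ ≤ C) {z v : ℝ → Torus → ℝ} (hz : SmoothOn T z) (hv : SmoothOn T v) :
    ∫⁻ t in Ico 0 T, ‖triSeries M (coeff (z t)) (coeff (v t)) (coeff (v t))‖ₑ ≤
      ∑' J : ℕ × ℕ × ℕ, ∫⁻ t in Ico 0 T, ‖triSum (annulus J.1) (annulus J.2.1) (annulus J.2.2) M
        (coeff (z t)) (coeff (v t)) (coeff (v t))‖ₑ := by
  rw [← lintegral_tsum]
  · refine setLIntegral_mono' measurableSet_Ico fun t ht => ?_
    have hsum := hv.summable_coeff hT (Ico_subset_Icc_self ht)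
    exact enorm_triSeries_le hM (hz.summable_coeff hT (Ico_subset_Icc_self ht)) hsum hsum
  · intro J
    refine (ContinuousOn.aemeasurable ?_ measurableSet_Ico).enorm
    have hcont {w : ℝ → Torus → ℝ} (hw : SmoothOn T w) (k : ℤ × ℤ) :
        ContinuousOn (fun t => coeff (w t) k) (Ico 0 T) :=
      (hw.continuousOn_coeff k).mono Ico_subset_Icc_self
    unfold triSum
    refine continuousOn_finsetSum _ fun p _ => continuousOn_finsetSum _ fun q _ =>
      continuousOn_finsetSum _ fun r _ => ?_
    split_ifs
    · exact ((continuousOn_const.mul (hcont hz p)).mul (hcont hv q)).mul (hcont hv r)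
    · exact continuousOn_const

theorem triSum_eq_zero {P Q R : Finset (ℤ × ℤ)} {M : ℤ × ℤ → ℤ × ℤ → ℤ × ℤ → ℂ}
    (hM : ∀ p ∈ P, ∀ q ∈ Q, ∀ r ∈ R, p + q + r = 0 → M p q r = 0) (f g h : ℤ × ℤ → ℂ) :
    triSum P Q R M f g h = 0 := by
  refine Finset.sum_eq_zero fun p hp => Finset.sum_eq_zero fun q hq =>
    Finset.sum_eq_zero fun r hr => ite_eq_right_iff.mpr fun hpqr => ?_
  rw [hM p hp q hq r hr hpqr]
  ring

/-- The bound of a dyadic piece of a cubic form whose symbol is at most `14 * 2 ^ m`. -/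
def dyadicTerm (T : ℝ) (z v : ℝ → Torus → ℝ) (m : ℕ) (J : ℕ × ℕ × ℕ) : ℝ≥0∞ :=
  triConst * 14 * 2 ^ m * ((2 : ℝ≥0∞) ^ min J.1 (min J.2.1 J.2.2)) ^ (1 / 2 : ℝ) *
    (shortNorm T z J.1 * shortNorm T v J.2.1 * shortNorm T v J.2.2)

theorem lintegral_triSum_le_dyadicTerm {T : ℝ} (hT : T ≤ 1) {M : ℤ × ℤ → ℤ × ℤ → ℤ × ℤ → ℂ}
    {J : ℕ × ℕ × ℕ} {m : ℕ} (hM : ∀ p ∈ annulus J.1, ∀ q ∈ annulus J.2.1, ∀ r ∈ annulus J.2.2,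
      p + q + r = 0 → ‖M p q r‖ ≤ 14 * 2 ^ m) (z v : ℝ → Torus → ℝ) :
    ∫⁻ t in Ico 0 T, ‖triSum (annulus J.1) (annulus J.2.1) (annulus J.2.2) M
      (coeff (z t)) (coeff (v t)) (coeff (v t))‖ₑ ≤ dyadicTerm T z v m J := by
  refine (lintegral_triSum_coeff_le (μ := 14 * 2 ^ m) (by positivity)
    (by exact_mod_cast hM) hT z v v).trans (le_of_eq ?_)
  simp only [dyadicTerm, ENNReal.coe_mul, ENNReal.coe_ofNat, ENNReal.coe_pow, mul_assoc]

theorem lintegral_triSeries_le_tsum_dyadicTerm {T : ℝ} (hT : 0 < T) (hT1 : T ≤ 1)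
    {M : ℤ × ℤ → ℤ × ℤ → ℤ × ℤ → ℂ} {C : ℝ} (hC : ∀ p q r, ‖M p q r‖ ≤ C)
    {m : ℕ × ℕ × ℕ → ℕ} {P : ℕ × ℕ × ℕ → Prop} [∀ J, Decidable (Admissible J ∧ P J)]
    (hM : ∀ J : ℕ × ℕ × ℕ, ∀ p ∈ annulus J.1, ∀ q ∈ annulus J.2.1, ∀ r ∈ annulus J.2.2,
      p + q + r = 0 → ‖M p q r‖ ≤ 14 * 2 ^ m J)
    (hP : ∀ J : ℕ × ℕ × ℕ, ¬P J → ∀ p ∈ annulus J.1, ∀ q ∈ annulus J.2.1, ∀ r ∈ annulus J.2.2,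
      M p q r = 0)
    {z v : ℝ → Torus → ℝ} (hz : SmoothOn T z) (hv : SmoothOn T v) :
    ∫⁻ t in Ico 0 T, ‖triSeries M (coeff (z t)) (coeff (v t)) (coeff (v t))‖ₑ ≤
      ∑' J : ℕ × ℕ × ℕ, if Admissible J ∧ P J then dyadicTerm T z v (m J) J else 0 := by
  refine (lintegral_triSeries_le hT hC hz hv).trans (ENNReal.tsum_le_tsum fun J => ?_)
  split_ifs with hJ
  · exact lintegral_triSum_le_dyadicTerm hT1 (hM J) z v
  · refine (setLIntegral_eq_zero measurableSet_Ico fun t _ => ?_).le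
    rw [Pi.zero_apply, enorm_eq_zero]
    refine triSum_eq_zero (fun p hp q hq r hr hpqr => ?_) _ _ _
    have hnot : ¬P J := fun h => hJ ⟨admissible_of_add_eq_zero hp hq hr hpqr, h⟩
    exact hP J hnot p hp q hq r hr

open Classical in
theorem lintegral_theta_half_le {T : ℝ} (hT : 0 < T) (hT1 : T ≤ 1) {z v : ℝ → Torus → ℝ}
    (hz : SmoothOn T z) (hv : SmoothOn T v) (n : ℕ) :
    ∫⁻ t in Ico 0 T, ‖theta n (coeff (z t)) (coeff (v t))‖ₑ ≤ ∑' J : ℕ × ℕ × ℕ,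
      if Admissible J ∧ (Near n J.2.1 ∨ Near n J.2.2) then dyadicTerm T z v J.1 J else 0 := by
  have hsymm (t : ℝ) (ht : t ∈ Ico 0 T) : ‖theta n (coeff (z t)) (coeff (v t))‖ₑ =
      ‖triSeries (halfSym n) (coeff (z t)) (coeff (v t)) (coeff (v t))‖ₑ := by
    rw [theta_eq_triSeries_halfSym n (hz.summable_coeff hT (Ico_subset_Icc_self ht))
      (hv.summable_coeff hT (Ico_subset_Icc_self ht))]
  rw [setLIntegral_congr_fun measurableSet_Ico hsymm]
  refine lintegral_triSeries_le_tsum_dyadicTerm hT hT1 (norm_halfSym_le_const n)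
    (m := fun J => J.1) (P := fun J => Near n J.2.1 ∨ Near n J.2.2)
    (fun J p hp q _ r _ hpqr => norm_halfSym_le hp hpqr) ?_ hz hv
  intro J hJ p _ q hq r hr
  rw [not_or] at hJ
  simp [halfSym, sym_eq_zero_of_not_near hq hJ.1, sym_eq_zero_of_not_near hr hJ.2]

open Classical in
theorem lintegral_theta_full_le {T : ℝ} (hT : 0 < T) (hT1 : T ≤ 1) {v : ℝ → Torus → ℝ}
    (hv : SmoothOn T v) (n : ℕ) :
    ∫⁻ t in Ico 0 T, ‖theta n (coeff (v t)) (coeff (v t))‖ₑ ≤ ∑' J : ℕ × ℕ × ℕ,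
      if Admissible J ∧ (Near n J.1 ∨ Near n J.2.1 ∨ Near n J.2.2) then
        dyadicTerm T v v (min J.1 (min J.2.1 J.2.2)) J else 0 := by
  have hsymm (t : ℝ) (ht : t ∈ Ico 0 T) : ‖theta n (coeff (v t)) (coeff (v t))‖ₑ =
      ‖triSeries (fullSym n) (coeff (v t)) (coeff (v t)) (coeff (v t))‖ₑ := by
    rw [theta_eq_triSeries_fullSym n (hv.summable_coeff hT (Ico_subset_Icc_self ht))]
  rw [setLIntegral_congr_fun measurableSet_Ico hsymm]
  refine lintegral_triSeries_le_tsum_dyadicTerm hT hT1 (norm_fullSym_le_const n)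
    (m := fun J => min J.1 (min J.2.1 J.2.2))
    (P := fun J => Near n J.1 ∨ Near n J.2.1 ∨ Near n J.2.2)
    (fun J p hp q hq r hr hpqr => norm_fullSym_le hp hq hr hpqr) ?_ hv hv
  intro J hJ p hp q hq r hr
  rw [not_or, not_or] at hJ
  simp [fullSym, sym_eq_zero_of_not_near hp hJ.1, sym_eq_zero_of_not_near hq hJ.2.1,
    sym_eq_zero_of_not_near hr hJ.2.2]

/-! ### Summation over dyadic indices -/

/-- The dyadic weight `N ^ σ`, `N = 2 ^ j`. -/
def dyad (σ : ℝ) (j : ℕ) : ℝ≥0∞ := ((2 : ℝ≥0∞) ^ j) ^ σ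

theorem dyad_add (σ τ : ℝ) (j : ℕ) : dyad (σ + τ) j = dyad σ j * dyad τ j :=
  ENNReal.rpow_add _ _ (by positivity) (by finiteness)

theorem dyad_one (j : ℕ) : dyad 1 j = 2 ^ j := ENNReal.rpow_one _

theorem dyad_mono {σ : ℝ} (hσ : 0 ≤ σ) {i j : ℕ} (h : i ≤ j) : dyad σ i ≤ dyad σ j :=
  ENNReal.rpow_le_rpow (pow_le_pow_right₀ one_le_two h) hσ

theorem dyad_anti {σ : ℝ} (hσ : σ ≤ 0) {i j : ℕ} (h : i ≤ j) : dyad σ j ≤ dyad σ i := by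
  have := ENNReal.inv_le_inv.mpr (dyad_mono (neg_nonneg.mpr hσ) h)
  rwa [dyad, dyad, ENNReal.rpow_neg, ENNReal.rpow_neg, inv_inv, inv_inv] at this

theorem dyad_le_of_le_add_one {σ : ℝ} (hσ : 0 ≤ σ) {i j : ℕ} (h : i ≤ j + 1) :
    dyad σ i ≤ 2 ^ σ * dyad σ j := by
  refine (dyad_mono hσ h).trans (le_of_eq ?_)
  rw [dyad, pow_succ', ENNReal.mul_rpow_of_nonneg _ _ hσ, dyad]

theorem dyad_two_mul (σ : ℝ) (j : ℕ) : dyad (2 * σ) j = dyad σ j * dyad σ j := by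
  rw [two_mul, dyad_add]

theorem dyad_two_mul_le {σ : ℝ} (hσ : 0 ≤ σ) {i j l : ℕ} (hij : i ≤ j + 1) (hil : i ≤ l + 1) :
    dyad (2 * σ) i ≤ 2 ^ (2 * σ) * (dyad σ j * dyad σ l) := by
  rw [dyad_two_mul, two_mul σ, ENNReal.rpow_add _ _ (by norm_num) (by norm_num)]
  calc dyad σ i * dyad σ i ≤ (2 ^ σ * dyad σ j) * (2 ^ σ * dyad σ l) :=
        mul_le_mul' (dyad_le_of_le_add_one hσ hij) (dyad_le_of_le_add_one hσ hil)
    _ = _ := by ring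

theorem tsum_dyad_ne_top {σ : ℝ} (hσ : σ < 0) : ∑' j, dyad σ j ≠ ⊤ := by
  have hgeometric (j : ℕ) : dyad σ j = ((2 : ℝ≥0∞) ^ σ) ^ j := by
    rw [dyad, ← ENNReal.rpow_natCast, ← ENNReal.rpow_mul, mul_comm, ENNReal.rpow_mul,
      ENNReal.rpow_natCast]
  have hratio : (2 : ℝ≥0∞) ^ σ < 1 := ENNReal.rpow_lt_one_of_one_lt_of_neg (by norm_num) hσ
  simp_rw [hgeometric]
  rw [ENNReal.tsum_geometric]
  exact ENNReal.inv_ne_top.mpr (tsub_pos_of_lt hratio).ne'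

open Classical in
theorem tsum_dyad_near_le {σ : ℝ} (hσ : 0 ≤ σ) (j : ℕ) :
    ∑' n, dyad σ n * (if Near n j then 1 else 0) ≤ 3 * 2 ^ σ * dyad σ j := by
  have hsupport : ∀ n ∉ Finset.Icc (j - 1) (j + 1),
      dyad σ n * (if Near n j then (1 : ℝ≥0∞) else 0) = 0 := by
    intro n hn
    rw [if_neg, mul_zero]
    rintro ⟨hnj, hjn⟩
    exact hn (Finset.mem_Icc.mpr ⟨by lia, hnj⟩)
  rw [tsum_eq_sum hsupport]
  calc ∑ n ∈ Finset.Icc (j - 1) (j + 1), dyad σ n * (if Near n j then (1 : ℝ≥0∞) else 0)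
      ≤ ∑ n ∈ Finset.Icc (j - 1) (j + 1), 2 ^ σ * dyad σ j := by
        refine Finset.sum_le_sum fun n hn => ?_
        refine (mul_le_of_le_one_right' (by split_ifs <;> simp)).trans ?_
        exact dyad_le_of_le_add_one hσ (Finset.mem_Icc.mp hn).2
    _ ≤ _ := by
        rw [Finset.sum_const, nsmul_eq_mul, mul_assoc]
        gcongr
        rw [Nat.card_Icc]
        exact_mod_cast (by lia : j + 1 + 1 - (j - 1) ≤ 3)

/-- The `ℓ²` norm of a sequence in `[0, ∞]`. -/
def ellTwo (y : ℕ → ℝ≥0∞) : ℝ≥0∞ := (∑' j, y j ^ 2) ^ (1 / 2 : ℝ)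

theorem ellTwo_succ_le (y : ℕ → ℝ≥0∞) : ellTwo (fun j => y (j + 1)) ≤ ellTwo y :=
  ENNReal.rpow_le_rpow
    (ENNReal.tsum_comp_le_tsum_of_injective (add_left_injective 1) fun j => y j ^ 2) (by norm_num)

theorem le_ellTwo (y : ℕ → ℝ≥0∞) (j : ℕ) : y j ≤ ellTwo y :=
  calc y j = (y j ^ 2) ^ (1 / 2 : ℝ) := by
        rw [← ENNReal.rpow_natCast, ← ENNReal.rpow_mul]
        norm_num
    _ ≤ _ := ENNReal.rpow_le_rpow (ENNReal.le_tsum j) (by norm_num)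

theorem tsum_mul_le_ellTwo (y w : ℕ → ℝ≥0∞) : ∑' j, y j * w j ≤ ellTwo y * ellTwo w := by
  have hcauchy := ENNReal.lintegral_mul_le_Lp_mul_Lq (Measure.count : Measure ℕ)
    Real.HolderConjugate.two_two (f := y) (g := w) measurable_from_nat.aemeasurable
    measurable_from_nat.aemeasurable
  simpa [lintegral_count, ellTwo] using hcauchy

open Classical in
theorem ite_near_le {j l : ℕ} (a : ℝ≥0∞) : (if Near j l then a else 0) ≤
    (if l = j then a else 0) + (if l = j + 1 then a else 0) + (if j = l + 1 then a else 0) := by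
  by_cases h : Near j l
  · rw [if_pos h]
    obtain ⟨hjl, hlj⟩ := h
    rcases (by lia : l = j ∨ l = j + 1 ∨ j = l + 1) with h | h | h
    · simp [h]
    · simp [h]
    · rw [if_pos h]
      exact le_add_self
  · rw [if_neg h]
    exact zero_le

open Classical in
theorem tsum_near_le (y w : ℕ → ℝ≥0∞) :
    ∑' j, ∑' l, (if Near j l then y j * w l else 0) ≤ 3 * (ellTwo y * ellTwo w) := by
  refine (ENNReal.tsum_le_tsum fun j => ENNReal.tsum_le_tsum fun l => ite_near_le _).trans ?_
  simp_rw [ENNReal.tsum_add]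
  rw [ENNReal.tsum_comm (f := fun j l => if j = l + 1 then y j * w l else 0)]
  simp_rw [tsum_ite_eq]
  calc _ ≤ ellTwo y * ellTwo w + ellTwo y * ellTwo w + ellTwo y * ellTwo w := by
        refine add_le_add (add_le_add (tsum_mul_le_ellTwo y w) ?_) ?_
        · refine (tsum_mul_le_ellTwo y fun j => w (j + 1)).trans ?_
          gcongr
          exact ellTwo_succ_le w
        · refine (tsum_mul_le_ellTwo (fun j => y (j + 1)) w).trans ?_
          gcongr
          exact ellTwo_succ_le y
    _ = _ := by ring

open Classical in
/-- The term of a paraproduct with low index `i` and comparable indices `j`, `l`. -/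
def paraTerm (x y w : ℕ → ℝ≥0∞) (i j l : ℕ) : ℝ≥0∞ := if Near j l then x i * (y j * w l) else 0

/-- The bound for the sum of a paraproduct: `ℓ¹` in the low index, `ℓ²` in the high ones. -/
def paraBound (x y w : ℕ → ℝ≥0∞) : ℝ≥0∞ := 3 * ((∑' j, x j) * (ellTwo y * ellTwo w))

theorem tsum_paraTerm_fst_le (x y w : ℕ → ℝ≥0∞) :
    ∑' J : ℕ × ℕ × ℕ, paraTerm x y w J.1 J.2.1 J.2.2 ≤ paraBound x y w := by
  classical
  have hfactor (i j l : ℕ) :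
      paraTerm x y w i j l = x i * (if Near j l then y j * w l else 0) := by
    rw [paraTerm, mul_ite, mul_zero]
  simp_rw [ENNReal.tsum_prod', hfactor, ENNReal.tsum_mul_left, ENNReal.tsum_mul_right]
  rw [paraBound, mul_left_comm]
  gcongr
  exact tsum_near_le y w

theorem tsum_paraTerm_snd_le (x y w : ℕ → ℝ≥0∞) :
    ∑' J : ℕ × ℕ × ℕ, paraTerm x y w J.2.1 J.1 J.2.2 ≤ paraBound x y w := by
  let swap : ℕ × ℕ × ℕ ≃ ℕ × ℕ × ℕ :=
    ⟨fun J => (J.2.1, J.1, J.2.2), fun J => (J.2.1, J.1, J.2.2), fun _ => rfl, fun _ => rfl⟩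
  exact (swap.tsum_eq fun J => paraTerm x y w J.1 J.2.1 J.2.2).trans_le
    (tsum_paraTerm_fst_le x y w)

theorem tsum_paraTerm_thd_le (x y w : ℕ → ℝ≥0∞) :
    ∑' J : ℕ × ℕ × ℕ, paraTerm x y w J.2.2 J.1 J.2.1 ≤ paraBound x y w := by
  let rotate : ℕ × ℕ × ℕ ≃ ℕ × ℕ × ℕ :=
    ⟨fun J => (J.2.2, J.1, J.2.1), fun J => (J.2.1, J.2.2, J.1), fun _ => rfl, fun _ => rfl⟩
  exact (rotate.tsum_eq fun J => paraTerm x y w J.1 J.2.1 J.2.2).trans_le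
    (tsum_paraTerm_fst_le x y w)

theorem Admissible.cases {J : ℕ × ℕ × ℕ} (h : Admissible J) :
    (J.1 ≤ J.2.1 ∧ J.1 ≤ J.2.2 ∧ Near J.2.1 J.2.2) ∨
      (J.2.1 ≤ J.1 ∧ J.2.1 ≤ J.2.2 ∧ Near J.1 J.2.2) ∨
      (J.2.2 ≤ J.1 ∧ J.2.2 ≤ J.2.1 ∧ Near J.1 J.2.1) := by
  simp only [Admissible, Near] at *
  omega

/-- The weighted dyadic pieces `N ^ σ sup_I ‖P_N u‖` of the short-time norm, `N = 2 ^ j`. -/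
def piece (σ T : ℝ) (u : ℝ → Torus → ℝ) (j : ℕ) : ℝ≥0∞ := dyad σ j * shortNorm T u j

theorem Fnorm_eq (σ T : ℝ) (u : ℝ → Torus → ℝ) : Fnorm σ T u = ellTwo (piece σ T u) := by
  rw [Fnorm, ellTwo]
  congr 1
  refine tsum_congr fun j => ?_
  rw [piece, mul_pow, sq (dyad σ j), ← dyad_two_mul, dyad, shortNorm]
  congr 1
  have sq_eq_orderIso (x : ℝ≥0∞) : x ^ 2 = ENNReal.orderIsoRpow 2 two_pos x := by
    rw [ENNReal.orderIsoRpow_apply, ← ENNReal.rpow_natCast]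
    norm_num
  simp_rw [sq_eq_orderIso, OrderIso.map_iSup]

theorem piece_le_Fnorm (σ T : ℝ) (u : ℝ → Torus → ℝ) (j : ℕ) : piece σ T u j ≤ Fnorm σ T u :=
  (le_ellTwo (piece σ T u) j).trans_eq (Fnorm_eq σ T u).symm

theorem tsum_piece_le (σ τ T : ℝ) (u : ℝ → Torus → ℝ) :
    ∑' j, piece (σ + τ) T u j ≤ (∑' j, dyad τ j) * Fnorm σ T u := by
  rw [← ENNReal.tsum_mul_right]
  refine ENNReal.tsum_le_tsum fun j => ?_
  rw [piece, dyad_add, mul_comm (dyad σ j), mul_assoc]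
  gcongr
  exact piece_le_Fnorm σ T u j

/-- The constant `∑ N ^ (3 / 2 - s)` of the summation over the low index: the exponent `3 / 2`
is one derivative plus the `1 / 2` lost in the dyadic trilinear estimate. -/
def lowConst (s : ℝ) : ℝ≥0∞ := ∑' j, dyad (3 / 2 - s) j

theorem paraBound_piece_le (s τ σ₁ σ₂ T : ℝ) (u v w : ℝ → Torus → ℝ) :
    paraBound (piece (τ + (3 / 2 - s)) T u) (piece σ₁ T v) (piece σ₂ T w) ≤
      3 * lowConst s * (Fnorm τ T u * (Fnorm σ₁ T v * Fnorm σ₂ T w)) := by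
  rw [paraBound, ← Fnorm_eq, ← Fnorm_eq, mul_assoc, ← mul_assoc (lowConst s)]
  gcongr
  exact tsum_piece_le τ (3 / 2 - s) T u

open Classical in
theorem tsum_dyad_mul_tsum_le {σ : ℝ} (hσ : 0 ≤ σ) (D : ℕ × ℕ × ℕ → ℝ≥0∞) :
    ∑' n, dyad (2 * σ) n * ∑' J : ℕ × ℕ × ℕ,
      (if Admissible J ∧ (Near n J.1 ∨ Near n J.2.1 ∨ Near n J.2.2) then D J else 0) ≤
    ∑' J : ℕ × ℕ × ℕ, if Admissible J then 3 * 2 ^ (2 * σ) *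
      (dyad (2 * σ) J.1 + dyad (2 * σ) J.2.1 + dyad (2 * σ) J.2.2) * D J else 0 := by
  simp_rw [← ENNReal.tsum_mul_left]
  rw [ENNReal.tsum_comm]
  refine ENNReal.tsum_le_tsum fun J => ?_
  by_cases hJ : Admissible J
  swap
  · simp [hJ]
  have hsplit (n : ℕ) :
      dyad (2 * σ) n * (if Admissible J ∧ (Near n J.1 ∨ Near n J.2.1 ∨ Near n J.2.2)
        then D J else 0) ≤ (dyad (2 * σ) n * (if Near n J.1 then 1 else 0) +
          dyad (2 * σ) n * (if Near n J.2.1 then 1 else 0) +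
          dyad (2 * σ) n * (if Near n J.2.2 then 1 else 0)) * D J := by
    rw [← mul_add, ← mul_add, mul_assoc]
    gcongr
    split_ifs <;> simp_all [add_mul, add_assoc]
  refine (ENNReal.tsum_le_tsum hsplit).trans ?_
  rw [if_pos hJ, ENNReal.tsum_mul_right, ENNReal.tsum_add, ENNReal.tsum_add, mul_add, mul_add]
  gcongr <;> exact tsum_dyad_near_le (by positivity) _

theorem dyad_sum_le {σ : ℝ} (hσ : 0 ≤ σ) {i j l : ℕ} (hij : i ≤ j) (hil : i ≤ l)
    (hjl : Near j l) : dyad (2 * σ) i + dyad (2 * σ) j + dyad (2 * σ) l ≤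
      3 * 2 ^ (2 * σ) * (dyad σ j * dyad σ l) := by
  obtain ⟨hj, hl⟩ := hjl
  calc _ ≤ 2 ^ (2 * σ) * (dyad σ j * dyad σ l) + 2 ^ (2 * σ) * (dyad σ j * dyad σ l) +
        2 ^ (2 * σ) * (dyad σ j * dyad σ l) := by
        gcongr <;> apply dyad_two_mul_le hσ <;> lia
    _ = _ := by ring

theorem two_pow_mul_half (j : ℕ) (s : ℝ) :
    2 ^ j * ((2 : ℝ≥0∞) ^ j) ^ (1 / 2 : ℝ) = dyad (s + (3 / 2 - s)) j := by
  change _ * dyad (1 / 2) j = _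
  rw [← dyad_one, ← dyad_add]
  congr 1
  ring

theorem two_pow_mul_half_le {s : ℝ} (hs : 1 ≤ s) {i j : ℕ} (h : i ≤ j) :
    2 ^ j * ((2 : ℝ≥0∞) ^ i) ^ (1 / 2 : ℝ) ≤ dyad s j * dyad (0 + (3 / 2 - s)) i := by
  have hpow : (2 : ℝ≥0∞) ^ j = dyad s j * dyad (1 - s) j := by
    rw [← dyad_one, ← dyad_add]
    congr 1
    ring
  have hlow : dyad (0 + (3 / 2 - s)) i = dyad (1 - s) i * dyad (1 / 2) i := by
    rw [← dyad_add]
    congr 1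
    ring
  rw [hpow, hlow, mul_assoc]
  gcongr
  · exact dyad_anti (by linarith) h
  · exact le_rfl

/-- The constant in front of the weighted dyadic terms. -/
def termConst (σ : ℝ) : ℝ≥0∞ := 3 * 2 ^ (2 * σ) * (3 * 2 ^ (2 * σ)) * (triConst * 14)

/-- The constant of the cubic estimates. -/
def cubicConst (s σ : ℝ) : ℝ≥0∞ := termConst σ * (9 * lowConst s)

theorem cubicConst_ne_top {s : ℝ} (hs : 3 / 2 < s) {σ : ℝ} (hσ : 0 ≤ σ) : cubicConst s σ ≠ ⊤ := by
  have hlow : lowConst s ≠ ⊤ := tsum_dyad_ne_top (by linarith)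
  have hpow : (2 : ℝ≥0∞) ^ (2 * σ) ≠ ⊤ :=
    ENNReal.rpow_ne_top_of_nonneg (by positivity) (by norm_num)
  rw [cubicConst, termConst]
  finiteness

theorem weighted_le_paraTerm {σ α β γ : ℝ} {i j l : ℕ} (hjl : Near j l) {W G a b c : ℝ≥0∞}
    {U V X : ℕ → ℝ≥0∞} {x y w : ℕ → ℝ≥0∞}
    (hx : x i = dyad α i * U i) (hy : y j = dyad β j * V j) (hw : w l = dyad γ l * X l)
    (hW : W ≤ 3 * 2 ^ (2 * σ) * a) (hG : G ≤ b) (hab : a * b ≤ dyad α i * dyad β j * dyad γ l)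
    (hc : c = U i * V j * X l) :
    3 * 2 ^ (2 * σ) * W * (triConst * 14 * G * c) ≤ termConst σ * paraTerm x y w i j l := by
  rw [paraTerm, if_pos hjl, hx, hy, hw, hc, termConst]
  calc _ ≤ 3 * 2 ^ (2 * σ) * (3 * 2 ^ (2 * σ) * a) * (triConst * 14 * b * (U i * V j * X l)) := by
        gcongr
    _ = 3 * 2 ^ (2 * σ) * (3 * 2 ^ (2 * σ)) * (triConst * 14) * (a * b) * (U i * V j * X l) := by
        ring
    _ ≤ 3 * 2 ^ (2 * σ) * (3 * 2 ^ (2 * σ)) * (triConst * 14) *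
        (dyad α i * dyad β j * dyad γ l) * (U i * V j * X l) := by gcongr
    _ = _ := by ring

/-- The sum of the paraproduct terms with low index in each of the three slots, the second
factors `x'`, `y'`, `w'` serving the last two slots. -/
def paraSum (x y w x' y' w' : ℕ → ℝ≥0∞) (J : ℕ × ℕ × ℕ) : ℝ≥0∞ :=
  paraTerm x y w J.1 J.2.1 J.2.2 + paraTerm x' y' w' J.2.1 J.1 J.2.2 +
    paraTerm x' y' w' J.2.2 J.1 J.2.1

theorem tsum_paraSum_le (x y w x' y' w' : ℕ → ℝ≥0∞) :
    ∑' J, paraSum x y w x' y' w' J ≤ paraBound x y w + 2 * paraBound x' y' w' := by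
  simp_rw [paraSum, ENNReal.tsum_add]
  rw [two_mul, ← add_assoc]
  exact add_le_add (add_le_add (tsum_paraTerm_fst_le x y w) (tsum_paraTerm_snd_le x' y' w'))
    (tsum_paraTerm_thd_le x' y' w')

open Classical in
theorem tsum_dyad_mul_tsum_le_paraBound {σ : ℝ} (hσ : 0 ≤ σ) {D : ℕ × ℕ × ℕ → ℝ≥0∞} {C : ℝ≥0∞}
    {x y w x' y' w' : ℕ → ℝ≥0∞}
    (hD : ∀ J : ℕ × ℕ × ℕ, Admissible J → 3 * 2 ^ (2 * σ) *
      (dyad (2 * σ) J.1 + dyad (2 * σ) J.2.1 + dyad (2 * σ) J.2.2) * D J ≤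
        C * paraSum x y w x' y' w' J) :
    ∑' n, dyad (2 * σ) n * ∑' J : ℕ × ℕ × ℕ,
      (if Admissible J ∧ (Near n J.1 ∨ Near n J.2.1 ∨ Near n J.2.2) then D J else 0) ≤
    C * (paraBound x y w + 2 * paraBound x' y' w') := by
  refine (tsum_dyad_mul_tsum_le hσ D).trans
    ((ENNReal.tsum_le_tsum (g := fun J => C * paraSum x y w x' y' w' J) fun J => ?_).trans ?_)
  · split_ifs with hJ
    · exact hD J hJ
    · exact zero_le
  · rw [ENNReal.tsum_mul_left]
    gcongr
    exact tsum_paraSum_le x y w x' y' w'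

theorem weighted_dyadicTerm_half_le {s σ : ℝ} (hs : 1 ≤ s) (hσ : 0 ≤ σ) (T : ℝ)
    (z v : ℝ → Torus → ℝ) {J : ℕ × ℕ × ℕ} (hJ : Admissible J) :
    3 * 2 ^ (2 * σ) * (dyad (2 * σ) J.1 + dyad (2 * σ) J.2.1 + dyad (2 * σ) J.2.2) *
      dyadicTerm T z v J.1 J ≤
    termConst σ * paraSum (piece (s + (3 / 2 - s)) T z) (piece σ T v) (piece σ T v)
      (piece (0 + (3 / 2 - s)) T v) (piece (σ + s) T z) (piece σ T v) J := by
  rw [dyadicTerm, mul_assoc (triConst * 14 : ℝ≥0∞), paraSum, mul_add (termConst σ),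
    mul_add (termConst σ)]
  rcases hJ.cases with ⟨hle₂, hle₃, hnear⟩ | ⟨hle₁, hle₃, hnear⟩ | ⟨hle₁, hle₂, hnear⟩
  · refine le_trans ?_ (le_self_add.trans le_self_add)
    rw [min_eq_left (le_min hle₂ hle₃)]
    exact weighted_le_paraTerm hnear rfl rfl rfl (dyad_sum_le hσ hle₂ hle₃ hnear)
      (two_pow_mul_half J.1 s).le (le_of_eq (by ring)) rfl
  · refine le_trans ?_ (le_add_self.trans le_self_add)
    rw [min_eq_right ((min_le_left _ _).trans hle₁), min_eq_left hle₃,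
      add_comm (dyad (2 * σ) J.1)]
    exact weighted_le_paraTerm hnear rfl rfl rfl (dyad_sum_le hσ hle₁ hle₃ hnear)
      (two_pow_mul_half_le hs hle₁) (le_of_eq (by rw [dyad_add σ s]; ring)) (by ring)
  · refine le_trans ?_ le_add_self
    rw [min_eq_right ((min_le_right _ _).trans hle₁), min_eq_right hle₂,
      add_comm _ (dyad (2 * σ) J.2.2), ← add_assoc]
    exact weighted_le_paraTerm hnear rfl rfl rfl (dyad_sum_le hσ hle₁ hle₂ hnear)
      (two_pow_mul_half_le hs hle₁) (le_of_eq (by rw [dyad_add σ s]; ring)) (by ring)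

theorem weighted_dyadicTerm_full_le (s : ℝ) {σ : ℝ} (hσ : 0 ≤ σ) (T : ℝ) (v : ℝ → Torus → ℝ)
    {J : ℕ × ℕ × ℕ} (hJ : Admissible J) :
    3 * 2 ^ (2 * σ) * (dyad (2 * σ) J.1 + dyad (2 * σ) J.2.1 + dyad (2 * σ) J.2.2) *
      dyadicTerm T v v (min J.1 (min J.2.1 J.2.2)) J ≤
    termConst σ * paraSum (piece (s + (3 / 2 - s)) T v) (piece σ T v) (piece σ T v)
      (piece (s + (3 / 2 - s)) T v) (piece σ T v) (piece σ T v) J := by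
  rw [dyadicTerm, mul_assoc (triConst * 14 : ℝ≥0∞), paraSum, mul_add (termConst σ),
    mul_add (termConst σ)]
  rcases hJ.cases with ⟨hle₂, hle₃, hnear⟩ | ⟨hle₁, hle₃, hnear⟩ | ⟨hle₁, hle₂, hnear⟩
  · refine le_trans ?_ (le_self_add.trans le_self_add)
    rw [min_eq_left (le_min hle₂ hle₃)]
    exact weighted_le_paraTerm hnear rfl rfl rfl (dyad_sum_le hσ hle₂ hle₃ hnear)
      (two_pow_mul_half J.1 s).le (le_of_eq (by ring)) rfl
  · refine le_trans ?_ (le_add_self.trans le_self_add)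
    rw [min_eq_right ((min_le_left _ _).trans hle₁), min_eq_left hle₃,
      add_comm (dyad (2 * σ) J.1)]
    exact weighted_le_paraTerm hnear rfl rfl rfl (dyad_sum_le hσ hle₁ hle₃ hnear)
      (two_pow_mul_half J.2.1 s).le (le_of_eq (by ring)) (by ring)
  · refine le_trans ?_ le_add_self
    rw [min_eq_right ((min_le_right _ _).trans hle₁), min_eq_right hle₂,
      add_comm _ (dyad (2 * σ) J.2.2), ← add_assoc]
    exact weighted_le_paraTerm hnear rfl rfl rfl (dyad_sum_le hσ hle₁ hle₂ hnear)
      (two_pow_mul_half J.2.2 s).le (le_of_eq (by ring)) (by ring)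

open Classical in
theorem tsum_half_le {s σ : ℝ} (hs : 1 ≤ s) (hσ : 0 ≤ σ) (T : ℝ) (z v : ℝ → Torus → ℝ) :
    ∑' n, dyad (2 * σ) n * ∑' J : ℕ × ℕ × ℕ,
      (if Admissible J ∧ (Near n J.2.1 ∨ Near n J.2.2) then dyadicTerm T z v J.1 J else 0) ≤
    cubicConst s σ * (Fnorm s T z * Fnorm σ T v ^ 2 +
      Fnorm 0 T v * Fnorm σ T v * Fnorm (σ + s) T z) := by
  have hweaken (n : ℕ) (J : ℕ × ℕ × ℕ) :
      (if Admissible J ∧ (Near n J.2.1 ∨ Near n J.2.2) then dyadicTerm T z v J.1 J else 0) ≤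
      if Admissible J ∧ (Near n J.1 ∨ Near n J.2.1 ∨ Near n J.2.2) then
        dyadicTerm T z v J.1 J else 0 := by
    by_cases h : Admissible J ∧ (Near n J.2.1 ∨ Near n J.2.2)
    · rw [if_pos h, if_pos ⟨h.1, Or.inr h.2⟩]
    · rw [if_neg h]
      exact zero_le
  calc _ ≤ _ := ENNReal.tsum_le_tsum fun n =>
        mul_le_mul_right (ENNReal.tsum_le_tsum (hweaken n)) _
    _ ≤ _ := tsum_dyad_mul_tsum_le_paraBound hσ
        fun J hJ => weighted_dyadicTerm_half_le hs hσ T z v hJ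
    _ ≤ termConst σ * (3 * lowConst s * (Fnorm s T z * (Fnorm σ T v * Fnorm σ T v)) +
        2 * (3 * lowConst s * (Fnorm 0 T v * (Fnorm (σ + s) T z * Fnorm σ T v)))) := by
        gcongr <;> apply paraBound_piece_le
    _ = termConst σ * (lowConst s * (3 * (Fnorm s T z * Fnorm σ T v ^ 2) +
        6 * (Fnorm 0 T v * Fnorm σ T v * Fnorm (σ + s) T z))) := by ring
    _ ≤ termConst σ * (lowConst s * (9 * (Fnorm s T z * Fnorm σ T v ^ 2) +
        9 * (Fnorm 0 T v * Fnorm σ T v * Fnorm (σ + s) T z))) := by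
        gcongr <;> norm_num
    _ = _ := by
        rw [cubicConst]
        ring

open Classical in
theorem tsum_full_le (s : ℝ) {σ : ℝ} (hσ : 0 ≤ σ) (T : ℝ) (v : ℝ → Torus → ℝ) :
    ∑' n, dyad (2 * σ) n * ∑' J : ℕ × ℕ × ℕ,
      (if Admissible J ∧ (Near n J.1 ∨ Near n J.2.1 ∨ Near n J.2.2) then
        dyadicTerm T v v (min J.1 (min J.2.1 J.2.2)) J else 0) ≤
    cubicConst s σ * (Fnorm s T v * Fnorm σ T v ^ 2) :=
  calc _ ≤ _ := tsum_dyad_mul_tsum_le_paraBound hσ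
        fun J hJ => weighted_dyadicTerm_full_le s hσ T v hJ
    _ ≤ termConst σ * (3 * lowConst s * (Fnorm s T v * (Fnorm σ T v * Fnorm σ T v)) +
        2 * (3 * lowConst s * (Fnorm s T v * (Fnorm σ T v * Fnorm σ T v)))) := by
        gcongr <;> apply paraBound_piece_le
    _ = _ := by
        rw [cubicConst]
        ring

/-! ### The initial data -/

open Classical in
theorem ofReal_energy_le (n : ℕ) (f : Torus → ℝ) :
    ENNReal.ofReal (energy n f) ≤ ∑' k, (if Near n (idx k) then 1 else 0) * ‖coeff f k‖ₑ ^ 2 := by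
  rw [energy, ENNReal.ofReal_sum_of_nonneg fun k _ => mul_nonneg (wt_nonneg n k) (sq_nonneg _)]
  refine (Finset.sum_le_sum fun k _ => ?_).trans (ENNReal.sum_le_tsum (box n))
  rw [ENNReal.ofReal_mul (wt_nonneg n k), ENNReal.ofReal_pow (norm_nonneg _), ofReal_norm]
  gcongr
  split_ifs with hnear
  · exact ENNReal.ofReal_le_one.mpr (wt_le_one n k)
  · rw [nonpos_iff_eq_zero, ENNReal.ofReal_eq_zero]
    by_contra! hpos
    exact hnear (near_of_wt_ne_zero (mem_annulus_idx k) hpos.ne')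

theorem two_pow_idx_sq_le (k : ℤ × ℤ) : ((2 : ℝ) ^ idx k) ^ 2 ≤ 1 + len k ^ 2 := by
  rcases eq_or_ne (idx k) 0 with hzero | hpos
  · rw [hzero, pow_zero, one_pow]
    exact le_add_of_nonneg_right (sq_nonneg _)
  · have hsq : ((2 : ℝ) ^ idx k) ^ 2 ≤ len k ^ 2 := by
      gcongr
      exact le_len_of_mem_annulus (mem_annulus_idx k) hpos
    linarith

theorem dyad_idx_le {σ : ℝ} (hσ : 0 ≤ σ) (k : ℤ × ℤ) :
    dyad (2 * σ) (idx k) ≤ ENNReal.ofReal ((1 + (k.1 : ℝ) ^ 2 + (k.2 : ℝ) ^ 2) ^ σ) := by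
  have hsq : ((2 : ℝ≥0∞) ^ idx k) ^ (2 : ℝ) = ENNReal.ofReal ((2 ^ idx k) ^ 2) := by
    rw [ENNReal.ofReal_pow (by positivity), ENNReal.ofReal_pow (by positivity),
      ENNReal.ofReal_ofNat]
    exact ENNReal.rpow_two _
  rw [← ENNReal.ofReal_rpow_of_nonneg (by positivity) hσ, dyad, ENNReal.rpow_mul, hsq, add_assoc,
    ← len_sq]
  gcongr
  exact two_pow_idx_sq_le k

theorem Hnorm_sq (σ : ℝ) (f : Torus → ℝ) : Hnorm σ f ^ 2 = ∑' k : ℤ × ℤ,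
    ENNReal.ofReal ((1 + (k.1 : ℝ) ^ 2 + (k.2 : ℝ) ^ 2) ^ σ) * ‖coeff f k‖ₑ ^ 2 := by
  rw [Hnorm, ← ENNReal.rpow_natCast, ← ENNReal.rpow_mul]
  norm_num

theorem tsum_energy_le {σ : ℝ} (hσ : 0 ≤ σ) (f : Torus → ℝ) :
    ∑' n, dyad (2 * σ) n * ENNReal.ofReal (energy n f) ≤ 3 * 2 ^ (2 * σ) * Hnorm σ f ^ 2 := by
  classical
  calc _ ≤ ∑' n, dyad (2 * σ) n *
        ∑' k, (if Near n (idx k) then 1 else 0) * ‖coeff f k‖ₑ ^ 2 :=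
        ENNReal.tsum_le_tsum fun n => mul_le_mul_right (ofReal_energy_le n f) _
    _ = ∑' k, (∑' n, dyad (2 * σ) n * (if Near n (idx k) then 1 else 0)) * ‖coeff f k‖ₑ ^ 2 := by
        simp_rw [← ENNReal.tsum_mul_left, ← ENNReal.tsum_mul_right, mul_assoc]
        exact ENNReal.tsum_comm
    _ ≤ ∑' k, (3 * 2 ^ (2 * σ) * dyad (2 * σ) (idx k)) * ‖coeff f k‖ₑ ^ 2 :=
        ENNReal.tsum_le_tsum fun k => mul_le_mul_left (tsum_dyad_near_le (by positivity) _) _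
    _ ≤ _ := by
        simp_rw [mul_assoc (3 * 2 ^ (2 * σ) : ℝ≥0∞), ENNReal.tsum_mul_left]
        rw [Hnorm_sq]
        gcongr with k
        exact dyad_idx_le hσ k

theorem tsum_enorm_inner_sq_le (g : L2) :
    ∑' k, ‖inner ℂ (characterL2 k) g‖ₑ ^ 2 ≤ ‖g‖ₑ ^ 2 := by
  have hreal (k : ℤ × ℤ) : ‖inner ℂ (characterL2 k) g‖ₑ ^ 2 =
      ENNReal.ofReal (‖inner ℂ (characterL2 k) g‖ ^ 2) := by
    rw [ENNReal.ofReal_pow (norm_nonneg _), ofReal_norm]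
  simp_rw [hreal]
  rw [← ENNReal.ofReal_tsum_of_nonneg (fun k => sq_nonneg _)
    (orthonormal_characterL2.inner_products_summable g), ← ofReal_norm,
    ← ENNReal.ofReal_pow (norm_nonneg _)]
  exact ENNReal.ofReal_le_ofReal (orthonormal_characterL2.tsum_inner_products_le g)

theorem Hnorm_zero_le_L2norm {f : Torus → ℝ} (hf : Continuous f) : Hnorm 0 f ≤ L2norm f := by
  set F : C(Torus, ℂ) := ⟨fun p => (f p : ℂ), by fun_prop⟩ with hF
  set g : L2 := ContinuousMap.toLp 2 torusMeasure ℂ F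
  have hgF : g =ᵐ[torusMeasure] F := ContinuousMap.coeFn_toLp torusMeasure F
  have hcoeff (k : ℤ × ℤ) : coeff f k = inner ℂ (characterL2 k) g := by
    rw [L2.inner_def, coeff]
    have hk : characterL2 k =ᵐ[torusMeasure] character k :=
      ContinuousMap.coeFn_toLp torusMeasure (character k)
    refine integral_congr_ae ?_
    filter_upwards [hk, hgF] with p hp hp'
    rw [hp, hp', RCLike.inner_apply']
    rfl
  have hL2norm : L2norm f = ‖g‖ₑ := by
    rw [L2norm, Lp.enorm_def]
    refine eLpNorm_congr_norm_ae ?_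
    filter_upwards [hgF] with p hp
    rw [hp, hF]
    simp
  rw [hL2norm, ← ENNReal.pow_le_pow_left_iff two_ne_zero, Hnorm_sq]
  simpa [hcoeff] using tsum_enorm_inner_sq_le g

/-! ### Differences of solutions -/

theorem SmoothOn.add {T : ℝ} {w w' : ℝ → Torus → ℝ} (hw : SmoothOn T w) (hw' : SmoothOn T w') :
    SmoothOn T (w + w') :=
  ContDiffOn.add hw hw'

theorem SmoothOn.sub {T : ℝ} {w w' : ℝ → Torus → ℝ} (hw : SmoothOn T w) (hw' : SmoothOn T w') :
    SmoothOn T (w - w') :=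
  ContDiffOn.sub hw hw'

theorem tsum_mul_comp_sub_add_sub {a b : ℤ × ℤ → ℂ} (ha : Summable a) (hb : Summable b)
    (k : ℤ × ℤ) :
    ∑' l, (a + b) l * (a - b) (k - l) = ∑' l, a l * a (k - l) - ∑' l, b l * b (k - l) := by
  have hcomm : ∑' l, a l * b (k - l) = ∑' l, b l * a (k - l) := by
    rw [← (Equiv.subLeft k).tsum_eq]
    refine tsum_congr fun l => ?_
    simp [mul_comm]
  have haa := summable_mul_comp_sub ha ha k
  have hab := summable_mul_comp_sub ha hb k
  have hba := summable_mul_comp_sub hb ha k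
  have hbb := summable_mul_comp_sub hb hb k
  calc _ = ∑' l, (a l * a (k - l) - a l * b (k - l) + (b l * a (k - l) - b l * b (k - l))) := by
        refine tsum_congr fun l => ?_
        simp only [Pi.add_apply, Pi.sub_apply]
        ring
    _ = _ := by
        rw [(haa.sub hab).tsum_add (hba.sub hbb), haa.tsum_sub hab, hba.tsum_sub hbb, hcomm]
        ring

theorem IsSmoothSolution.isAdvected {T : ℝ} (hT : 0 < T) {u : ℝ → Torus → ℝ}
    (hu : IsSmoothSolution T u) : IsAdvected T u u :=
  fun _ ht => hu.hasDerivAt_coeff hT ht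

theorem IsSmoothSolution.isAdvected_sub {T : ℝ} (hT : 0 < T) {u₁ u₂ : ℝ → Torus → ℝ}
    (h₁ : IsSmoothSolution T u₁) (h₂ : IsSmoothSolution T u₂) :
    IsAdvected T (u₁ + u₂) (u₁ - u₂) := by
  intro t ht k
  have hsub (τ : ℝ) (hτ : τ ∈ Icc 0 T) : coeff ((u₁ - u₂) τ) = coeff (u₁ τ) - coeff (u₂ τ) :=
    funext (coeff_sub (h₁.smoothOn.continuous hτ) (h₂.smoothOn.continuous hτ))
  have ht' := Ioo_subset_Icc_self ht
  have hadd : coeff ((u₁ + u₂) t) = coeff (u₁ t) + coeff (u₂ t) :=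
    funext (coeff_add (h₁.smoothOn.continuous ht') (h₂.smoothOn.continuous ht'))
  have hderiv := (h₁.hasDerivAt_coeff hT ht k).sub (h₂.hasDerivAt_coeff hT ht k)
  refine (hderiv.congr_of_eventuallyEq ?_).congr_deriv ?_
  · filter_upwards [Ioo_mem_nhds ht.1 ht.2] with τ hτ
    rw [hsub τ (Ioo_subset_Icc_self hτ)]
    rfl
  · rw [hsub t ht', hadd, tsum_mul_comp_sub_add_sub (h₁.smoothOn.summable_coeff hT ht')
      (h₂.smoothOn.summable_coeff hT ht'), Pi.sub_apply]
    ring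

/-! ### Energy estimates -/

theorem Enorm_sq (σ T : ℝ) (u : ℝ → Torus → ℝ) :
    Enorm σ T u ^ 2 = ∑' j, dyad (2 * σ) j * ⨆ t ∈ Icc 0 T, ‖proj j (u t)‖ₑ ^ 2 := by
  rw [Enorm, ← ENNReal.rpow_natCast, ← ENNReal.rpow_mul]
  norm_num [dyad]

/-- The time integrals of the cubic forms, summed over the dyadic indices. -/
def cubic (σ T : ℝ) (z v : ℝ → Torus → ℝ) : ℝ≥0∞ :=
  ∑' n, dyad (2 * σ) n * ∫⁻ τ in Ico 0 T, ‖theta n (coeff (z τ)) (coeff (v τ))‖ₑ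

theorem IsAdvected.Enorm_sq_le {T : ℝ} {z v : ℝ → Torus → ℝ} (hzv : IsAdvected T z v)
    (hT : 0 < T) (hz : SmoothOn T z) (hv : SmoothOn T v) {σ : ℝ} (hσ : 0 ≤ σ) :
    Enorm σ T v ^ 2 ≤ 3 * 2 ^ (2 * σ) * Hnorm σ (v 0) ^ 2 + cubic σ T z v := by
  rw [Enorm_sq, cubic]
  refine (ENNReal.tsum_le_tsum fun n =>
    mul_le_mul_right (hzv.iSup_enorm_proj_sq_le hT hz hv n) _).trans ?_
  simp_rw [mul_add, ENNReal.tsum_add]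
  gcongr
  exact tsum_energy_le hσ (v 0)

theorem cubic_add_le (σ : ℝ) {T : ℝ} (hT : 0 < T) {z z' v : ℝ → Torus → ℝ} (hz : SmoothOn T z)
    (hz' : SmoothOn T z') (hv : SmoothOn T v) :
    cubic σ T (z + z') v ≤ cubic σ T z v + cubic σ T z' v := by
  rw [cubic, cubic, cubic, ← ENNReal.tsum_add]
  refine ENNReal.tsum_le_tsum fun n => ?_
  rw [← mul_add]
  gcongr
  rw [← lintegral_add_left' (((continuousOn_theta hT hz hv n).mono
    Ico_subset_Icc_self).aemeasurable measurableSet_Ico).enorm]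
  refine setLIntegral_mono' measurableSet_Ico fun τ hτ => ?_
  have hτ' := Ico_subset_Icc_self hτ
  have hadd : coeff ((z + z') τ) = coeff (z τ) + coeff (z' τ) :=
    funext (coeff_add (hz.continuous hτ') (hz'.continuous hτ'))
  rw [hadd, theta_add n (hz.summable_coeff hT hτ') (hz'.summable_coeff hT hτ')
    (hv.summable_coeff hT hτ')]
  exact enorm_add_le _ _

theorem cubic_le {s σ : ℝ} (hs : 1 ≤ s) (hσ : 0 ≤ σ) {T : ℝ} (hT : 0 < T) (hT1 : T ≤ 1)
    {z v : ℝ → Torus → ℝ} (hz : SmoothOn T z) (hv : SmoothOn T v) :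
    cubic σ T z v ≤ cubicConst s σ * (Fnorm s T z * Fnorm σ T v ^ 2 +
      Fnorm 0 T v * Fnorm σ T v * Fnorm (σ + s) T z) := by
  classical
  exact (ENNReal.tsum_le_tsum fun n => mul_le_mul_right
    (lintegral_theta_half_le hT hT1 hz hv n) _).trans (tsum_half_le hs hσ T z v)

theorem cubic_self_le (s : ℝ) {σ : ℝ} (hσ : 0 ≤ σ) {T : ℝ} (hT : 0 < T) (hT1 : T ≤ 1)
    {v : ℝ → Torus → ℝ} (hv : SmoothOn T v) :
    cubic σ T v v ≤ cubicConst s σ * (Fnorm s T v * Fnorm σ T v ^ 2) := by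
  classical
  exact (ENNReal.tsum_le_tsum fun n => mul_le_mul_right
    (lintegral_theta_full_le hT hT1 hv n) _).trans (tsum_full_le s hσ T v)

/-- A finite constant serving in all three energy estimates. -/
def energyConst (s : ℝ) : ℝ≥0∞ :=
  3 * 2 ^ (2 * s) + 3 + 2 * cubicConst s s + 2 * cubicConst s 0

theorem energyConst_ne_top {s : ℝ} (hs : 3 / 2 < s) : energyConst s ≠ ⊤ := by
  have hpow : (2 : ℝ≥0∞) ^ (2 * s) ≠ ⊤ :=
    ENNReal.rpow_ne_top_of_nonneg (by linarith) (by norm_num)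
  have hcubic := cubicConst_ne_top hs (σ := s) (by linarith)
  have hcubic₀ := cubicConst_ne_top hs le_rfl
  rw [energyConst]
  finiteness

theorem three_mul_two_rpow_le_energyConst (s : ℝ) : 3 * 2 ^ (2 * s) ≤ energyConst s := by
  rw [energyConst, add_assoc, add_assoc]
  exact le_self_add

theorem two_mul_cubicConst_le_energyConst (s : ℝ) : 2 * cubicConst s s ≤ energyConst s :=
  le_add_self.trans le_self_add

theorem Enorm_sq_le_of_solution {s : ℝ} (hs : 0 ≤ s) {T : ℝ} (hT : 0 < T) (hT1 : T ≤ 1)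
    {u : ℝ → Torus → ℝ} (hu : IsSmoothSolution T u) :
    Enorm s T u ^ 2 ≤ energyConst s * (Hnorm s (u 0) ^ 2 + Fnorm s T u ^ 3) :=
  calc _ ≤ _ := (hu.isAdvected hT).Enorm_sq_le hT hu.smoothOn hu.smoothOn hs
    _ ≤ 3 * 2 ^ (2 * s) * Hnorm s (u 0) ^ 2 +
        cubicConst s s * (Fnorm s T u * Fnorm s T u ^ 2) := by
        gcongr
        exact cubic_self_le s hs hT hT1 hu.smoothOn
    _ ≤ energyConst s * Hnorm s (u 0) ^ 2 +
        energyConst s * (Fnorm s T u * Fnorm s T u ^ 2) := by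
        gcongr
        · exact three_mul_two_rpow_le_energyConst s
        · exact (le_mul_of_one_le_left' one_le_two).trans (two_mul_cubicConst_le_energyConst s)
    _ = _ := by ring

theorem Enorm_zero_sq_le_of_sub {s : ℝ} (hs : 1 ≤ s) {T : ℝ} (hT : 0 < T) (hT1 : T ≤ 1)
    {u₁ u₂ : ℝ → Torus → ℝ} (h₁ : IsSmoothSolution T u₁) (h₂ : IsSmoothSolution T u₂) :
    Enorm 0 T (u₁ - u₂) ^ 2 ≤ energyConst s * (L2norm ((u₁ - u₂) 0) ^ 2 +
      Fnorm 0 T (u₁ - u₂) ^ 2 * (Fnorm s T u₁ + Fnorm s T u₂)) := by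
  have hu₁ := h₁.smoothOn
  have hu₂ := h₂.smoothOn
  have hadv := h₁.isAdvected_sub hT h₂
  set v := u₁ - u₂
  have hv : SmoothOn T v := hu₁.sub hu₂
  calc _ ≤ _ := hadv.Enorm_sq_le hT (hu₁.add hu₂) hv le_rfl
    _ ≤ 3 * L2norm (v 0) ^ 2 + (cubic 0 T u₁ v + cubic 0 T u₂ v) := by
        rw [mul_zero, ENNReal.rpow_zero, mul_one]
        gcongr
        · exact Hnorm_zero_le_L2norm (hv.continuous ⟨le_rfl, hT.le⟩)
        · exact cubic_add_le 0 hT hu₁ hu₂ hv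
    _ ≤ 3 * L2norm (v 0) ^ 2 + (cubicConst s 0 * (Fnorm s T u₁ * Fnorm 0 T v ^ 2 +
          Fnorm 0 T v * Fnorm 0 T v * Fnorm (0 + s) T u₁) +
        cubicConst s 0 * (Fnorm s T u₂ * Fnorm 0 T v ^ 2 +
          Fnorm 0 T v * Fnorm 0 T v * Fnorm (0 + s) T u₂)) := by
        gcongr
        · exact cubic_le hs le_rfl hT hT1 hu₁ hv
        · exact cubic_le hs le_rfl hT hT1 hu₂ hv
    _ = 3 * L2norm (v 0) ^ 2 +
        2 * cubicConst s 0 * (Fnorm 0 T v ^ 2 * (Fnorm s T u₁ + Fnorm s T u₂)) := by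
        rw [zero_add]
        ring
    _ ≤ energyConst s * L2norm (v 0) ^ 2 +
        energyConst s * (Fnorm 0 T v ^ 2 * (Fnorm s T u₁ + Fnorm s T u₂)) := by
        gcongr
        · rw [energyConst, add_assoc, add_assoc]
          exact le_self_add.trans le_add_self
        · exact le_add_self
    _ = _ := by ring

theorem Enorm_sq_le_of_sub {s : ℝ} (hs : 1 ≤ s) {T : ℝ} (hT : 0 < T) (hT1 : T ≤ 1)
    {u₁ u₂ : ℝ → Torus → ℝ} (h₁ : IsSmoothSolution T u₁) (h₂ : IsSmoothSolution T u₂) :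
    Enorm s T (u₁ - u₂) ^ 2 ≤ energyConst s * (Hnorm s ((u₁ - u₂) 0) ^ 2 +
      Fnorm s T (u₁ - u₂) ^ 3 + Fnorm s T (u₁ - u₂) ^ 2 * Fnorm s T u₂ +
        Fnorm 0 T (u₁ - u₂) * Fnorm s T (u₁ - u₂) * Fnorm (2 * s) T u₂) := by
  have hs0 : 0 ≤ s := zero_le_one.trans hs
  have hu₂ := h₂.smoothOn
  have hadv := h₁.isAdvected_sub hT h₂
  set v := u₁ - u₂ with hvdef
  have hv : SmoothOn T v := h₁.smoothOn.sub hu₂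
  have hsum : u₁ + u₂ = v + (u₂ + u₂) := by
    rw [hvdef]
    abel
  rw [hsum] at hadv
  calc _ ≤ _ := hadv.Enorm_sq_le hT (hv.add (hu₂.add hu₂)) hv hs0
    _ ≤ 3 * 2 ^ (2 * s) * Hnorm s (v 0) ^ 2 +
        (cubic s T v v + (cubic s T u₂ v + cubic s T u₂ v)) := by
        gcongr
        exact (cubic_add_le s hT hv (hu₂.add hu₂) hv).trans
          (add_le_add_right (cubic_add_le s hT hu₂ hu₂ hv) _)
    _ ≤ 3 * 2 ^ (2 * s) * Hnorm s (v 0) ^ 2 +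
        2 * (cubicConst s s * (Fnorm s T v * Fnorm s T v ^ 2) +
          cubicConst s s * (Fnorm s T u₂ * Fnorm s T v ^ 2 +
            Fnorm 0 T v * Fnorm s T v * Fnorm (s + s) T u₂)) := by
        rw [← two_mul, mul_add 2]
        gcongr
        · exact (cubic_self_le s hs0 hT hT1 hv).trans (le_mul_of_one_le_left' one_le_two)
        · exact cubic_le hs hs0 hT hT1 hu₂ hv
    _ = 3 * 2 ^ (2 * s) * Hnorm s (v 0) ^ 2 + 2 * cubicConst s s * (Fnorm s T v ^ 3 +
        Fnorm s T v ^ 2 * Fnorm s T u₂ + Fnorm 0 T v * Fnorm s T v * Fnorm (2 * s) T u₂) := by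
        rw [two_mul s]
        ring
    _ ≤ energyConst s * Hnorm s (v 0) ^ 2 + energyConst s * (Fnorm s T v ^ 3 +
        Fnorm s T v ^ 2 * Fnorm s T u₂ + Fnorm 0 T v * Fnorm s T v * Fnorm (2 * s) T u₂) := by
        gcongr
        · exact three_mul_two_rpow_le_energyConst s
        · exact two_mul_cubicConst_le_energyConst s
    _ = _ := by ring

end ZK

end

theorem mainTheorem8 (s : ℝ) (hs : 3 / 2 < s) :
    ∃ C : ℝ≥0, ∀ T : ℝ, 0 < T → T ≤ 1 →
      (∀ u : ℝ → ZK.Torus → ℝ, ZK.IsSmoothSolution T u →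
        ZK.Enorm s T u ^ 2 ≤ C * (ZK.Hnorm s (u 0) ^ 2 + ZK.Fnorm s T u ^ 3)) ∧
      (∀ u₁ u₂ v : ℝ → ZK.Torus → ℝ, ZK.IsSmoothSolution T u₁ → ZK.IsSmoothSolution T u₂ →
        v = u₁ - u₂ →
        ZK.Enorm 0 T v ^ 2 ≤ C * (ZK.L2norm (v 0) ^ 2
          + ZK.Fnorm 0 T v ^ 2 * (ZK.Fnorm s T u₁ + ZK.Fnorm s T u₂)) ∧
        ZK.Enorm s T v ^ 2 ≤ C * (ZK.Hnorm s (v 0) ^ 2 + ZK.Fnorm s T v ^ 3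
          + ZK.Fnorm s T v ^ 2 * ZK.Fnorm s T u₂
          + ZK.Fnorm 0 T v * ZK.Fnorm s T v * ZK.Fnorm (2 * s) T u₂)) := by
  have hs0 : 0 ≤ s := by linarith
  have hs1 : 1 ≤ s := by linarith
  refine ⟨(ZK.energyConst s).toNNReal, fun T hT hT1 => ?_⟩
  rw [ENNReal.coe_toNNReal (ZK.energyConst_ne_top hs)]
  refine ⟨fun u hu => ZK.Enorm_sq_le_of_solution hs0 hT hT1 hu, ?_⟩
  rintro u₁ u₂ v h₁ h₂ rfl
  exact ⟨ZK.Enorm_zero_sq_le_of_sub hs1 hT hT1 h₁ h₂, ZK.Enorm_sq_le_of_sub hs1 hT hT1 h₁ h₂⟩
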